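/- Let $(X,\|\cdot\|)$ be a finite dimensional real normed space, let $|\cdot|$ be the Euclidean norm of an inner product on $X$, let $(G,|\cdot|_G)$ be an Abelian group equipped with a norm that makes it a complete metric space, and let $1 \le m \le \dim X - 1$. For an integer $k\ge 0$, let $\mathcal P_k(X,G)$ be the group of polyhedral $G$ chains of dimension $k$ in $X$: finite formal sums $\sum_i g_i [\![\sigma_i]\!]$ with $g_i \in G$ and $\sigma_i$ oriented (nondegenerate) $k$-simplexes in $X$, with the identifications $(g+g')[\![\sigma]\!]=g[\![\sigma]\!]+g'[\![\sigma]\!]$, $g[\![-\sigma]\!] = (-g)[\![\sigma]\!]$ (where $-\sigma$ is $\sigma$ with the opposite orientation) and $g[\![\sigma]\!]=\sum_i g[\![\sigma_i]\!]$ whenever the $\sigma_i$ form a simplicial partition of $\sigma$ with the same orientation. Let $\partial : \mathcal P_k(X,G)\to\mathcal P_{k-1}(X,G)$, $k\ge 1$, be the usual boundary operator. The Hausdorff mass of $P\in\mathcal P_k(X,G)$ is $\mathcal M_H(P)=\sum_i |g_i|_G\,\mathcal H^k_{\|\cdot\|}(\sigma_i)$, where $P=\sum_i g_i[\![\sigma_i]\!]$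 with nonoverlapping $\sigma_i$, and where $\mathcal H^k_{\|\cdot\|}$ is the $k$-dimensional Hausdorff measure of $(X,\|\cdot\|)$; $\mathcal M_{H,|\cdot|}$ is defined in the same way from $\mathcal H^k_{|\cdot|}$. The flat norm of $P\in\mathcal P_m(X,G)$ is $$\mathcal F(P)=\inf\{\mathcal M_{H,|\cdot|}(Q)+\mathcal M_{H,|\cdot|}(R): Q\in\mathcal P_m(X,G),\ R\in\mathcal P_{m+1}(X,G),\ P=Q+\partial R\}.$$ Then the following are equivalent. (1) The triangle inequality for cycles holds: for all oriented $m$-simplexes $\sigma_1,\dots,\sigma_\kappa$ in $X$ and all $g_1,\dots,g_\kappa\in G$ (with $\kappa\ge1$) such that $\partial\big(\sum_{k=1}^\kappa g_k[\![\sigma_k]\!]\big)=0$, one has $$\mathcal M_H(g_1[\![\sigma_1]\!])\le\sum_{k=2}^\kappa \mathcal M_H(g_k[\![\sigma_k]\!]).$$ (2) The Hausdorff mass $\mathcal M_H$ is lower semicontinuous on $\mathcal P_m(X,G)$ with respect to $\mathcal F$ convergence: if $P,P_1,P_2,\dots\in\mathcal P_m(X,G)$ and $\mathcal F(P-P_j)\to0$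 as $j\to\infty$, then $\mathcal M_H(P)\le\liminf_j\mathcal M_H(P_j)$. -/

import Mathlib

open MeasureTheory Filter Topology
open scoped ENNReal

noncomputable section

namespace PolyhedralGChain

/-! ### Hausdorff measure -/

/-- The `m`-dimensional Hausdorff (outer) measure of a metric space, normalised as in geometric
measure theory: covers are weighted by `α(m) 2⁻ᵐ (diam E)ᵐ`, with `α(m)` the volume of the
Euclidean unit ball of dimension `m` (Mathlib's `μH[m]` uses the weight `(diam E)ᵐ`). -/
def hausdorff {Y : Type*} [EMetricSpace Y] (m : ℕ) (A : Set Y) : ℝ≥0∞ :=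
  letI : MeasurableSpace Y := borel Y
  haveI : BorelSpace Y := ⟨rfl⟩
  (volume (Metric.closedBall (0 : EuclideanSpace ℝ (Fin m)) 1) / 2 ^ m) *
    Measure.hausdorffMeasure (m : ℝ) A

/-- The `m`-dimensional Hausdorff measure on a real vector space for the Euclidean norm
`|x| = √⟨x, x⟩` of a given inner product. -/
def euclideanHausdorff {X : Type*} [AddCommGroup X] [Module ℝ X]
    (ip : InnerProductSpace.Core ℝ X) (m : ℕ) (A : Set X) : ℝ≥0∞ :=
  letI : NormedAddCommGroup X := ip.toNormedAddCommGroup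
  hausdorff m A

section Chains

variable {X : Type*} [AddCommGroup X] [Module ℝ X]

/-! ### Simplexes

An oriented `m`-simplex is given by its (affinely independent) vertices in some order. -/

/-- The simplex as a set. -/
def body {m : ℕ} (σ : Affine.Simplex ℝ X m) : Set X :=
  convexHull ℝ (Set.range σ.points)

/-- The relative interior of a simplex: points with positive barycentric coordinates. -/
def relInterior {m : ℕ} (σ : Affine.Simplex ℝ X m) : Set X :=
  {x | ∃ w : Fin (m + 1) → ℝ, (∀ i, 0 < w i) ∧ ∑ i, w i = 1 ∧ x = ∑ i, w i • σ.points i}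

/-- The facet of `σ` opposite to its `i`-th vertex, with the induced order of the vertices. -/
def facet {m : ℕ} (σ : Affine.Simplex ℝ X (m + 1)) (i : Fin (m + 2)) : Affine.Simplex ℝ X m where
  points := σ.points ∘ i.succAbove
  independent := σ.independent.comp_embedding i.succAboveEmb

/-- `τ` and `σ` are parallel and have the same orientation: the edge vectors of `τ` at its first
vertex are obtained from those of `σ` through a matrix of positive determinant. -/
def SameOrientation {m : ℕ} (σ τ : Affine.Simplex ℝ X m) : Prop :=
  ∃ A : Matrix (Fin m) (Fin m) ℝ, 0 < A.det ∧
    ∀ j : Fin m, τ.points j.succ - τ.points 0 =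
      ∑ i : Fin m, A i j • (σ.points i.succ - σ.points 0)

/-- `τ₁, …, τ_κ` is a simplicial partition of `σ`, all of them having the orientation of `σ`. -/
structure IsSimplicialPartition {m κ : ℕ} (σ : Affine.Simplex ℝ X m)
    (τ : Fin κ → Affine.Simplex ℝ X m) : Prop where
  iUnion_eq : ⋃ k, body (τ k) = body σ
  disjoint : ∀ k l, k ≠ l → Disjoint (relInterior (τ k)) (relInterior (τ l))
  orientation : ∀ k, SameOrientation σ (τ k)

variable (X) (G : Type*) [AddCommGroup G]

/-! ### Polyhedral chains -/

/-- Formal sums `∑ gₖ ⟦σₖ⟧` of oriented `m`-simplexes with coefficients in `G`. -/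
abbrev FormalChain (m : ℕ) := Affine.Simplex ℝ X m →₀ G

/-- The formal sums that are identified with zero. The first family of generators says that
reordering the vertices of `σ` by a permutation `e` turns `⟦σ⟧` into `sign(e) ⟦σ⟧` (an ordering
gives an orientation, and a change of orientation is a change of sign); the second one
says that `g ⟦σ⟧ = ∑ g ⟦τₖ⟧` for a simplicial partition `(τₖ)` of `σ` with the same orientation. -/
def relations (m : ℕ) : AddSubgroup (FormalChain X G m) :=
  AddSubgroup.closure
    ({c | ∃ (σ : Affine.Simplex ℝ X m) (e : Equiv.Perm (Fin (m + 1))) (g : G),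
        c = Finsupp.single (σ.reindex e) g -
          Finsupp.single σ (((Equiv.Perm.sign e : ℤˣ) : ℤ) • g)} ∪
     {c | ∃ (σ : Affine.Simplex ℝ X m) (κ : ℕ) (τ : Fin κ → Affine.Simplex ℝ X m) (g : G),
        IsSimplicialPartition σ τ ∧
        c = Finsupp.single σ g - ∑ k, Finsupp.single (τ k) g})

/-- The group `𝒫ₘ(X, G)` of polyhedral `G` chains of dimension `m` in `X`. -/
abbrev PolyhedralChain (m : ℕ) := FormalChain X G m ⧸ relations X G m

variable {X G}

/-- The polyhedral chain represented by a formal sum. -/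
abbrev toChain {m : ℕ} (c : FormalChain X G m) : PolyhedralChain X G m :=
  QuotientAddGroup.mk c

/-- The boundary of a formal sum: `∂ (g ⟦x₀, …, x_{m+1}⟧) = ∑ᵢ (-1)ⁱ g ⟦x₀, …, x̂ᵢ, …, x_{m+1}⟧`.
The boundary of the polyhedral chain `toChain c` is `toChain (formalBoundary c)`. -/
def formalBoundary {m : ℕ} (c : FormalChain X G (m + 1)) : FormalChain X G m :=
  c.sum fun σ g => ∑ i : Fin (m + 2), Finsupp.single (facet σ i) ((-1 : ℤ) ^ (i : ℕ) • g)

/-- The polyhedral chain represented by `c` has zero boundary (always true in dimension zero). -/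
def IsCycle : {m : ℕ} → FormalChain X G m → Prop
  | 0, _ => True
  | _ + 1, c => toChain (formalBoundary c) = 0

end Chains

section Mass

variable {X : Type*} [AddCommGroup X] [Module ℝ X] {G : Type*} [NormedAddCommGroup G]

/-- The simplexes of the formal sum `c` are nonoverlapping: they meet pairwise in sets of
measure zero for the `m`-dimensional measure `h`. -/
def NonOverlapping {m : ℕ} (h : Set X → ℝ≥0∞) (c : FormalChain X G m) : Prop :=
  ∀ σ ∈ c.support, ∀ τ ∈ c.support, σ ≠ τ → h (body σ ∩ body τ) = 0

/-- The mass of a polyhedral chain `P` with respect to an `m`-dimensional measure `h`: the value of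
`∑ |gₖ| h(σₖ)` for the representations `P = ∑ gₖ ⟦σₖ⟧` with nonoverlapping simplexes `σₖ`.
(For a Hausdorff measure all these representations give the same value, so that the
infimum is this common value.) -/
def mass {m : ℕ} (h : Set X → ℝ≥0∞) (P : PolyhedralChain X G m) : ℝ≥0∞ :=
  ⨅ (c : FormalChain X G m) (_ : toChain c = P) (_ : NonOverlapping h c),
    c.sum fun σ g => ‖g‖ₑ * h (body σ)

/-- The mass `ℳ_{H,|·|}` for the Hausdorff measure of the Euclidean norm. -/
def euclideanMass {m : ℕ} (ip : InnerProductSpace.Core ℝ X) (P : PolyhedralChain X G m) : ℝ≥0∞ :=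
  mass (euclideanHausdorff ip m) P

/-- The flat norm `ℱ(P) = inf { ℳ_{H,|·|}(Q) + ℳ_{H,|·|}(R) : P = Q + ∂R }`, where `Q` is a
polyhedral chain of dimension `m` and `R` is one of dimension `m + 1`, represented by the formal
sum `r`. -/
def flatNorm {m : ℕ} (ip : InnerProductSpace.Core ℝ X) (P : PolyhedralChain X G m) : ℝ≥0∞ :=
  ⨅ (Q : PolyhedralChain X G m) (r : FormalChain X G (m + 1))
    (_ : P = Q + toChain (formalBoundary r)),
    euclideanMass ip Q + euclideanMass ip (toChain r)

end Mass

section Criterion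

variable {X : Type*} [NormedAddCommGroup X] [NormedSpace ℝ X] {G : Type*} [NormedAddCommGroup G]

/-- The Hausdorff mass `ℳ_H = ℳ_{H,‖·‖}` for the given norm of `X`. -/
def hausdorffMass {m : ℕ} (P : PolyhedralChain X G m) : ℝ≥0∞ :=
  mass (hausdorff m) P

variable (X G)

/-- The triangle inequality for cycles: if `∂ (∑ gₖ ⟦σₖ⟧) = 0` then
`ℳ_H(g₀ ⟦σ₀⟧) ≤ ∑_{k ≥ 1} ℳ_H(gₖ ⟦σₖ⟧)`. -/
def TriangleInequalityForCycles (m : ℕ) : Prop :=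
  ∀ (κ : ℕ) (σ : Fin (κ + 1) → Affine.Simplex ℝ X m) (g : Fin (κ + 1) → G),
    IsCycle (∑ k, Finsupp.single (σ k) (g k)) →
    hausdorffMass (toChain (Finsupp.single (σ 0) (g 0))) ≤
      ∑ k : Fin κ, hausdorffMass (toChain (Finsupp.single (σ k.succ) (g k.succ)))

/-- Lower semicontinuity of `ℳ_H` on `𝒫ₘ(X, G)` with respect to `ℱ` convergence. -/
def HausdorffMassLowerSemicontinuous (ip : InnerProductSpace.Core ℝ X) (m : ℕ) : Prop :=
  ∀ (P : PolyhedralChain X G m) (Pseq : ℕ → PolyhedralChain X G m),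
    Tendsto (fun j => flatNorm ip (P - Pseq j)) atTop (𝓝 0) →
    hausdorffMass P ≤ liminf (fun j => hausdorffMass (Pseq j)) atTop

end Criterion

end PolyhedralGChain

end

open MeasureTheory Filter Topology
open scoped ENNReal

noncomputable section

namespace PolyhedralGChain

/-! ### Barycentric coordinates and planes of simplexes -/

section Coordinates

variable {X : Type*} [AddCommGroup X] [Module ℝ X] {m : ℕ}

/-! Everything rests on a pointwise description of polyhedral chains. Given a frame `L` of `m`
linear forms, a formal sum has at each point `x` a `density`: the sum of the coefficients of the
simplexes with `x` in their relative interior, signed by their orientation with respect to `L`. A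
formal sum represents zero exactly when its densities vanish off a finite union of affine subspaces
of dimension less than `m` (`nullChain_of_mem_relations`, `mem_relations_of_nullChain`). The
converse half uses a common refinement into simplexes meeting only along their boundaries
(`exists_common_refinement`). Boundaries fit this picture because the density of `∂c` is, up to
sign, a jump of the density of `c`; hence `∂` respects the relations
(`formalBoundary_mem_relations`). Mass is controlled by integrating the norm of the density
(`hausdorffMass_le_lintegral`).

The triangle inequality gives lower semicontinuity by localization. Write the limit as
nonoverlapping simplexes and write `p - T = Q + ∂R` with `Q` and `R` of small mass. Around each
simplex `σ` of `p` choose a thin polyhedral tube that meets no other simplex of `p`, the tubes being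
disjoint. Cutting `R` by the faces of the tube creates new `m`-dimensional pieces. By Eilenberg's
inequality and an averaging argument the levels of the faces can be chosen so that these pieces have
mass at most `C` times the mass of `R` (`exists_good_slice`, `exists_restriction_to_polyhedron`).
Inside the tube, `p` is a slightly shrunken copy of `σ` with the same coefficient, and it differs by
a boundary from the restriction of `T` plus a chain of small mass. The triangle inequality bounds
the mass of the copy (`TriangleInequalityForCycles.exists_local_bound`); the bounds add up over the
disjoint tubes, and finally the shrinking tends to zero.

Conversely, let `z = g₀σ₀ + w` be a cycle. A cone with generic apex gives `R` with `∂R = z`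
(`IsCycle.exists_filling`). Place `q ^ m` disjoint copies of `σ₀` of ratio `1 / (m q)` inside `σ₀`
and subtract the corresponding copies of `z` from `g₀σ₀`. The subtracted chain bounds the copies of
`R`, whose total mass is of order `1 / q`, so the result converges to `g₀σ₀` in the flat norm. Yet
the subtraction replaces the fixed fraction `ρ = m⁻ᵐ` of the mass of `σ₀` by at most `ρ` times the
mass of `w`. Lower semicontinuity then gives `A ≤ A - ρ A + ρ M(w)` with `A = M(g₀σ₀)`, and
cancelling yields the triangle inequality. -/

theorem affineMap_sum_smul {ι : Type*} [Fintype ι] (f : X →ᵃ[ℝ] ℝ) (w : ι → ℝ) (p : ι → X)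
    (hw : ∑ i, w i = 1) : f (∑ i, w i • p i) = ∑ i, w i * f (p i) := by
  have h : ∀ x, f x = f.linear x + f 0 := fun x => congrFun f.decomp x
  rw [h, map_sum, ← one_mul (f 0), ← hw, Finset.sum_mul, ← Finset.sum_add_distrib]
  refine Finset.sum_congr rfl fun i _ => ?_
  rw [h (p i), map_smul, smul_eq_mul, mul_add]

/-- The plane spanned by a simplex. -/
def plane (σ : Affine.Simplex ℝ X m) : AffineSubspace ℝ X :=
  affineSpan ℝ (Set.range σ.points)

theorem linearIndependent_edges (σ : Affine.Simplex ℝ X m) :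
    LinearIndependent ℝ fun j : Fin m => σ.points j.succ - σ.points 0 := by
  have h := (affineIndependent_iff_linearIndependent_vsub ℝ σ.points 0).1 σ.independent
  let e : Fin m → {x : Fin (m + 1) // x ≠ 0} := fun j => ⟨j.succ, Fin.succ_ne_zero j⟩
  have he : Function.Injective e := fun a b hab => by
    simpa [e] using hab
  exact h.comp e he

/-- A left inverse of the edge parametrization extends the edge coordinates to the whole space; the
coordinate of the first vertex is what is missing to `1`. -/
theorem exists_coord (σ : Affine.Simplex ℝ X m) :
    ∃ c : Fin (m + 1) → (X →ᵃ[ℝ] ℝ),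
      (∀ i j, c i (σ.points j) = if i = j then 1 else 0) ∧ ∀ x, ∑ i, c i x = 1 := by
  let E : (Fin m → ℝ) →ₗ[ℝ] X :=
    Fintype.linearCombination ℝ fun j : Fin m => σ.points j.succ - σ.points 0
  have hE : LinearMap.ker E = ⊥ :=
    LinearMap.ker_eq_bot.2 (linearIndependent_edges σ).fintypeLinearCombination_injective
  obtain ⟨K, hK⟩ := E.exists_leftInverse_of_injective hE
  have hK' : ∀ j : Fin m, K (σ.points j.succ - σ.points 0) = Pi.single j 1 := by
    intro j
    have := LinearMap.congr_fun hK (Pi.single j 1)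
    simpa [E, Fintype.linearCombination_apply, Pi.single_apply, ite_smul] using this
  let d : Fin m → (X →ᵃ[ℝ] ℝ) := fun i =>
    ((LinearMap.proj i : (Fin m → ℝ) →ₗ[ℝ] ℝ).comp K).toAffineMap.comp
      ((LinearMap.id (R := ℝ) (M := X)).toAffineMap - AffineMap.const ℝ X (σ.points 0))
  have hd : ∀ i x, d i x = K (x - σ.points 0) i := fun i x => by simp [d]
  let d0 : X →ᵃ[ℝ] ℝ := AffineMap.const ℝ X 1 - ∑ i, d i
  have hs : ∀ x, (∑ i, d i : X →ᵃ[ℝ] ℝ) x = ∑ i, d i x := by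
    intro x
    induction (Finset.univ : Finset (Fin m)) using Finset.induction_on with
    | empty => simp
    | insert a s ha ih => rw [Finset.sum_insert ha, Finset.sum_insert ha, ← ih]; rfl
  have hd0 : ∀ x, d0 x = 1 - ∑ i, d i x := fun x => by
    simp [d0, hs]
  refine ⟨Fin.cons d0 d, ?_, ?_⟩
  · intro i j
    refine Fin.cases ?_ (fun i => ?_) i <;> refine Fin.cases ?_ (fun j => ?_) j
    · simp [hd0, hd]
    · simp [hd0, hd, hK', (Fin.succ_ne_zero j).symm]
    · simp [hd]
    · simp [hd, hK', Pi.single_apply]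
  · intro x
    simp [Fin.sum_univ_succ, hd0]

/-- Affine functions on the whole space that extend the barycentric coordinates of a simplex. -/
def coord (σ : Affine.Simplex ℝ X m) : Fin (m + 1) → (X →ᵃ[ℝ] ℝ) :=
  (exists_coord σ).choose

theorem coord_points (σ : Affine.Simplex ℝ X m) (i j : Fin (m + 1)) :
    coord σ i (σ.points j) = if i = j then 1 else 0 :=
  (exists_coord σ).choose_spec.1 i j

theorem sum_coord (σ : Affine.Simplex ℝ X m) (x : X) : ∑ i, coord σ i x = 1 :=
  (exists_coord σ).choose_spec.2 x

/-- The affine projection onto the plane of a simplex given by its coordinates. -/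
def planeProj (σ : Affine.Simplex ℝ X m) (x : X) : X := ∑ i, coord σ i x • σ.points i

theorem coord_sum (σ : Affine.Simplex ℝ X m) (w : Fin (m + 1) → ℝ) (hw : ∑ i, w i = 1)
    (i : Fin (m + 1)) : coord σ i (∑ j, w j • σ.points j) = w i := by
  rw [affineMap_sum_smul _ _ _ hw]
  simp [coord_points]

theorem sum_mem_plane (σ : Affine.Simplex ℝ X m) (w : Fin (m + 1) → ℝ) (hw : ∑ i, w i = 1) :
    ∑ j, w j • σ.points j ∈ plane σ := by
  rw [← Finset.affineCombination_eq_linear_combination _ _ _ hw]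
  exact affineCombination_mem_affineSpan hw _

theorem mem_plane_iff {σ : Affine.Simplex ℝ X m} {x : X} : x ∈ plane σ ↔ planeProj σ x = x := by
  constructor
  · intro h
    obtain ⟨w, hw, rfl⟩ := eq_affineCombination_of_mem_affineSpan_of_fintype h
    rw [Finset.affineCombination_eq_linear_combination _ _ _ hw, planeProj]
    simp_rw [coord_sum σ w hw]
  · intro h
    rw [← h]
    exact sum_mem_plane σ _ (sum_coord σ x)

theorem eq_sum_coord {σ : Affine.Simplex ℝ X m} {x : X} (h : x ∈ plane σ) :
    x = ∑ i, coord σ i x • σ.points i := (mem_plane_iff.1 h).symm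

theorem points_mem_plane (σ : Affine.Simplex ℝ X m) (i : Fin (m + 1)) : σ.points i ∈ plane σ :=
  subset_affineSpan _ _ (Set.mem_range_self i)

theorem mem_relInterior_iff {σ : Affine.Simplex ℝ X m} {x : X} :
    x ∈ relInterior σ ↔ x ∈ plane σ ∧ ∀ i, 0 < coord σ i x := by
  constructor
  · rintro ⟨w, hw0, hw, rfl⟩
    exact ⟨sum_mem_plane σ w hw, fun i => by rw [coord_sum σ w hw]; exact hw0 i⟩
  · rintro ⟨h, h0⟩
    exact ⟨_, h0, sum_coord σ x, eq_sum_coord h⟩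

theorem mem_body_iff_exists {σ : Affine.Simplex ℝ X m} {x : X} :
    x ∈ body σ ↔ ∃ w : Fin (m + 1) → ℝ, (∀ i, 0 ≤ w i) ∧ ∑ i, w i = 1 ∧
      x = ∑ i, w i • σ.points i := by
  rw [body, convexHull_range_eq_exists_affineCombination]
  constructor
  · rintro ⟨s, w, h0, h1, rfl⟩
    refine ⟨fun i => if i ∈ s then w i else 0, fun i => ?_, ?_, ?_⟩
    · dsimp only
      split_ifs with h
      · exact h0 i h
      · exact le_rfl
    · simpa using h1
    · rw [Finset.affineCombination_eq_linear_combination _ _ _ h1]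
      simp
  · rintro ⟨w, h0, h1, rfl⟩
    exact ⟨Finset.univ, w, fun i _ => h0 i, h1,
      Finset.affineCombination_eq_linear_combination _ _ _ h1⟩

theorem mem_body_iff {σ : Affine.Simplex ℝ X m} {x : X} :
    x ∈ body σ ↔ x ∈ plane σ ∧ ∀ i, 0 ≤ coord σ i x := by
  rw [mem_body_iff_exists]
  constructor
  · rintro ⟨w, hw0, hw, rfl⟩
    exact ⟨sum_mem_plane σ w hw, fun i => by rw [coord_sum σ w hw]; exact hw0 i⟩
  · rintro ⟨h, h0⟩
    exact ⟨_, h0, sum_coord σ x, eq_sum_coord h⟩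

theorem relInterior_subset_body (σ : Affine.Simplex ℝ X m) : relInterior σ ⊆ body σ := by
  intro x hx
  rw [mem_relInterior_iff] at hx
  exact mem_body_iff.2 ⟨hx.1, fun i => (hx.2 i).le⟩

theorem body_subset_plane (σ : Affine.Simplex ℝ X m) : body σ ⊆ plane σ :=
  fun _ hx => (mem_body_iff.1 hx).1

theorem points_mem_body (σ : Affine.Simplex ℝ X m) (i : Fin (m + 1)) : σ.points i ∈ body σ :=
  subset_convexHull _ _ (Set.mem_range_self i)

theorem convex_body (σ : Affine.Simplex ℝ X m) : Convex ℝ (body σ) := convex_convexHull _ _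

/-- The barycenter of a simplex. -/
def barycenter (σ : Affine.Simplex ℝ X m) : X := ∑ i, ((m : ℝ) + 1)⁻¹ • σ.points i

theorem sum_barycenter_weights : ∑ _i : Fin (m + 1), ((m : ℝ) + 1)⁻¹ = 1 := by
  rw [Finset.sum_const, Finset.card_univ, Fintype.card_fin, nsmul_eq_mul]
  push_cast
  exact mul_inv_cancel₀ (by positivity)

theorem coord_barycenter (σ : Affine.Simplex ℝ X m) (i : Fin (m + 1)) :
    coord σ i (barycenter σ) = ((m : ℝ) + 1)⁻¹ :=
  coord_sum σ (fun _ => ((m : ℝ) + 1)⁻¹) sum_barycenter_weights i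

theorem barycenter_mem_relInterior (σ : Affine.Simplex ℝ X m) : barycenter σ ∈ relInterior σ :=
  ⟨fun _ => ((m : ℝ) + 1)⁻¹, fun _ => by positivity, sum_barycenter_weights, rfl⟩

theorem barycenter_mem_plane (σ : Affine.Simplex ℝ X m) : barycenter σ ∈ plane σ :=
  (mem_relInterior_iff.1 (barycenter_mem_relInterior σ)).1

theorem finrank_direction_plane (σ : Affine.Simplex ℝ X m) :
    Module.finrank ℝ (plane σ).direction = m := by
  rw [plane, direction_affineSpan]
  exact σ.independent.finrank_vectorSpan (by simp)

theorem plane_le_of_points {σ : Affine.Simplex ℝ X m} {A : AffineSubspace ℝ X}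
    (h : ∀ i, σ.points i ∈ A) : plane σ ≤ A :=
  affineSpan_le.2 (by rintro _ ⟨i, rfl⟩; exact h i)

theorem plane_eq_of_le [FiniteDimensional ℝ X] {σ : Affine.Simplex ℝ X m} {A : AffineSubspace ℝ X}
    (h : plane σ ≤ A) (hA : Module.finrank ℝ A.direction ≤ m) : plane σ = A := by
  apply AffineSubspace.eq_of_direction_eq_of_nonempty_of_le _ ⟨_, points_mem_plane σ 0⟩ h
  apply Submodule.eq_of_le_of_finrank_le (AffineSubspace.direction_le h)
  rwa [finrank_direction_plane]

theorem plane_eq_plane_of_le [FiniteDimensional ℝ X] {σ τ : Affine.Simplex ℝ X m}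
    (h : plane σ ≤ plane τ) : plane σ = plane τ :=
  plane_eq_of_le h (finrank_direction_plane τ).le

/-! ### Facets -/

theorem sum_succAbove {n : ℕ} {M : Type*} [AddCommMonoid M] (i : Fin (n + 1)) (f : Fin (n + 1) → M)
    (h : f i = 0) : ∑ j, f j = ∑ j : Fin n, f (i.succAbove j) := by
  rw [Fin.sum_univ_succAbove f i, h, zero_add]

theorem facet_points (σ : Affine.Simplex ℝ X (m + 1)) (i : Fin (m + 2)) (j : Fin (m + 1)) :
    (facet σ i).points j = σ.points (i.succAbove j) := rfl

theorem plane_facet_le (σ : Affine.Simplex ℝ X (m + 1)) (i : Fin (m + 2)) :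
    plane (facet σ i) ≤ plane σ :=
  plane_le_of_points fun j => points_mem_plane σ (i.succAbove j)

theorem coord_eq_zero_of_mem_plane_facet {σ : Affine.Simplex ℝ X (m + 1)} {i : Fin (m + 2)} {x : X}
    (hx : x ∈ plane (facet σ i)) : coord σ i x = 0 := by
  rw [eq_sum_coord hx, affineMap_sum_smul _ _ _ (sum_coord _ x)]
  refine Finset.sum_eq_zero fun j _ => ?_
  rw [facet_points, coord_points, if_neg (Fin.succAbove_ne i j).symm, mul_zero]

theorem mem_plane_facet_iff {σ : Affine.Simplex ℝ X (m + 1)} {i : Fin (m + 2)} {x : X} :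
    x ∈ plane (facet σ i) ↔ x ∈ plane σ ∧ coord σ i x = 0 := by
  refine ⟨fun h => ⟨plane_facet_le σ i h, coord_eq_zero_of_mem_plane_facet h⟩, fun ⟨h, h0⟩ => ?_⟩
  have hs := sum_coord σ x
  rw [sum_succAbove i _ h0] at hs
  have he := eq_sum_coord h
  rw [sum_succAbove i _ (by rw [h0, zero_smul])] at he
  rw [he]
  exact sum_mem_plane (facet σ i) _ hs

theorem coord_facet {σ : Affine.Simplex ℝ X (m + 1)} {i : Fin (m + 2)} {x : X}
    (hx : x ∈ plane (facet σ i)) (j : Fin (m + 1)) :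
    coord (facet σ i) j x = coord σ (i.succAbove j) x := by
  obtain ⟨h, h0⟩ := mem_plane_facet_iff.1 hx
  have hs := sum_coord σ x
  rw [sum_succAbove i _ h0] at hs
  have he := eq_sum_coord h
  rw [sum_succAbove i _ (by rw [h0, zero_smul])] at he
  conv_lhs => rw [he]
  exact coord_sum (facet σ i) _ hs j

theorem mem_relInterior_facet_iff {σ : Affine.Simplex ℝ X (m + 1)} {i : Fin (m + 2)} {x : X} :
    x ∈ relInterior (facet σ i) ↔
      x ∈ plane σ ∧ coord σ i x = 0 ∧ ∀ j, j ≠ i → 0 < coord σ j x := by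
  rw [mem_relInterior_iff]
  constructor
  · rintro ⟨h, h1⟩
    refine ⟨plane_facet_le σ i h, coord_eq_zero_of_mem_plane_facet h, fun j hj => ?_⟩
    obtain ⟨k, rfl⟩ := Fin.exists_succAbove_eq hj
    rw [← coord_facet h]
    exact h1 k
  · rintro ⟨h, h0, h1⟩
    have hx := mem_plane_facet_iff.2 ⟨h, h0⟩
    refine ⟨hx, fun j => ?_⟩
    rw [coord_facet hx]
    exact h1 _ (Fin.succAbove_ne i j)

theorem body_facet_subset (σ : Affine.Simplex ℝ X (m + 1)) (i : Fin (m + 2)) :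
    body (facet σ i) ⊆ body σ := by
  apply convexHull_mono
  rintro _ ⟨j, rfl⟩
  exact Set.mem_range_self _

end Coordinates

/-! ### Finite unions of affine subspaces of small dimension -/

section Small

variable {X : Type*} [AddCommGroup X] [Module ℝ X]

/-- `N` is contained in a finite union of affine subspaces of dimension less than `k`. -/
def Small (k : ℕ) (N : Set X) : Prop :=
  ∃ 𝒜 : Finset (AffineSubspace ℝ X), (∀ A ∈ 𝒜, Module.finrank ℝ A.direction < k) ∧
    N ⊆ ⋃ A ∈ 𝒜, (A : Set X)

theorem small_empty (k : ℕ) : Small k (∅ : Set X) := ⟨∅, by simp, by simp⟩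

theorem Small.mono {k : ℕ} {N N' : Set X} (h : Small k N) (h' : N' ⊆ N) : Small k N' := by
  obtain ⟨𝒜, h1, h2⟩ := h
  exact ⟨𝒜, h1, h'.trans h2⟩

theorem Small.union {k : ℕ} {N N' : Set X} (h : Small k N) (h' : Small k N') :
    Small k (N ∪ N') := by
  classical
  obtain ⟨𝒜, h1, h2⟩ := h
  obtain ⟨𝒜', h1', h2'⟩ := h'
  refine ⟨𝒜 ∪ 𝒜', fun A hA => ?_, ?_⟩
  · rcases Finset.mem_union.1 hA with h | h
    exacts [h1 A h, h1' A h]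
  · rw [Finset.set_biUnion_union]
    exact Set.union_subset_union h2 h2'

theorem Small.biUnion {k : ℕ} {ι : Type*} (s : Finset ι) (N : ι → Set X)
    (h : ∀ i ∈ s, Small k (N i)) : Small k (⋃ i ∈ s, N i) := by
  classical
  induction s using Finset.induction_on with
  | empty => simpa using small_empty k
  | insert a s ha ih =>
    rw [Finset.set_biUnion_insert]
    exact (h a (Finset.mem_insert_self a s)).union
      (ih fun i hi => h i (Finset.mem_insert_of_mem hi))

theorem Small.iUnion {k : ℕ} {ι : Type*} [Fintype ι] (N : ι → Set X)
    (h : ∀ i, Small k (N i)) : Small k (⋃ i, N i) := by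
  simpa using Small.biUnion Finset.univ N fun i _ => h i

theorem small_affineSubspace {k : ℕ} {A : AffineSubspace ℝ X}
    (h : Module.finrank ℝ A.direction < k) : Small k (A : Set X) :=
  ⟨{A}, by simpa using h, by simp⟩

theorem small_plane_inter [FiniteDimensional ℝ X] {k : ℕ} (σ : Affine.Simplex ℝ X k)
    {A : AffineSubspace ℝ X} (h : ¬ plane σ ≤ A) : Small k ((plane σ : Set X) ∩ A) := by
  rcases Set.eq_empty_or_nonempty ((plane σ : Set X) ∩ A) with h0 | h0
  · rw [h0]; exact small_empty k
  · have : ((plane σ ⊓ A : AffineSubspace ℝ X) : Set X) = (plane σ : Set X) ∩ A := rfl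
    rw [← this] at h0 ⊢
    refine small_affineSubspace ?_
    have hlt : plane σ ⊓ A < plane σ := inf_lt_left.2 h
    have := Submodule.finrank_lt_finrank_of_lt (AffineSubspace.direction_lt_of_nonempty hlt h0)
    rwa [finrank_direction_plane] at this

theorem small_plane_zero [FiniteDimensional ℝ X] {k : ℕ} (σ : Affine.Simplex ℝ X k)
    (f : X →ᵃ[ℝ] ℝ) {i : Fin (k + 1)} (h : f (σ.points i) ≠ 0) :
    Small k {x | x ∈ plane σ ∧ f x = 0} := by
  -- The zero set of `f`, as an affine subspace.
  let A : AffineSubspace ℝ X := (AffineSubspace.mk' (0 : ℝ) ⊥).comap f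
  have hA : ∀ x, x ∈ A ↔ f x = 0 := fun x => by simp [A]
  refine (small_plane_inter σ (A := A) fun hle => h ?_).mono fun x hx => ⟨hx.1, (hA x).2 hx.2⟩
  exact (hA _).1 (hle (points_mem_plane σ i))

theorem small_body_diff_relInterior [FiniteDimensional ℝ X] {k : ℕ} (σ : Affine.Simplex ℝ X k) :
    Small k (body σ \ relInterior σ) := by
  refine (Small.iUnion (fun i => {x | x ∈ plane σ ∧ coord σ i x = 0}) fun i =>
    small_plane_zero σ (coord σ i) (i := i) (by simp [coord_points])).mono ?_
  rintro x ⟨h1, h2⟩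
  rw [mem_body_iff] at h1
  rw [mem_relInterior_iff] at h2
  push Not at h2
  obtain ⟨i, hi⟩ := h2 h1.1
  exact Set.mem_iUnion.2 ⟨i, h1.1, le_antisymm hi (h1.2 i)⟩

end Small

section Density

variable {X : Type*} [AddCommGroup X] [Module ℝ X] {m : ℕ}

/-! ### Determinants of simplexes and orientation -/

/-- The matrix whose columns are `(1, L pⱼ)`. -/
def frameMatrix (L : Fin m → X →ₗ[ℝ] ℝ) (p : Fin (m + 1) → X) :
    Matrix (Fin (m + 1)) (Fin (m + 1)) ℝ :=
  Matrix.of fun i j => (Fin.cons 1 (fun l => L l (p j)) : Fin (m + 1) → ℝ) i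

/-- The oriented volume of the image of `p₀, …, pₘ` under `L`. -/
def frameDet (L : Fin m → X →ₗ[ℝ] ℝ) (p : Fin (m + 1) → X) : ℝ := (frameMatrix L p).det

/-- Subtracting the first column from the others leaves a single nonzero entry in the row of ones.
-/
theorem frameDet_eq_det_edges (L : Fin m → X →ₗ[ℝ] ℝ) (p : Fin (m + 1) → X) :
    frameDet L p = (Matrix.of fun i j : Fin m => L i (p j.succ - p 0)).det := by
  let B : Matrix (Fin (m + 1)) (Fin (m + 1)) ℝ := Matrix.of fun j i =>
    (Fin.cons (if j = 0 then 1 else 0)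
      (fun l => L l ((Fin.cons (p 0) (fun j => p j.succ - p 0) : Fin (m + 1) → X) j)) :
        Fin (m + 1) → ℝ) i
  have h : frameDet L p = B.det := by
    rw [frameDet, ← Matrix.det_transpose]
    refine Matrix.det_eq_of_forall_row_eq_smul_add_const (fun j => if j = 0 then 0 else 1) 0
      (by simp) fun j i => ?_
    refine Fin.cases ?_ (fun i => ?_) i <;> refine Fin.cases ?_ (fun j => ?_) j <;>
      simp [frameMatrix, B]
  rw [h, Matrix.det_succ_column_zero, Fin.sum_univ_succ, Finset.sum_eq_zero, add_zero]
  · rw [← Matrix.det_transpose]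
    simp only [B, Fin.val_zero, pow_zero, Matrix.of_apply, Fin.cons_zero, if_true, mul_one, one_mul]
    congr 1
  · intro j _
    simp [B]

theorem frameDet_comp_perm (L : Fin m → X →ₗ[ℝ] ℝ) (p : Fin (m + 1) → X)
    (e : Equiv.Perm (Fin (m + 1))) :
    frameDet L (p ∘ e) = ((Equiv.Perm.sign e : ℤˣ) : ℤ) * frameDet L p :=
  Matrix.det_permute' e (frameMatrix L p)

theorem frameDet_eq_mul_of_edges (L : Fin m → X →ₗ[ℝ] ℝ) {p q : Fin (m + 1) → X}
    (A : Matrix (Fin m) (Fin m) ℝ)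
    (h : ∀ j : Fin m, q j.succ - q 0 = ∑ i : Fin m, A i j • (p i.succ - p 0)) :
    frameDet L q = frameDet L p * A.det := by
  rw [frameDet_eq_det_edges, frameDet_eq_det_edges, ← Matrix.det_mul]
  congr 1
  ext i j
  simp [Matrix.mul_apply, h, map_sum, mul_comm]

theorem affineIndependent_of_frameDet_ne_zero {L : Fin m → X →ₗ[ℝ] ℝ} {p : Fin (m + 1) → X}
    (h : frameDet L p ≠ 0) : AffineIndependent ℝ p := by
  rw [affineIndependent_iff_linearIndependent_vsub ℝ p 0]
  have hl : LinearIndependent ℝ fun j : Fin m => p j.succ - p 0 := by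
    rw [Fintype.linearIndependent_iff]
    intro w hw
    rw [frameDet_eq_det_edges] at h
    have := Matrix.eq_zero_of_mulVec_eq_zero h (v := w) (by
      ext i
      have := congrArg (L i) hw
      simpa [Matrix.mulVec, dotProduct, map_sum, mul_comm] using this)
    exact fun i => congrFun this i
  let e : {x : Fin (m + 1) // x ≠ 0} → Fin m := fun x => x.1.pred x.2
  have he : Function.Injective e := fun a b hab => by
    simpa [e, Subtype.ext_iff] using hab
  have he' : (fun i : {x : Fin (m + 1) // x ≠ 0} => p i -ᵥ p 0) =
      (fun j : Fin m => p j.succ - p 0) ∘ e := by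
    ext x
    simp [e]
  rw [he']
  exact hl.comp e he

/-- The linear parts of the barycentric coordinates are dual to the edges. With such a frame the
density reads the coefficient of `σ` without a sign. -/
theorem exists_frameDet_eq_one (σ : Affine.Simplex ℝ X m) :
    ∃ L : Fin m → X →ₗ[ℝ] ℝ, frameDet L σ.points = 1 := by
  refine ⟨fun l => (coord σ l.succ).linear, ?_⟩
  rw [frameDet_eq_det_edges, ← Matrix.det_one (n := Fin m)]
  congr 1
  ext i j
  have : (coord σ i.succ).linear (σ.points j.succ - σ.points 0) =
      coord σ i.succ (σ.points j.succ) - coord σ i.succ (σ.points 0) := by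
    rw [← vsub_eq_sub, AffineMap.linearMap_vsub, vsub_eq_sub]
  rw [Matrix.of_apply, this]
  simp [coord_points, Matrix.one_apply]

/-- Multilinearity: of the combination placed in column `i`, only the part along the old column `i`
counts. -/
theorem frameDet_update (L : Fin m → X →ₗ[ℝ] ℝ) (p : Fin (m + 1) → X) (w : Fin (m + 1) → ℝ)
    (hw : ∑ i, w i = 1) (i : Fin (m + 1)) :
    frameDet L (Function.update p i (∑ k, w k • p k)) = w i * frameDet L p := by
  have : frameMatrix L (Function.update p i (∑ k, w k • p k)) =
      (frameMatrix L p).updateCol i (fun k => ∑ j, w j * frameMatrix L p k j) := by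
    ext a b
    rw [Matrix.updateCol_apply]
    split_ifs with h
    · subst h
      refine Fin.cases ?_ (fun a => ?_) a <;> simp [frameMatrix, hw, map_sum]
    · simp [frameMatrix, h]
  rw [frameDet, this]
  have := Matrix.det_updateCol_sum (frameMatrix L p) i w
  simp only [smul_eq_mul] at this
  rw [← frameDet] at this
  convert this using 3

theorem SameOrientation.exists_frameDet {σ τ : Affine.Simplex ℝ X m} (h : SameOrientation σ τ) :
    ∃ d : ℝ, 0 < d ∧ ∀ L : Fin m → X →ₗ[ℝ] ℝ, frameDet L τ.points = frameDet L σ.points * d := by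
  obtain ⟨A, hA, h⟩ := h
  exact ⟨A.det, hA, fun L => frameDet_eq_mul_of_edges L A h⟩

theorem SameOrientation.sign_eq {σ τ : Affine.Simplex ℝ X m} (h : SameOrientation σ τ)
    (L : Fin m → X →ₗ[ℝ] ℝ) :
    SignType.sign (frameDet L τ.points) = SignType.sign (frameDet L σ.points) := by
  obtain ⟨d, hd, h⟩ := h.exists_frameDet
  rw [h, sign_mul, sign_pos hd, mul_one]

theorem SameOrientation.refl (σ : Affine.Simplex ℝ X m) : SameOrientation σ σ :=
  ⟨1, by simp, fun j => by simp [Matrix.one_apply, ite_smul]⟩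

theorem SameOrientation.trans {σ τ ρ : Affine.Simplex ℝ X m} (h : SameOrientation σ τ)
    (h' : SameOrientation τ ρ) : SameOrientation σ ρ := by
  obtain ⟨A, hA, h⟩ := h
  obtain ⟨B, hB, h'⟩ := h'
  refine ⟨A * B, by rw [Matrix.det_mul]; positivity, fun j => ?_⟩
  rw [h']
  simp_rw [h, Finset.smul_sum, Matrix.mul_apply, Finset.sum_smul, smul_smul]
  rw [Finset.sum_comm]
  simp_rw [mul_comm]

theorem exists_edges_matrix {σ τ : Affine.Simplex ℝ X m} (h : plane τ ≤ plane σ) :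
    ∃ A : Matrix (Fin m) (Fin m) ℝ, ∀ j : Fin m, τ.points j.succ - τ.points 0 =
      ∑ i : Fin m, A i j • (σ.points i.succ - σ.points 0) := by
  refine ⟨Matrix.of fun i j => coord σ i.succ (τ.points j.succ) - coord σ i.succ (τ.points 0),
    fun j => ?_⟩
  have key : ∀ x ∈ plane σ,
      x = σ.points 0 + ∑ i : Fin m, coord σ i.succ x • (σ.points i.succ - σ.points 0) := by
    intro x hx
    have h1 := sum_coord σ x
    rw [Fin.sum_univ_succ] at h1
    conv_lhs => rw [eq_sum_coord hx, Fin.sum_univ_succ, eq_sub_of_add_eq h1]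
    simp only [smul_sub, Finset.sum_sub_distrib, sub_smul, one_smul, Finset.sum_smul]
    abel
  simp only [Matrix.of_apply, sub_smul, Finset.sum_sub_distrib]
  rw [← sub_eq_of_eq_add' (key _ (h (points_mem_plane τ j.succ))),
    ← sub_eq_of_eq_add' (key _ (h (points_mem_plane τ 0)))]
  abel

/-- In a common plane the determinants in any frame differ by the factor `A.det`, so a single frame
that is nondegenerate on `σ` detects its sign. -/
theorem sameOrientation_of_frameDet {σ τ : Affine.Simplex ℝ X m} (h : plane τ ≤ plane σ)
    {L : Fin m → X →ₗ[ℝ] ℝ} (hL : 0 < frameDet L σ.points * frameDet L τ.points) :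
    SameOrientation σ τ := by
  obtain ⟨A, hA⟩ := exists_edges_matrix h
  refine ⟨A, ?_, hA⟩
  rw [frameDet_eq_mul_of_edges L A hA, ← mul_assoc] at hL
  exact pos_of_mul_pos_right hL (mul_self_nonneg _)

theorem frameDet_ne_zero_of_plane_le {σ τ : Affine.Simplex ℝ X m} (h : plane τ ≤ plane σ)
    {L : Fin m → X →ₗ[ℝ] ℝ} (hL : frameDet L τ.points ≠ 0) : frameDet L σ.points ≠ 0 := by
  obtain ⟨A, hA⟩ := exists_edges_matrix h
  rw [frameDet_eq_mul_of_edges L A hA] at hL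
  exact left_ne_zero_of_mul hL

/-! ### The density of a formal chain -/

variable {G : Type*} [AddCommGroup G]

open Classical in
/-- The density at `x` of a formal sum, for the orientation given by `L`. -/
def density (L : Fin m → X →ₗ[ℝ] ℝ) (x : X) : FormalChain X G m →+ G :=
  Finsupp.liftAddHom fun σ =>
    if x ∈ relInterior σ then
      zsmulAddGroupHom ((SignType.sign (frameDet L σ.points) : SignType) : ℤ) else 0

open Classical in
theorem density_single (L : Fin m → X →ₗ[ℝ] ℝ) (x : X) (σ : Affine.Simplex ℝ X m) (g : G) :
    density L x (Finsupp.single σ g) =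
      if x ∈ relInterior σ then
        ((SignType.sign (frameDet L σ.points) : SignType) : ℤ) • g else 0 := by
  rw [density, Finsupp.liftAddHom_apply_single]
  split_ifs <;> simp

theorem density_single_of_mem {L : Fin m → X →ₗ[ℝ] ℝ} {x : X} {σ : Affine.Simplex ℝ X m}
    (h : x ∈ relInterior σ) (g : G) : density L x (Finsupp.single σ g) =
      ((SignType.sign (frameDet L σ.points) : SignType) : ℤ) • g := by
  rw [density_single, if_pos h]

theorem density_single_of_notMem {L : Fin m → X →ₗ[ℝ] ℝ} {x : X} {σ : Affine.Simplex ℝ X m}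
    (h : x ∉ relInterior σ) (g : G) : density L x (Finsupp.single σ g) = 0 := by
  rw [density_single, if_neg h]

theorem density_eq_sum (L : Fin m → X →ₗ[ℝ] ℝ) (x : X) (c : FormalChain X G m) :
    density L x c = ∑ σ ∈ c.support, density L x (Finsupp.single σ (c σ)) := by
  conv_lhs => rw [← Finsupp.sum_single c, Finsupp.sum, map_sum]

/-- The formal sum has zero density outside of a finite union of planes of smaller dimension. -/
def NullChain (c : FormalChain X G m) : Prop :=
  ∃ N : Set X, Small m N ∧ ∀ (L : Fin m → X →ₗ[ℝ] ℝ), ∀ x ∉ N, density L x c = 0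

theorem nullChain_zero : NullChain (0 : FormalChain X G m) :=
  ⟨∅, small_empty m, fun _ _ _ => map_zero _⟩

theorem NullChain.add {c c' : FormalChain X G m} (h : NullChain c) (h' : NullChain c') :
    NullChain (c + c') := by
  obtain ⟨N, hN, h⟩ := h
  obtain ⟨N', hN', h'⟩ := h'
  refine ⟨N ∪ N', hN.union hN', fun L x hx => ?_⟩
  rw [map_add, h L x fun hx' => hx (Or.inl hx'), h' L x fun hx' => hx (Or.inr hx'), add_zero]

theorem NullChain.neg {c : FormalChain X G m} (h : NullChain c) : NullChain (-c) := by
  obtain ⟨N, hN, h⟩ := h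
  exact ⟨N, hN, fun L x hx => by rw [map_neg, h L x hx, neg_zero]⟩

theorem NullChain.sub {c c' : FormalChain X G m} (h : NullChain c) (h' : NullChain c') :
    NullChain (c - c') := by
  rw [sub_eq_add_neg]; exact h.add h'.neg

theorem relInterior_reindex (σ : Affine.Simplex ℝ X m) (e : Equiv.Perm (Fin (m + 1))) :
    relInterior (σ.reindex e) = relInterior σ := by
  have key : ∀ (σ : Affine.Simplex ℝ X m) (e : Equiv.Perm (Fin (m + 1))),
      relInterior (σ.reindex e) ⊆ relInterior σ := by
    rintro σ e x ⟨w, h0, h1, rfl⟩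
    refine ⟨w ∘ e, fun i => h0 _, ?_, ?_⟩
    · rw [← h1]; exact Equiv.sum_comp e w
    · rw [← Equiv.sum_comp e]
      simp [Affine.Simplex.reindex]
  refine (key σ e).antisymm ?_
  have := key (σ.reindex e) e.symm
  rwa [← Affine.Simplex.reindex_trans, Equiv.self_trans_symm, Affine.Simplex.reindex_refl] at this

theorem body_reindex (σ : Affine.Simplex ℝ X m) (e : Equiv.Perm (Fin (m + 1))) :
    body (σ.reindex e) = body σ := by
  rw [body, body, Affine.Simplex.reindex_range_points]

theorem plane_reindex (σ : Affine.Simplex ℝ X m) (e : Equiv.Perm (Fin (m + 1))) :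
    plane (σ.reindex e) = plane σ := by
  rw [plane, plane, Affine.Simplex.reindex_range_points]

theorem frameDet_reindex (L : Fin m → X →ₗ[ℝ] ℝ) (σ : Affine.Simplex ℝ X m)
    (e : Equiv.Perm (Fin (m + 1))) :
    frameDet L (σ.reindex e).points = ((Equiv.Perm.sign e : ℤˣ) : ℤ) * frameDet L σ.points := by
  have : (σ.reindex e).points = σ.points ∘ e.symm := rfl
  rw [this, frameDet_comp_perm, Equiv.Perm.sign_symm]

theorem nullChain_reindex (σ : Affine.Simplex ℝ X m) (e : Equiv.Perm (Fin (m + 1))) (g : G) :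
    NullChain (Finsupp.single (σ.reindex e) g -
      Finsupp.single σ (((Equiv.Perm.sign e : ℤˣ) : ℤ) • g)) := by
  refine ⟨∅, small_empty m, fun L x _ => ?_⟩
  rw [map_sub, density_single, density_single, relInterior_reindex, frameDet_reindex]
  split_ifs
  · rcases Int.units_eq_one_or (Equiv.Perm.sign e) with h | h <;> simp [h, Left.sign_neg]
  · simp

/-- Off the relative boundaries, a point of `σ` lies in the interior of exactly one piece, which
carries the same sign. -/
theorem nullChain_partition [FiniteDimensional ℝ X] {κ : ℕ} {σ : Affine.Simplex ℝ X m}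
    {τ : Fin κ → Affine.Simplex ℝ X m} (h : IsSimplicialPartition σ τ) (g : G) :
    NullChain (Finsupp.single σ g - ∑ k, Finsupp.single (τ k) g) := by
  refine ⟨(body σ \ relInterior σ) ∪ ⋃ k, (body (τ k) \ relInterior (τ k)),
    (small_body_diff_relInterior σ).union (Small.iUnion _ fun k => small_body_diff_relInterior _),
    fun L x hx => ?_⟩
  rw [map_sub, map_sum]
  simp only [Set.mem_union, Set.mem_iUnion, not_or, not_exists, Set.mem_sdiff, not_and, not_not] at hx
  by_cases hxσ : x ∈ body σ
  · have hx' := hxσ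
    rw [← h.iUnion_eq, Set.mem_iUnion] at hx'
    obtain ⟨k, hk⟩ := hx'
    rw [Finset.sum_eq_single k, density_single_of_mem (hx.1 hxσ),
      density_single_of_mem (hx.2 k hk), (h.orientation k).sign_eq, sub_self]
    · intro l _ hl
      exact density_single_of_notMem
        (fun hx' => Set.disjoint_left.1 (h.disjoint l k hl) hx' (hx.2 k hk)) g
    · simp
  · rw [density_single_of_notMem fun hx' => hxσ (relInterior_subset_body σ hx'), zero_sub,
      neg_eq_zero]
    refine Finset.sum_eq_zero fun k _ => density_single_of_notMem (fun hx' => hxσ ?_) g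
    rw [← h.iUnion_eq]
    exact Set.mem_iUnion.2 ⟨k, relInterior_subset_body _ hx'⟩

/-- Makes the density, up to small sets, an invariant of the polyhedral chain and not only of the
formal sum. -/
theorem nullChain_of_mem_relations [FiniteDimensional ℝ X] {c : FormalChain X G m}
    (hc : c ∈ relations X G m) : NullChain c := by
  induction hc using AddSubgroup.closure_induction with
  | mem c hc =>
    rcases hc with ⟨σ, e, g, rfl⟩ | ⟨σ, κ, τ, g, h, rfl⟩
    · exact nullChain_reindex σ e g
    · exact nullChain_partition h g
  | zero => exact nullChain_zero
  | add _ _ _ _ h h' => exact h.add h'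
  | neg _ _ h => exact h.neg

end Density

/-! ### Cutting simplexes by affine functions -/

section Subdivision

variable {X : Type*} [AddCommGroup X] [Module ℝ X] {m : ℕ}

theorem nonneg_of_mem_body {f : X →ᵃ[ℝ] ℝ} {σ : Affine.Simplex ℝ X m}
    (h : ∀ i, 0 ≤ f (σ.points i)) {x : X} (hx : x ∈ body σ) : 0 ≤ f x := by
  obtain ⟨w, h0, h1, rfl⟩ := mem_body_iff_exists.1 hx
  rw [affineMap_sum_smul _ _ _ h1]
  exact Finset.sum_nonneg fun i _ => mul_nonneg (h0 i) (h i)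

theorem pos_of_mem_relInterior {f : X →ᵃ[ℝ] ℝ} {σ : Affine.Simplex ℝ X m}
    (h : ∀ i, 0 ≤ f (σ.points i)) {i : Fin (m + 1)} (hi : f (σ.points i) ≠ 0) {x : X}
    (hx : x ∈ relInterior σ) : 0 < f x := by
  obtain ⟨w, h0, h1, rfl⟩ := hx
  rw [affineMap_sum_smul _ _ _ h1]
  exact Finset.sum_pos' (fun i _ => mul_nonneg (h0 i).le (h i))
    ⟨i, Finset.mem_univ i, mul_pos (h0 i) (lt_of_le_of_ne (h i) hi.symm)⟩

theorem eq_zero_of_mem_plane {f : X →ᵃ[ℝ] ℝ} {σ : Affine.Simplex ℝ X m}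
    (h : ∀ i, f (σ.points i) = 0) {x : X} (hx : x ∈ plane σ) : f x = 0 := by
  rw [eq_sum_coord hx, affineMap_sum_smul _ _ _ (sum_coord σ x)]
  simp [h]

theorem plane_eq_of_body_subset [FiniteDimensional ℝ X] {σ τ : Affine.Simplex ℝ X m}
    (h : body τ ⊆ body σ) : plane τ = plane σ :=
  plane_eq_plane_of_le (plane_le_of_points fun i => body_subset_plane σ (h (points_mem_body τ i)))

/-- Each coordinate of `σ` is nonnegative at the vertices of `τ`, and not zero at all of them
because the planes agree; so it is positive inside `τ`. -/
theorem relInterior_subset_of_body_subset [FiniteDimensional ℝ X] {σ τ : Affine.Simplex ℝ X m}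
    (h : body τ ⊆ body σ) : relInterior τ ⊆ relInterior σ := by
  intro x hx
  have hp := plane_eq_of_body_subset h
  refine mem_relInterior_iff.2 ⟨hp ▸ (mem_relInterior_iff.1 hx).1, fun i => ?_⟩
  have h0 : ∀ j, 0 ≤ coord σ i (τ.points j) := fun j =>
    (mem_body_iff.1 (h (points_mem_body τ j))).2 i
  by_cases hj : ∃ j, coord σ i (τ.points j) ≠ 0
  · obtain ⟨j, hj⟩ := hj
    exact pos_of_mem_relInterior h0 hj hx
  · push Not at hj
    have := eq_zero_of_mem_plane hj (hp ▸ points_mem_plane σ i)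
    simp [coord_points] at this

/-- A finite set of nonoverlapping simplexes with union and orientation those of `σ`. -/
structure Subdivides (𝒯 : Finset (Affine.Simplex ℝ X m)) (σ : Affine.Simplex ℝ X m) : Prop where
  biUnion_eq : ⋃ τ ∈ 𝒯, body τ = body σ
  disjoint : ∀ τ ∈ 𝒯, ∀ τ' ∈ 𝒯, τ ≠ τ' → Disjoint (relInterior τ) (relInterior τ')
  orientation : ∀ τ ∈ 𝒯, SameOrientation σ τ

theorem Subdivides.refl (σ : Affine.Simplex ℝ X m) : Subdivides {σ} σ where
  biUnion_eq := by simp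
  disjoint := by simp
  orientation := by simpa using SameOrientation.refl σ

theorem Subdivides.body_subset {𝒯 : Finset (Affine.Simplex ℝ X m)} {σ τ : Affine.Simplex ℝ X m}
    (h : Subdivides 𝒯 σ) (hτ : τ ∈ 𝒯) : body τ ⊆ body σ := by
  rw [← h.biUnion_eq]
  exact Set.subset_biUnion_of_mem (u := fun τ => body τ) hτ

theorem Subdivides.exists_mem {𝒯 : Finset (Affine.Simplex ℝ X m)} {σ : Affine.Simplex ℝ X m}
    (h : Subdivides 𝒯 σ) {x : X} (hx : x ∈ body σ) : ∃ τ ∈ 𝒯, x ∈ body τ := by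
  rw [← h.biUnion_eq] at hx
  simpa using hx

theorem Subdivides.isSimplicialPartition {𝒯 : Finset (Affine.Simplex ℝ X m)}
    {σ : Affine.Simplex ℝ X m} (h : Subdivides 𝒯 σ) :
    IsSimplicialPartition σ fun k => (𝒯.equivFin.symm k).1 where
  iUnion_eq := by
    rw [← h.biUnion_eq]
    refine (𝒯.equivFin.symm.surjective.iUnion_comp fun τ : 𝒯 => body τ.1).trans ?_
    exact Set.iUnion_subtype (· ∈ 𝒯) fun τ => body τ.1
  disjoint k l hkl := h.disjoint _ (𝒯.equivFin.symm k).2 _ (𝒯.equivFin.symm l).2 fun he =>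
    hkl (𝒯.equivFin.symm.injective (Subtype.ext he))
  orientation k := h.orientation _ (𝒯.equivFin.symm k).2

theorem Subdivides.sub_mem_relations {G : Type*} [AddCommGroup G]
    {𝒯 : Finset (Affine.Simplex ℝ X m)} {σ : Affine.Simplex ℝ X m} (h : Subdivides 𝒯 σ) (g : G) :
    Finsupp.single σ g - ∑ τ ∈ 𝒯, Finsupp.single τ g ∈ relations X G m := by
  refine AddSubgroup.subset_closure (Or.inr ⟨σ, _, _, g, h.isSimplicialPartition, ?_⟩)
  congr 1
  rw [← Finset.sum_coe_sort]
  exact (Equiv.sum_comp 𝒯.equivFin.symm fun τ : 𝒯 => Finsupp.single τ.1 g).symm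

open Classical in
theorem Subdivides.biUnion [FiniteDimensional ℝ X] {𝒯 : Finset (Affine.Simplex ℝ X m)}
    {σ : Affine.Simplex ℝ X m} (h : Subdivides 𝒯 σ)
    {𝒮 : Affine.Simplex ℝ X m → Finset (Affine.Simplex ℝ X m)}
    (h' : ∀ τ ∈ 𝒯, Subdivides (𝒮 τ) τ) : Subdivides (𝒯.biUnion 𝒮) σ where
  biUnion_eq := by
    rw [Finset.set_biUnion_biUnion, ← h.biUnion_eq]
    exact Set.iUnion₂_congr fun τ hτ => (h' τ hτ).biUnion_eq
  disjoint ρ hρ ρ' hρ' hne := by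
    obtain ⟨τ, hτ, hρ⟩ := Finset.mem_biUnion.1 hρ
    obtain ⟨τ', hτ', hρ'⟩ := Finset.mem_biUnion.1 hρ'
    by_cases he : τ = τ'
    · subst he
      exact (h' τ hτ).disjoint ρ hρ ρ' hρ' hne
    · exact (h.disjoint τ hτ τ' hτ' he).mono
        (relInterior_subset_of_body_subset ((h' τ hτ).body_subset hρ))
        (relInterior_subset_of_body_subset ((h' τ' hτ').body_subset hρ'))
  orientation ρ hρ := by
    obtain ⟨τ, hτ, hρ⟩ := Finset.mem_biUnion.1 hρ
    exact (h.orientation τ hτ).trans ((h' τ hτ).orientation ρ hρ)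

/-- Vertex `i` is moved to the point that divides the edge from `i` to `j` in the ratio `t : 1 - t`.
This keeps the part of `σ` on the side of vertex `j`; exchanging `i` with `j` and `t` with `1 - t`
gives the other part. -/
theorem exists_cut (σ : Affine.Simplex ℝ X m) {i j : Fin (m + 1)} (hij : i ≠ j) {t : ℝ}
    (h0 : 0 < t) (h1 : t < 1) : ∃ τ : Affine.Simplex ℝ X m,
      τ.points = Function.update σ.points i ((1 - t) • σ.points i + t • σ.points j) ∧
      SameOrientation σ τ ∧
      (∀ x, x ∈ body τ ↔ x ∈ body σ ∧ t * coord σ i x ≤ (1 - t) * coord σ j x) ∧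
      ∀ x ∈ relInterior τ, t * coord σ i x < (1 - t) * coord σ j x := by
  have ht : 0 < 1 - t := by linarith
  let w : Fin (m + 1) → ℝ := Pi.single i (1 - t) + Pi.single j t
  have hw : ∑ k, w k = 1 := by
    simp [w, Finset.sum_add_distrib]
  have hr : ∑ k, w k • σ.points k = (1 - t) • σ.points i + t • σ.points j := by
    simp [w, add_smul, Finset.sum_add_distrib, Pi.single_apply, ite_smul]
  have hwi : w i = 1 - t := by simp [w, hij]
  have hD : ∀ L : Fin m → X →ₗ[ℝ] ℝ, frameDet L (Function.update σ.points i
      ((1 - t) • σ.points i + t • σ.points j)) = (1 - t) * frameDet L σ.points := fun L => by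
    rw [← hr, frameDet_update L _ w hw, hwi]
  obtain ⟨L, hL⟩ := exists_frameDet_eq_one σ
  have hne : frameDet L (Function.update σ.points i
      ((1 - t) • σ.points i + t • σ.points j)) ≠ 0 := by
    rw [hD, hL]; linarith
  let τ : Affine.Simplex ℝ X m := ⟨_, affineIndependent_of_frameDet_ne_zero hne⟩
  have hτ : τ.points = Function.update σ.points i ((1 - t) • σ.points i + t • σ.points j) := rfl
  have hpl : plane τ ≤ plane σ := plane_le_of_points fun k => by
    rw [hτ]
    by_cases hk : k = i
    · subst hk
      rw [Function.update_self, ← hr]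
      exact sum_mem_plane σ w hw
    · rw [Function.update_of_ne hk]
      exact points_mem_plane σ k
  have hsum : ∀ v : Fin (m + 1) → ℝ, ∑ k, v k • τ.points k =
      ∑ k, (v + Pi.single j (t * v i) - Pi.single i (t * v i) : Fin (m + 1) → ℝ) k • σ.points k := by
    intro v
    have e1 : ∀ k, v k • τ.points k =
        v k • σ.points k + if k = i then (t * v i) • (σ.points j - σ.points i) else 0 := by
      intro k
      rw [hτ]
      by_cases hk : k = i
      · subst hk
        rw [Function.update_self, if_pos rfl]
        module
      · rw [Function.update_of_ne hk, if_neg hk, add_zero]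
    simp only [e1, Pi.add_apply, Pi.sub_apply, add_smul, sub_smul, Finset.sum_add_distrib,
      Finset.sum_sub_distrib, Finset.sum_ite_eq', Finset.mem_univ, if_true, Pi.single_apply,
      ite_smul, zero_smul]
    rw [smul_sub, add_sub_assoc]
  have hsum1 : ∀ v : Fin (m + 1) → ℝ, ∑ k, v k = 1 →
      ∑ k, (v + Pi.single j (t * v i) - Pi.single i (t * v i) : Fin (m + 1) → ℝ) k = 1 := by
    intro v hv
    simp [Finset.sum_add_distrib, Finset.sum_sub_distrib, hv]
  refine ⟨τ, hτ, sameOrientation_of_frameDet hpl (L := L) ?_, fun x => ⟨?_, ?_⟩, ?_⟩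
  · rw [hτ, hD, hL]; linarith
  · intro hx
    obtain ⟨v, hv0, hv, rfl⟩ := mem_body_iff_exists.1 hx
    rw [hsum, mem_body_iff_exists, coord_sum _ _ (hsum1 v hv), coord_sum _ _ (hsum1 v hv)]
    refine ⟨⟨_, fun k => ?_, hsum1 v hv, rfl⟩, ?_⟩
    · have := hv0 k
      have := mul_nonneg h0.le (hv0 i)
      have := mul_nonneg ht.le (hv0 i)
      by_cases hki : k = i
      · subst hki
        simp [hij]; nlinarith
      · by_cases hkj : k = j
        · subst hkj; simp [hki]; nlinarith
        · simp [hki, hkj, hv0 k]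
    · have := hv0 j
      simp [hij, hij.symm]
      nlinarith
  · rintro ⟨hx, hle⟩
    obtain ⟨v, hv0, hv, rfl⟩ := mem_body_iff_exists.1 hx
    rw [coord_sum _ _ hv, coord_sum _ _ hv] at hle
    -- Inverse of the change of barycentric coordinates `hsum`.
    let u : Fin (m + 1) → ℝ := v + Pi.single i (t / (1 - t) * v i) - Pi.single j (t / (1 - t) * v i)
    have hui : u i = v i / (1 - t) := by
      simp [u, hij]; field_simp; ring
    have hu1 : ∑ k, u k = 1 := by
      simp [u, Finset.sum_add_distrib, Finset.sum_sub_distrib, hv]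
    have huv : (u + Pi.single j (t * u i) - Pi.single i (t * u i) : Fin (m + 1) → ℝ) = v := by
      have : t * u i = t / (1 - t) * v i := by rw [hui]; ring
      rw [this]
      simp only [u]; abel
    refine mem_body_iff_exists.2 ⟨u, fun k => ?_, hu1, by rw [hsum, huv]⟩
    by_cases hki : k = i
    · rw [hki, hui]; exact div_nonneg (hv0 i) ht.le
    · by_cases hkj : k = j
      · subst hkj
        have : u k = v k - t * v i / (1 - t) := by simp [u, hki]; ring
        rw [this, sub_nonneg, div_le_iff₀ ht]
        linarith
      · have : u k = v k := by simp [u, hki, hkj]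
        rw [this]; exact hv0 k
  · rintro x ⟨v, hv0, hv, rfl⟩
    rw [hsum, coord_sum _ _ (hsum1 v hv), coord_sum _ _ (hsum1 v hv)]
    have := hv0 j
    simp [hij, hij.symm]
    nlinarith

/-- The affine function `f` does not change sign on the simplex. -/
def Uncut (f : X →ᵃ[ℝ] ℝ) (σ : Affine.Simplex ℝ X m) : Prop :=
  (∀ i, 0 ≤ f (σ.points i)) ∨ ∀ i, f (σ.points i) ≤ 0

theorem nonpos_of_mem_body {f : X →ᵃ[ℝ] ℝ} {σ : Affine.Simplex ℝ X m}
    (h : ∀ i, f (σ.points i) ≤ 0) {x : X} (hx : x ∈ body σ) : f x ≤ 0 := by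
  have := nonneg_of_mem_body (f := -f) (σ := σ) (fun i => by simpa using h i) hx
  simpa using this

theorem Uncut.of_body_subset {f : X →ᵃ[ℝ] ℝ} {σ τ : Affine.Simplex ℝ X m} (h : Uncut f σ)
    (hs : body τ ⊆ body σ) : Uncut f τ := by
  rcases h with h | h
  · exact Or.inl fun i => nonneg_of_mem_body h (hs (points_mem_body τ i))
  · exact Or.inr fun i => nonpos_of_mem_body h (hs (points_mem_body τ i))

open Classical in
-- Induction on the number of vertices where `f` is not zero: cutting an edge at a zero of `f`
-- produces two simplexes, each with one such vertex fewer. The bound on the number of pieces makes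
-- the constants for slices uniform.
theorem exists_subdivides_uncut [FiniteDimensional ℝ X] (f : X →ᵃ[ℝ] ℝ)
    (σ : Affine.Simplex ℝ X m) : ∃ 𝒯 : Finset (Affine.Simplex ℝ X m), Subdivides 𝒯 σ ∧
      (∀ τ ∈ 𝒯, Uncut f τ) ∧ 𝒯.card ≤ 2 ^ (m + 1) := by
  suffices h : ∀ (n : ℕ) (σ : Affine.Simplex ℝ X m),
      (Finset.univ.filter fun k => f (σ.points k) ≠ 0).card ≤ n →
      ∃ 𝒯 : Finset (Affine.Simplex ℝ X m), Subdivides 𝒯 σ ∧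
        (∀ τ ∈ 𝒯, Uncut f τ) ∧ 𝒯.card ≤ 2 ^ n by
    refine h (m + 1) σ ((Finset.card_filter_le _ _).trans (by simp))
  intro n
  induction n with
  | zero =>
    intro σ hσ
    refine ⟨{σ}, Subdivides.refl σ, ?_, by simp⟩
    rw [Nat.le_zero, Finset.card_eq_zero, Finset.filter_eq_empty_iff] at hσ
    intro τ hτ
    rw [Finset.mem_singleton.1 hτ]
    exact Or.inl fun i => (not_not.1 (hσ (Finset.mem_univ i))).ge
  | succ n ih =>
    intro σ hσ
    by_cases hu : Uncut f σ
    · exact ⟨{σ}, Subdivides.refl σ, by simpa using hu, by simpa using Nat.one_le_two_pow⟩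
    · simp only [Uncut, not_or, not_forall, not_le] at hu
      obtain ⟨⟨j, hj⟩, i, hi⟩ := hu
      have hij : i ≠ j := fun h => by rw [h] at hi; linarith
      -- The parameter of the zero of `f` on the edge from vertex `i`, where `f > 0`, to vertex `j`,
      -- where `f < 0`.
      set t : ℝ := f (σ.points i) / (f (σ.points i) - f (σ.points j)) with ht
      have hd : 0 < f (σ.points i) - f (σ.points j) := by linarith
      have h0 : 0 < t := div_pos hi hd
      have h1 : t < 1 := by rw [ht, div_lt_one hd]; linarith
      have hfr : f ((1 - t) • σ.points i + t • σ.points j) = 0 := by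
        have := affineMap_sum_smul f ![1 - t, t] ![σ.points i, σ.points j] (by simp)
        simp only [Fin.sum_univ_two, Matrix.cons_val_zero, Matrix.cons_val_one] at this
        rw [this, ht]
        field_simp
        ring
      obtain ⟨τ, hτ, ho, hb, hr⟩ := exists_cut σ hij h0 h1
      obtain ⟨τ', hτ', ho', hb', hr'⟩ := exists_cut σ hij.symm (t := 1 - t) (by linarith)
        (by linarith)
      rw [sub_sub_cancel, add_comm (t • σ.points j)] at hτ'
      simp only [sub_sub_cancel] at hb' hr'
      have hcard : ∀ (k : Fin (m + 1)) (ρ : Affine.Simplex ℝ X m), f (σ.points k) ≠ 0 →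
          ρ.points = Function.update σ.points k ((1 - t) • σ.points i + t • σ.points j) →
          (Finset.univ.filter fun k => f (ρ.points k) ≠ 0).card ≤ n := by
        intro k ρ hk hρ
        refine Nat.le_of_lt_succ (lt_of_lt_of_le (Finset.card_lt_card ?_) hσ)
        refine (Finset.ssubset_iff_of_subset ?_).2 ⟨k, by simpa using hk, by simp [hρ, hfr]⟩
        intro l hl
        rw [Finset.mem_filter] at hl ⊢
        refine ⟨Finset.mem_univ _, fun h => hl.2 ?_⟩
        rw [hρ]
        by_cases hlk : l = k
        · rw [hlk, Function.update_self, hfr]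
        · rw [Function.update_of_ne hlk, h]
      obtain ⟨𝒯, h𝒯, hu, hc⟩ := ih τ (hcard i τ hi.ne' hτ)
      obtain ⟨𝒯', h𝒯', hu', hc'⟩ := ih τ' (hcard j τ' hj.ne hτ')
      refine ⟨𝒯 ∪ 𝒯', ?_, ?_, ?_⟩
      · refine ⟨?_, ?_, ?_⟩
        · rw [Finset.set_biUnion_union, h𝒯.biUnion_eq, h𝒯'.biUnion_eq]
          ext x
          rw [Set.mem_union, hb, hb', ← and_or_left]
          exact ⟨fun h => h.1, fun h => ⟨h, le_total _ _⟩⟩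
        · have key : ∀ ρ ∈ 𝒯, ∀ ρ' ∈ 𝒯', Disjoint (relInterior ρ) (relInterior ρ') := by
            intro ρ hρ ρ' hρ'
            rw [Set.disjoint_left]
            intro x hx hx'
            have h2 := hr x (relInterior_subset_of_body_subset (h𝒯.body_subset hρ) hx)
            have h3 := hr' x (relInterior_subset_of_body_subset (h𝒯'.body_subset hρ') hx')
            linarith
          intro ρ hρ ρ' hρ' hne
          rcases Finset.mem_union.1 hρ with hρ | hρ <;> rcases Finset.mem_union.1 hρ' with hρ' | hρ'
          · exact h𝒯.disjoint ρ hρ ρ' hρ' hne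
          · exact key ρ hρ ρ' hρ'
          · exact (key ρ' hρ' ρ hρ).symm
          · exact h𝒯'.disjoint ρ hρ ρ' hρ' hne
        · intro ρ hρ
          rcases Finset.mem_union.1 hρ with hρ | hρ
          · exact ho.trans (h𝒯.orientation ρ hρ)
          · exact ho'.trans (h𝒯'.orientation ρ hρ)
      · intro ρ hρ
        rcases Finset.mem_union.1 hρ with hρ | hρ
        exacts [hu ρ hρ, hu' ρ hρ]
      · refine (Finset.card_union_le _ _).trans ?_
        rw [pow_succ]
        omega

open Classical in
theorem exists_subdivides_forall_uncut [FiniteDimensional ℝ X] (𝓕 : Finset (X →ᵃ[ℝ] ℝ))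
    (σ : Affine.Simplex ℝ X m) : ∃ 𝒯 : Finset (Affine.Simplex ℝ X m), Subdivides 𝒯 σ ∧
      ∀ τ ∈ 𝒯, ∀ f ∈ 𝓕, Uncut f τ := by
  induction 𝓕 using Finset.induction_on with
  | empty => exact ⟨{σ}, Subdivides.refl σ, by simp⟩
  | insert f 𝓕 _ ih =>
    obtain ⟨𝒯, h𝒯, hu⟩ := ih
    choose 𝒮 h𝒮 hu' _ using fun τ : Affine.Simplex ℝ X m => exists_subdivides_uncut f τ
    refine ⟨𝒯.biUnion 𝒮, h𝒯.biUnion fun τ _ => h𝒮 τ, fun ρ hρ f' hf' => ?_⟩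
    obtain ⟨τ, hτ, hρ⟩ := Finset.mem_biUnion.1 hρ
    rcases Finset.mem_insert.1 hf' with rfl | hf'
    · exact hu' τ ρ hρ
    · exact (hu τ hτ f' hf').of_body_subset ((h𝒮 τ).body_subset hρ)

end Subdivision

/-! ### Affine images, normal coordinates and homotheties -/

section Maps

variable {X : Type*} [AddCommGroup X] [Module ℝ X] {m : ℕ}

theorem affineMap_finset_sum_apply {ι : Type*} (s : Finset ι) (d : ι → X →ᵃ[ℝ] ℝ) (x : X) :
    (∑ i ∈ s, d i) x = ∑ i ∈ s, d i x := by
  classical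
  induction s using Finset.induction_on with
  | empty => simp
  | insert a s ha ih => rw [Finset.sum_insert ha, Finset.sum_insert ha, ← ih]; rfl

theorem affineMap_sum_smul_eq {Y : Type*} [AddCommGroup Y] [Module ℝ Y] {ι : Type*} [Fintype ι]
    (f : X →ᵃ[ℝ] Y) (w : ι → ℝ) (p : ι → X)
    (hw : ∑ i, w i = 1) : f (∑ i, w i • p i) = ∑ i, w i • f (p i) := by
  have h : ∀ x, f x = f.linear x + f 0 := fun x => congrFun f.decomp x
  rw [h, map_sum, ← one_smul ℝ (f 0), ← hw, Finset.sum_smul, ← Finset.sum_add_distrib]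
  refine Finset.sum_congr rfl fun i _ => ?_
  rw [h (p i), map_smul, smul_add]

theorem body_map (σ : Affine.Simplex ℝ X m) (f : X →ᵃ[ℝ] X) (hf : Function.Injective f) :
    body (σ.map f hf) = f '' body σ := by
  ext x
  simp only [mem_body_iff_exists, Set.mem_image]
  constructor
  · rintro ⟨w, h0, h1, rfl⟩
    exact ⟨_, ⟨w, h0, h1, rfl⟩, affineMap_sum_smul_eq f w _ h1⟩
  · rintro ⟨_, ⟨w, h0, h1, rfl⟩, rfl⟩
    exact ⟨w, h0, h1, affineMap_sum_smul_eq f w _ h1⟩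

theorem relInterior_map (σ : Affine.Simplex ℝ X m) (f : X →ᵃ[ℝ] X) (hf : Function.Injective f) :
    relInterior (σ.map f hf) = f '' relInterior σ := by
  ext x
  simp only [relInterior, Set.mem_ofPred_eq, Set.mem_image]
  constructor
  · rintro ⟨w, h0, h1, rfl⟩
    exact ⟨_, ⟨w, h0, h1, rfl⟩, affineMap_sum_smul_eq f w _ h1⟩
  · rintro ⟨_, ⟨w, h0, h1, rfl⟩, rfl⟩
    exact ⟨w, h0, h1, affineMap_sum_smul_eq f w _ h1⟩

/-- Affine functions that vanish together exactly on the plane of a simplex. -/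
def normalCoord [FiniteDimensional ℝ X] (σ : Affine.Simplex ℝ X m)
    (j : Fin (Module.finrank ℝ X)) : X →ᵃ[ℝ] ℝ :=
  ((Module.finBasis ℝ X).coord j).toAffineMap -
    ∑ i, ((Module.finBasis ℝ X).coord j (σ.points i)) • coord σ i

theorem normalCoord_apply [FiniteDimensional ℝ X] (σ : Affine.Simplex ℝ X m)
    (j : Fin (Module.finrank ℝ X)) (x : X) :
    normalCoord σ j x = (Module.finBasis ℝ X).coord j (x - planeProj σ x) := by
  have : (normalCoord σ j) x = (Module.finBasis ℝ X).coord j x -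
      (∑ i, ((Module.finBasis ℝ X).coord j (σ.points i)) • coord σ i) x := rfl
  rw [this, affineMap_finset_sum_apply, map_sub, planeProj, map_sum]
  congr 1
  refine Finset.sum_congr rfl fun i _ => ?_
  rw [map_smul, smul_eq_mul, mul_comm]
  rfl

theorem mem_plane_iff_normalCoord [FiniteDimensional ℝ X] {σ : Affine.Simplex ℝ X m} {x : X} :
    x ∈ plane σ ↔ ∀ j, normalCoord σ j x = 0 := by
  simp_rw [normalCoord_apply, mem_plane_iff]
  rw [Module.Basis.forall_coord_eq_zero_iff, sub_eq_zero, eq_comm]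

theorem homothety_injective (b : X) {r : ℝ} (hr : r ≠ 0) :
    Function.Injective (AffineMap.homothety b r) := by
  intro x y h
  simp only [AffineMap.homothety_apply, vsub_eq_sub, vadd_eq_add, add_left_inj] at h
  exact sub_left_injective (smul_right_injective X hr h)

theorem affineMap_homothety_apply (f : X →ᵃ[ℝ] ℝ) (b x : X) (r : ℝ) :
    f (AffineMap.homothety b r x) = (1 - r) * f b + r * f x := by
  rw [AffineMap.homothety_eq_lineMap, AffineMap.apply_lineMap, AffineMap.lineMap_apply_module,
    smul_eq_mul, smul_eq_mul]

theorem homothety_mem {A : AffineSubspace ℝ X} {b x : X} (hb : b ∈ A) (hx : x ∈ A) (r : ℝ) :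
    AffineMap.homothety b r x ∈ A := by
  rw [AffineMap.homothety_eq_lineMap]
  exact AffineMap.lineMap_mem r hb hx

theorem homothety_mem_relInterior {σ : Affine.Simplex ℝ X m} {b x : X} (hb : b ∈ relInterior σ)
    (hx : x ∈ body σ) {r : ℝ} (h0 : 0 ≤ r) (h1 : r < 1) :
    AffineMap.homothety b r x ∈ relInterior σ := by
  rw [mem_relInterior_iff] at hb ⊢
  rw [mem_body_iff] at hx
  refine ⟨homothety_mem hb.1 hx.1 r, fun i => ?_⟩
  rw [affineMap_homothety_apply]
  have := mul_pos (sub_pos.2 h1) (hb.2 i)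
  have := mul_nonneg h0 (hx.2 i)
  linarith

/-- A homothety of `σ` about its barycenter with large ratio covers any finite set of points of the
plane. -/
theorem exists_body_superset [FiniteDimensional ℝ X] (σ : Affine.Simplex ℝ X m) (Y : Finset X)
    (hY : ∀ y ∈ Y, y ∈ plane σ) :
    ∃ S : Affine.Simplex ℝ X m, plane S = plane σ ∧ ∀ y ∈ Y, y ∈ body S := by
  set R : ℝ := ∑ y ∈ Y, ∑ i, |coord σ i y| with hR
  have hR0 : 0 ≤ R := Finset.sum_nonneg fun y _ => Finset.sum_nonneg fun i _ => abs_nonneg _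
  have hRy : ∀ y ∈ Y, ∀ i, -coord σ i y ≤ R := fun y hy i =>
    ((neg_le_abs _).trans (Finset.single_le_sum (f := fun i => |coord σ i y|)
      (fun i _ => abs_nonneg _) (Finset.mem_univ i))).trans
      (Finset.single_le_sum (f := fun y => ∑ i, |coord σ i y|)
        (fun y _ => Finset.sum_nonneg fun i _ => abs_nonneg _) hy)
  -- With this ratio, contracting `y` by `ρ⁻¹` turns its coordinates into `ρ⁻¹ * (R + coord σ i y)`,
  -- which `hRy` makes nonnegative.
  set ρ : ℝ := 1 + (m + 1) * R with hρ
  have hρ0 : 0 < ρ := by positivity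
  have hb := barycenter_mem_plane σ
  refine ⟨σ.map (AffineMap.homothety (barycenter σ) ρ) (homothety_injective _ hρ0.ne'), ?_, ?_⟩
  · refine plane_eq_plane_of_le (plane_le_of_points fun i => ?_)
    exact homothety_mem hb (points_mem_plane σ i) ρ
  · intro y hy
    rw [body_map]
    refine ⟨AffineMap.homothety (barycenter σ) ρ⁻¹ y, mem_body_iff.2
      ⟨homothety_mem hb (hY y hy) _, fun i => ?_⟩, ?_⟩
    · rw [affineMap_homothety_apply, coord_barycenter]
      have h1 := hRy y hy i
      have : (1 - ρ⁻¹) * ((m : ℝ) + 1)⁻¹ + ρ⁻¹ * coord σ i y = ρ⁻¹ * (R + coord σ i y) := by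
        rw [hρ]; field_simp; ring
      rw [this]
      exact mul_nonneg (inv_nonneg.2 hρ0.le) (by linarith)
    · rw [← AffineMap.comp_apply, ← AffineMap.homothety_mul, mul_inv_cancel₀ hρ0.ne']
      simp

/-- A common point could be pushed slightly towards the barycenter of `τ`: it would enter the
interior of `τ` without leaving that of `σ`, which is open in the common plane. -/
theorem relInterior_disjoint_body [FiniteDimensional ℝ X] {σ τ : Affine.Simplex ℝ X m}
    (h : Disjoint (relInterior σ) (relInterior τ)) (hp : plane τ = plane σ) :
    Disjoint (relInterior σ) (body τ) := by
  rw [Set.disjoint_left]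
  intro x hx hxτ
  have hbσ : barycenter τ ∈ plane σ := hp ▸ barycenter_mem_plane τ
  have hx' := mem_relInterior_iff.1 hx
  have hev : ∀ᶠ r : ℝ in 𝓝[<] 1, AffineMap.homothety (barycenter τ) r x ∈ relInterior σ := by
    have : ∀ i, ∀ᶠ r : ℝ in 𝓝[<] 1, 0 < coord σ i (AffineMap.homothety (barycenter τ) r x) := by
      intro i
      have hc : Continuous fun r : ℝ => coord σ i (AffineMap.homothety (barycenter τ) r x) := by
        simp_rw [affineMap_homothety_apply]
        fun_prop
      have h1 : 0 < coord σ i (AffineMap.homothety (barycenter τ) (1 : ℝ) x) := by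
        simpa using hx'.2 i
      exact ((hc.continuousAt (x := 1)).eventually (lt_mem_nhds h1)).filter_mono
        nhdsWithin_le_nhds
    filter_upwards [Filter.eventually_all.2 this] with r hr
    exact mem_relInterior_iff.2 ⟨homothety_mem hbσ hx'.1 r, hr⟩
  have hev2 : ∀ᶠ r : ℝ in 𝓝[<] 1, r ∈ Set.Ico (0 : ℝ) 1 := by
    filter_upwards [Ico_mem_nhdsLT (zero_lt_one' ℝ)] with r hr using hr
  obtain ⟨r, hr, hr2⟩ := (hev.and hev2).exists
  exact Set.disjoint_left.1 h hr
    (homothety_mem_relInterior (barycenter_mem_relInterior τ) hxτ hr2.1 hr2.2)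

end Maps

/-! ### Common refinements without overlaps -/

section Refinement

variable {X : Type*} [NormedAddCommGroup X] [NormedSpace ℝ X] {m : ℕ}

theorem isClosed_body (σ : Affine.Simplex ℝ X m) : IsClosed (body σ) :=
  (Set.finite_range σ.points).isClosed_convexHull _

theorem isCompact_body (σ : Affine.Simplex ℝ X m) : IsCompact (body σ) :=
  (Set.finite_range σ.points).isCompact_convexHull _

theorem body_subset_closure_relInterior (σ : Affine.Simplex ℝ X m) :
    body σ ⊆ closure (relInterior σ) := by
  intro x hx
  have hc : Continuous fun r : ℝ => AffineMap.homothety (barycenter σ) r x := by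
    simp_rw [AffineMap.homothety_apply]
    fun_prop
  have ht : Tendsto (fun r : ℝ => AffineMap.homothety (barycenter σ) r x) (𝓝[<] 1) (𝓝 x) := by
    have := (hc.tendsto 1).mono_left (nhdsWithin_le_nhds (s := Set.Iio 1))
    simpa using this
  refine mem_closure_of_tendsto ht ?_
  filter_upwards [Ico_mem_nhdsLT (zero_lt_one' ℝ)] with r hr
  exact homothety_mem_relInterior (barycenter_mem_relInterior σ) hx hr.1 hr.2

/-- Every coordinate of `σ` is positive at `x ∈ body τ`, which rules out the nonpositive alternative
of `Uncut`. -/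
theorem body_subset_of_uncut {σ τ : Affine.Simplex ℝ X m} (hp : plane τ ≤ plane σ)
    (hu : ∀ i, Uncut (coord σ i) τ) {x : X} (hx : x ∈ relInterior σ) (hxτ : x ∈ body τ) :
    body τ ⊆ body σ := by
  refine convexHull_min ?_ (convex_body σ)
  rintro _ ⟨j, rfl⟩
  refine mem_body_iff.2 ⟨hp (points_mem_plane τ j), fun i => ?_⟩
  rcases hu i with h | h
  · exact h j
  · exact absurd (nonpos_of_mem_body h hxτ) (not_le.2 ((mem_relInterior_iff.1 hx).2 i))

theorem single_reindex_sub_mem_relations {G : Type*} [AddCommGroup G] (σ : Affine.Simplex ℝ X m)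
    (e : Equiv.Perm (Fin (m + 1))) (g : G) : Finsupp.single (σ.reindex e) g -
      Finsupp.single σ (((Equiv.Perm.sign e : ℤˣ) : ℤ) • g) ∈ relations X G m :=
  AddSubgroup.subset_closure (Or.inl ⟨σ, e, g, rfl⟩)

/-- The extended coordinates of `σ.reindex e` are chosen independently of those of `σ`; they are a
permutation of them only on the plane, which suffices for the vertices of `τ`. -/
theorem uncut_reindex_coord {σ τ : Affine.Simplex ℝ X m} (e : Equiv.Perm (Fin (m + 1)))
    (hp : plane τ = plane σ) (hu : ∀ i, Uncut (coord σ i) τ) (i : Fin (m + 1)) :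
    Uncut (coord (σ.reindex e) i) τ := by
  have key : ∀ x ∈ plane σ, coord (σ.reindex e) i x = coord σ (e.symm i) x := by
    intro x hx
    have h1 : x = ∑ k, coord σ (e.symm k) x • (σ.reindex e).points k := by
      conv_lhs => rw [eq_sum_coord hx, ← Equiv.sum_comp e.symm]
      rfl
    conv_lhs => rw [h1]
    rw [coord_sum _ _ ((Equiv.sum_comp e.symm fun k => coord σ k x).trans (sum_coord σ x))]
  have hk : ∀ j, coord (σ.reindex e) i (τ.points j) = coord σ (e.symm i) (τ.points j) :=
    fun j => key _ (hp ▸ points_mem_plane τ j)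
  simpa only [Uncut, hk] using hu (e.symm i)

/-- Distinct simplexes of the formal sum meet at most along their relative boundaries. -/
def StronglyDisjoint {G : Type*} [AddCommGroup G] (c : FormalChain X G m) : Prop :=
  ∀ τ ∈ c.support, ∀ τ' ∈ c.support, τ ≠ τ' → Disjoint (relInterior τ) (body τ')

theorem StronglyDisjoint.density_eq {G : Type*} [AddCommGroup G] {c : FormalChain X G m} (h : StronglyDisjoint c)
    {τ : Affine.Simplex ℝ X m} (hτ : τ ∈ c.support) {x : X} (hx : x ∈ relInterior τ)
    (L : Fin m → X →ₗ[ℝ] ℝ) :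
    density L x c = ((SignType.sign (frameDet L τ.points) : SignType) : ℤ) • c τ := by
  rw [density_eq_sum, Finset.sum_eq_single τ, density_single_of_mem hx]
  · intro τ' hτ' hne
    exact density_single_of_notMem (fun hx' => Set.disjoint_left.1 (h τ hτ τ' hτ' hne.symm) hx
      (relInterior_subset_body τ' hx')) _
  · exact fun h => absurd hτ h

variable [FiniteDimensional ℝ X]

open Classical in
-- The pieces of `S` inside `σ` cover the relative interior of `σ`, since a piece touching it is
-- contained in `σ`. Their union is closed, so it covers `σ`.
theorem Subdivides.filter {𝒯 : Finset (Affine.Simplex ℝ X m)} {S σ : Affine.Simplex ℝ X m}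
    (h : Subdivides 𝒯 S) (hS : body σ ⊆ body S)
    (hu : ∀ τ ∈ 𝒯, ∀ i, Uncut (coord σ i) τ) (ho : SameOrientation σ S) :
    Subdivides (𝒯.filter fun τ => body τ ⊆ body σ) σ where
  biUnion_eq := by
    have hp := plane_eq_of_body_subset hS
    apply subset_antisymm
    · exact Set.iUnion₂_subset fun τ hτ => (Finset.mem_filter.1 hτ).2
    · have hcl : IsClosed (⋃ τ ∈ 𝒯.filter fun τ => body τ ⊆ body σ, body τ) :=
        isClosed_biUnion_finset fun τ _ => isClosed_body τ
      refine (body_subset_closure_relInterior σ).trans (hcl.closure_subset_iff.2 fun x hx => ?_)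
      obtain ⟨τ, hτ, hxτ⟩ := h.exists_mem (hS (relInterior_subset_body σ hx))
      have hpτ := plane_eq_of_body_subset (h.body_subset hτ)
      exact Set.mem_biUnion (Finset.mem_filter.2
        ⟨hτ, body_subset_of_uncut (hpτ.trans hp.symm).le (hu τ hτ) hx hxτ⟩) hxτ
  disjoint τ hτ τ' hτ' := h.disjoint τ (Finset.mem_filter.1 hτ).1 τ' (Finset.mem_filter.1 hτ').1
  orientation τ hτ := ho.trans (h.orientation τ (Finset.mem_filter.1 hτ).1)

/-- If `σ` and `S` have opposite orientations, two vertices of `σ` are exchanged and the coefficient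
changes sign. -/
theorem exists_sum_of_subdivides {G : Type*} [AddCommGroup G] {𝒯 : Finset (Affine.Simplex ℝ X m)}
    {S σ : Affine.Simplex ℝ X m} (h : Subdivides 𝒯 S) (hS : body σ ⊆ body S)
    (hu : ∀ τ ∈ 𝒯, ∀ i, Uncut (coord σ i) τ) (g : G) :
    ∃ c : FormalChain X G m, c.support ⊆ 𝒯 ∧ Finsupp.single σ g - c ∈ relations X G m := by
  classical
  have hp := plane_eq_of_body_subset hS
  have hsupp : ∀ (σ' : Affine.Simplex ℝ X m) (g : G),
      (∑ τ ∈ 𝒯.filter (fun τ => body τ ⊆ body σ'), Finsupp.single τ g :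
        FormalChain X G m).support ⊆ 𝒯 := by
    intro σ' g
    refine Finsupp.support_finsetSum.trans (Finset.biUnion_subset.2 fun τ hτ => ?_)
    exact Finsupp.support_single_subset.trans
      (Finset.singleton_subset_iff.2 (Finset.mem_filter.1 hτ).1)
  obtain ⟨L, hL⟩ := exists_frameDet_eq_one σ
  have hne : frameDet L S.points ≠ 0 :=
    frameDet_ne_zero_of_plane_le (τ := σ) hp.le (by rw [hL]; exact one_ne_zero)
  rcases lt_or_gt_of_ne hne with hneg | hpos
  · cases m with
    -- In dimension zero every determinant is `1`, so orientations cannot be opposite.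
    | zero =>
      rw [frameDet_eq_det_edges] at hneg
      simp at hneg
      linarith
    | succ n =>
      have h01 : (0 : Fin (n + 2)) ≠ 1 := by simp
      let e : Equiv.Perm (Fin (n + 2)) := Equiv.swap 0 1
      have hs : ((Equiv.Perm.sign e : ℤˣ) : ℤ) = -1 := by simp [e, Equiv.Perm.sign_swap h01]
      have ho : SameOrientation (σ.reindex e) S := by
        refine sameOrientation_of_frameDet (L := L) (by rw [plane_reindex]; exact hp.ge) ?_
        rw [frameDet_reindex, hs, hL]
        push_cast
        linarith
      have hsub := h.filter (σ := σ.reindex e) (by rwa [body_reindex]) (fun τ hτ i =>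
        uncut_reindex_coord e ((plane_eq_of_body_subset (h.body_subset hτ)).trans hp.symm)
          (hu τ hτ) i) ho
      refine ⟨_, hsupp (σ.reindex e) (-g), ?_⟩
      have h1 := hsub.sub_mem_relations (-g)
      have h2 := single_reindex_sub_mem_relations σ e (-g)
      rw [hs, neg_smul, one_smul, neg_neg] at h2
      have := AddSubgroup.sub_mem _ h1 h2
      rwa [sub_sub_sub_cancel_left] at this
  · have ho : SameOrientation σ S :=
      sameOrientation_of_frameDet hp.ge (L := L) (by rw [hL]; linarith)
    exact ⟨_, hsupp σ g, (h.filter hS hu ho).sub_mem_relations g⟩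

/-- In each plane spanned by a simplex of `F`, a large simplex is cut by all barycentric and normal
coordinates of `F`. Pieces of one plane are disjoint by construction. For two planes, some normal
coordinate of the second is not identically zero on a piece of the first; it has one sign there,
hence it has no zero in the relative interior. -/
theorem exists_common_refinement (G : Type*) [AddCommGroup G]
    (F : Finset (Affine.Simplex ℝ X m)) :
    ∃ 𝒯 : Finset (Affine.Simplex ℝ X m),
      (∀ τ ∈ 𝒯, ∀ τ' ∈ 𝒯, τ ≠ τ' → Disjoint (relInterior τ) (body τ')) ∧
      ∀ σ ∈ F, ∀ g : G, ∃ c : FormalChain X G m, c.support ⊆ 𝒯 ∧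
        Finsupp.single σ g - c ∈ relations X G m := by
  classical
  let 𝓕 : Finset (X →ᵃ[ℝ] ℝ) := F.biUnion fun σ =>
    Finset.univ.image (coord σ) ∪ Finset.univ.image (normalCoord σ)
  have hcoord : ∀ σ ∈ F, ∀ i, coord σ i ∈ 𝓕 := fun σ hσ i =>
    Finset.mem_biUnion.2 ⟨σ, hσ, Finset.mem_union_left _ (Finset.mem_image_of_mem _ (by simp))⟩
  have hnormal : ∀ σ ∈ F, ∀ i, normalCoord σ i ∈ 𝓕 := fun σ hσ i =>
    Finset.mem_biUnion.2 ⟨σ, hσ, Finset.mem_union_right _ (Finset.mem_image_of_mem _ (by simp))⟩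
  have hW : ∀ W ∈ F.image plane, ∃ (S : Affine.Simplex ℝ X m)
      (𝒯 : Finset (Affine.Simplex ℝ X m)), plane S = W ∧
      (∀ σ ∈ F, plane σ = W → body σ ⊆ body S) ∧ Subdivides 𝒯 S ∧
      ∀ τ ∈ 𝒯, ∀ f ∈ 𝓕, Uncut f τ := by
    intro W hW
    obtain ⟨σ₀, _, rfl⟩ := Finset.mem_image.1 hW
    obtain ⟨S, hS, hY⟩ := exists_body_superset σ₀
      ((F.filter fun σ => plane σ = plane σ₀).biUnion fun σ => Finset.univ.image σ.points) (by
        intro y hy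
        obtain ⟨σ, hσ, hy⟩ := Finset.mem_biUnion.1 hy
        obtain ⟨i, _, rfl⟩ := Finset.mem_image.1 hy
        rw [← (Finset.mem_filter.1 hσ).2]
        exact points_mem_plane σ i)
    obtain ⟨𝒯, h𝒯, hu⟩ := exists_subdivides_forall_uncut 𝓕 S
    refine ⟨S, 𝒯, hS, fun σ hσ hp => convexHull_min ?_ (convex_body S), h𝒯, hu⟩
    rintro _ ⟨i, rfl⟩
    exact hY _ (Finset.mem_biUnion.2 ⟨σ, Finset.mem_filter.2 ⟨hσ, hp⟩,
      Finset.mem_image_of_mem _ (Finset.mem_univ i)⟩)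
  choose! S 𝒯 hS hF h𝒯 hu using hW
  have hplane : ∀ W ∈ F.image plane, ∀ τ ∈ 𝒯 W, plane τ = W := fun W hW τ hτ =>
    (plane_eq_of_body_subset ((h𝒯 W hW).body_subset hτ)).trans (hS W hW)
  refine ⟨(F.image plane).biUnion 𝒯, ?_, ?_⟩
  · intro τ hτ τ' hτ' hne
    obtain ⟨W, hW, hτ⟩ := Finset.mem_biUnion.1 hτ
    obtain ⟨W', hW', hτ'⟩ := Finset.mem_biUnion.1 hτ'
    by_cases he : W = W'
    · subst he
      exact relInterior_disjoint_body ((h𝒯 W hW).disjoint τ hτ τ' hτ' hne)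
        ((hplane W hW τ' hτ').trans (hplane W hW τ hτ).symm)
    · obtain ⟨σ', hσ', hσW'⟩ := Finset.mem_image.1 hW'
      have hle : ¬ plane τ ≤ plane σ' := fun hle => he <| by
        rw [← hplane W hW τ hτ, ← hσW']; exact plane_eq_plane_of_le hle
      obtain ⟨i, hi⟩ : ∃ i, τ.points i ∉ plane σ' := by
        by_contra hcon
        push Not at hcon
        exact hle (plane_le_of_points hcon)
      rw [mem_plane_iff_normalCoord] at hi
      push Not at hi
      obtain ⟨j, hj⟩ := hi
      rw [Set.disjoint_left]
      intro x hx hx'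
      have hx0 : normalCoord σ' j x = 0 := mem_plane_iff_normalCoord.1 (by
        rw [hσW', ← hplane W' hW' τ' hτ']; exact body_subset_plane τ' hx') j
      rcases hu W hW τ hτ _ (hnormal σ' hσ' j) with h | h
      · exact absurd hx0 (pos_of_mem_relInterior h hj hx).ne'
      · have := pos_of_mem_relInterior (f := -normalCoord σ' j) (σ := τ)
          (fun k => by simpa using h k) (i := i) (by simpa using hj) hx
        simp [hx0] at this
  · intro σ hσ g
    have hW : plane σ ∈ F.image plane := Finset.mem_image_of_mem _ hσ
    obtain ⟨c, hc, h⟩ := exists_sum_of_subdivides (h𝒯 _ hW) (hF _ hW σ hσ rfl)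
      (fun τ hτ i => hu _ hW τ hτ _ (hcoord σ hσ i)) g
    exact ⟨c, hc.trans (Finset.subset_biUnion_of_mem 𝒯 hW), h⟩

theorem exists_stronglyDisjoint {G : Type*} [AddCommGroup G] (c : FormalChain X G m) :
    ∃ c' : FormalChain X G m, StronglyDisjoint c' ∧ c - c' ∈ relations X G m := by
  obtain ⟨𝒯, hd, h⟩ := exists_common_refinement G c.support
  choose! d hd1 hd2 using h
  refine ⟨∑ σ ∈ c.support, d σ (c σ), ?_, ?_⟩
  · have hsupp : (∑ σ ∈ c.support, d σ (c σ)).support ⊆ 𝒯 := by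
      classical
      exact Finsupp.support_finsetSum.trans (Finset.biUnion_subset.2 fun σ hσ => hd1 σ hσ _)
    exact fun τ hτ τ' hτ' => hd τ (hsupp hτ) τ' (hsupp hτ')
  · have : c = ∑ σ ∈ c.support, Finsupp.single σ (c σ) := (Finsupp.sum_single c).symm
    have e : c - ∑ σ ∈ c.support, d σ (c σ) =
        ∑ σ ∈ c.support, (Finsupp.single σ (c σ) - d σ (c σ)) := by
      rw [Finset.sum_sub_distrib, ← this]
    rw [e]
    exact AddSubgroup.sum_mem _ fun σ hσ => hd2 σ hσ _

/-! ### Null chains are relations -/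

theorem Small.eq_empty_or_dimH_lt {k : ℕ} {N : Set X} (h : Small k N) : N = ∅ ∨ dimH N < k := by
  obtain ⟨𝒜, h1, h2⟩ := h
  -- For `k = 0` no subspace qualifies and the set is empty; a strict bound on `dimH` would be false
  -- in this case.
  rcases Nat.eq_zero_or_pos k with rfl | hk
  · left
    refine Set.subset_eq_empty h2 ?_
    simp only [Set.iUnion_eq_empty]
    exact fun A hA => absurd (h1 A hA) (Nat.not_lt_zero _)
  · right
    refine (dimH_mono h2).trans_lt ?_
    have := dimH_bUnion (𝒜.finite_toSet.countable) fun A => (A : Set X)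
    simp only [SetLike.mem_coe] at this
    rw [this]
    have hlt : ∀ A ∈ 𝒜, dimH (A : Set X) < k := by
      intro A hA
      rcases Set.eq_empty_or_nonempty (A : Set X) with h0 | h0
      · rw [h0, dimH_empty]; exact_mod_cast hk
      · rw [Real.Convex.dimH_eq_finrank_vectorSpan A.convex h0]
        exact_mod_cast h1 A hA
    rw [← Finset.sup_eq_iSup, Finset.sup_lt_iff (by simpa using hk)]
    exact hlt

theorem dimH_body (σ : Affine.Simplex ℝ X m) : dimH (body σ) = m := by
  rw [Real.Convex.dimH_eq_finrank_vectorSpan (convex_body σ) ⟨_, points_mem_body σ 0⟩]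
  rw [body, ← direction_affineSpan, affineSpan_convexHull]
  exact_mod_cast finrank_direction_plane σ

/-- Hausdorff dimension prevents finitely many lower-dimensional planes from covering a simplex. -/
theorem not_small_body (σ : Affine.Simplex ℝ X m) : ¬ Small m (body σ) := fun h => by
  rcases h.eq_empty_or_dimH_lt with h | h
  · exact (Set.Nonempty.ne_empty ⟨_, points_mem_body σ 0⟩) h
  · rw [dimH_body] at h
    exact lt_irrefl _ h

theorem Small.exists_mem_relInterior {N : Set X} (h : Small m N) (σ : Affine.Simplex ℝ X m) :
    ∃ x ∈ relInterior σ, x ∉ N := by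
  by_contra hcon
  push Not at hcon
  refine not_small_body σ (((small_body_diff_relInterior σ).union h).mono fun x hx => ?_)
  by_cases hx' : x ∈ relInterior σ
  · exact Or.inr (hcon x hx')
  · exact Or.inl ⟨hx, hx'⟩

variable {G : Type*} [AddCommGroup G]

/-- On a refinement without overlaps each coefficient is the density at a generic interior point of
its simplex, in a frame of determinant one, so it vanishes. -/
theorem mem_relations_of_nullChain {c : FormalChain X G m} (hc : NullChain c) :
    c ∈ relations X G m := by
  obtain ⟨c', hd, hr⟩ := exists_stronglyDisjoint c
  have hc' : NullChain c' := by
    have := hc.sub (nullChain_of_mem_relations hr)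
    rwa [sub_sub_cancel] at this
  suffices h : c' = 0 by rwa [h, sub_zero] at hr
  obtain ⟨N, hN, h⟩ := hc'
  ext τ
  by_contra hne
  have hτ : τ ∈ c'.support := Finsupp.mem_support_iff.2 hne
  obtain ⟨x, hx, hxN⟩ := hN.exists_mem_relInterior τ
  obtain ⟨L, hL⟩ := exists_frameDet_eq_one τ
  have := h L x hxN
  rw [hd.density_eq hτ hx, hL] at this
  exact hne (by simpa using this)

end Refinement

/-! ### The boundary operator -/

section Boundary

variable {X : Type*} [AddCommGroup X] [Module ℝ X] {G : Type*} [AddCommGroup G] {m : ℕ}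

variable (X G m) in
/-- The boundary of formal sums as a homomorphism. -/
def boundaryHom : FormalChain X G (m + 1) →+ FormalChain X G m :=
  Finsupp.liftAddHom fun σ => ∑ i : Fin (m + 2),
    (Finsupp.singleAddHom (facet σ i)).comp (zsmulAddGroupHom ((-1 : ℤ) ^ (i : ℕ)))

theorem boundaryHom_apply (c : FormalChain X G (m + 1)) :
    boundaryHom X G m c = formalBoundary c := by
  rw [boundaryHom, Finsupp.liftAddHom_apply, formalBoundary]
  refine Finsupp.sum_congr fun σ _ => ?_
  simp

theorem formalBoundary_single (σ : Affine.Simplex ℝ X (m + 1)) (g : G) :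
    formalBoundary (Finsupp.single σ g) =
      ∑ i : Fin (m + 2), Finsupp.single (facet σ i) ((-1 : ℤ) ^ (i : ℕ) • g) := by
  rw [← boundaryHom_apply, boundaryHom, Finsupp.liftAddHom_apply_single]
  simp

theorem formalBoundary_add (c c' : FormalChain X G (m + 1)) :
    formalBoundary (c + c') = formalBoundary c + formalBoundary c' := by
  simp only [← boundaryHom_apply, map_add]

theorem formalBoundary_sub (c c' : FormalChain X G (m + 1)) :
    formalBoundary (c - c') = formalBoundary c - formalBoundary c' := by
  simp only [← boundaryHom_apply, map_sub]

theorem formalBoundary_neg (c : FormalChain X G (m + 1)) :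
    formalBoundary (-c) = -formalBoundary c := by
  simp only [← boundaryHom_apply, map_neg]

theorem formalBoundary_sum {ι : Type*} (s : Finset ι) (c : ι → FormalChain X G (m + 1)) :
    formalBoundary (∑ i ∈ s, c i) = ∑ i ∈ s, formalBoundary (c i) := by
  simp only [← boundaryHom_apply, map_sum]

theorem facet_facet (σ : Affine.Simplex ℝ X (m + 2)) (i : Fin (m + 3)) (j : Fin (m + 2))
    (h : (i : ℕ) ≤ j) : facet (facet σ i) j =
      facet (facet σ j.succ) (i.castLT (lt_of_le_of_lt h j.is_lt)) := by
  ext k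
  simp only [facet_points]
  congr 1
  ext
  simp only [Fin.succAbove, Fin.lt_def, Fin.val_castSucc, Fin.val_castLT, Fin.val_succ]
  split_ifs <;> simp_all <;> omega

/-- The iterated facets cancel in pairs: `(i, j)` with `i ≤ j` is matched with `(j + 1, i)`, which
has the opposite sign. -/
theorem formalBoundary_formalBoundary (c : FormalChain X G (m + 2)) :
    formalBoundary (formalBoundary c) = 0 := by
  suffices h : ((boundaryHom X G m).comp (boundaryHom X G (m + 1))) = 0 by
    have := DFunLike.congr_fun h c
    simpa [boundaryHom_apply] using this
  refine Finsupp.addHom_ext fun σ g => ?_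
  rw [AddMonoidHom.comp_apply, boundaryHom_apply, boundaryHom_apply, formalBoundary_single,
    formalBoundary_sum, AddMonoidHom.zero_apply]
  simp only [formalBoundary_single, ← Finset.sum_product']
  rw [Finset.univ_product_univ]
  let S : Finset (Fin (m + 3) × Fin (m + 2)) := {ij | (ij.1 : ℕ) ≤ (ij.2 : ℕ)}
  rw [← Finset.sum_add_sum_compl S, ← eq_neg_iff_add_eq_zero, ← Finset.sum_neg_distrib]
  let φ : ∀ ij : Fin (m + 3) × Fin (m + 2), ij ∈ S → Fin (m + 3) × Fin (m + 2) := fun ij hij =>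
    (ij.2.succ, Fin.castLT ij.1 (lt_of_le_of_lt (Finset.mem_filter.mp hij).right (Fin.is_lt ij.2)))
  apply Finset.sum_bij φ
  · intro ij hij
    simp_rw [S, φ, Finset.compl_filter, Finset.mem_filter_univ, Fin.val_succ,
      Fin.val_castLT] at hij ⊢
    omega
  · rintro ⟨i, j⟩ hij ⟨i', j'⟩ hij' h
    rw [Prod.mk_inj]
    exact ⟨by simpa [φ, Fin.castSucc_castLT] using! congr_arg Fin.castSucc (congr_arg Prod.snd h),
      by simpa [φ] using! congr_arg Prod.fst h⟩
  · rintro ⟨i', j'⟩ hij'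
    simp_rw [S, Finset.compl_filter, Finset.mem_filter_univ, not_le] at hij'
    refine ⟨(Fin.castSucc j', i'.pred <| ?_), ?_, ?_⟩
    · rintro rfl
      simp only [Fin.val_zero, not_lt_zero] at hij'
    · simpa [S] using! Nat.le_sub_one_of_lt hij'
    · simp only [φ, Fin.castLT_castSucc, Fin.succ_pred]
  · rintro ⟨i, j⟩ hij
    have h : (i : ℕ) ≤ j := by simpa [S] using hij
    dsimp only [φ]
    rw [facet_facet σ i j h, ← Finsupp.single_neg, smul_smul, smul_smul, ← neg_smul]
    congr 2
    simp only [Fin.val_succ, Fin.val_castLT, pow_succ]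
    ring

/-! ### Densities of boundaries -/

/-- Differentiate the identity `x = ∑ coord σ j x • σ.points j` in the direction `n`. -/
theorem sum_linear_coord {σ : Affine.Simplex ℝ X m} {n : X} (hn : n ∈ (plane σ).direction) :
    ∑ j, (coord σ j).linear n • σ.points j = n := by
  have h0 := points_mem_plane σ 0
  have h1 : n +ᵥ σ.points 0 ∈ plane σ := AffineSubspace.vadd_mem_of_mem_direction hn h0
  have e : ∀ j, (coord σ j).linear n = coord σ j (n +ᵥ σ.points 0) - coord σ j (σ.points 0) :=
    fun j => by rw [AffineMap.map_vadd, vadd_eq_add]; ring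
  simp only [e, sub_smul, Finset.sum_sub_distrib]
  rw [← eq_sum_coord h1, ← eq_sum_coord h0, vadd_eq_add, add_sub_cancel_right]

theorem sum_linear_coord_eq_zero (σ : Affine.Simplex ℝ X m) (n : X) :
    ∑ j, (coord σ j).linear n = 0 := by
  have e : ∀ j, (coord σ j).linear n = coord σ j (n +ᵥ σ.points 0) - coord σ j (σ.points 0) :=
    fun j => by rw [AffineMap.map_vadd, vadd_eq_add]; ring
  simp only [e, Finset.sum_sub_distrib, sum_coord, sub_self]

/-- Cramer's rule. Combining the columns with the derivatives of the coordinates along `n` gives the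
basis vector of the row of `ν`, because `ν n = 1`, `L n = 0`, and the derivatives sum to zero.
Expanding the determinant along that column leaves the minor of the `i`-th facet. -/
theorem frameDet_facet {L : Fin m → X →ₗ[ℝ] ℝ} {ν : X →ₗ[ℝ] ℝ} {n : X}
    {σ : Affine.Simplex ℝ X (m + 1)} (hn : n ∈ (plane σ).direction) (hν : ν n = 1)
    (hL : ∀ l, L l n = 0) (i : Fin (m + 2)) :
    frameDet L (facet σ i).points * (((-1 : ℤ) ^ (i : ℕ) : ℤ) : ℝ) =
      -((coord σ i).linear n *
        frameDet (Fin.cons ν L : Fin (m + 1) → X →ₗ[ℝ] ℝ) σ.points) := by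
  set M : Matrix (Fin (m + 2)) (Fin (m + 2)) ℝ :=
    frameMatrix (Fin.cons ν L : Fin (m + 1) → X →ₗ[ℝ] ℝ) σ.points with hM
  have h1 := Matrix.det_updateCol_sum M i fun j => (coord σ j).linear n
  have hcol : (fun k => ∑ j, (coord σ j).linear n • M k j) = Pi.single 1 1 := by
    have hf : ∀ f : X →ₗ[ℝ] ℝ, ∑ j, (coord σ j).linear n * f (σ.points j) = f n := by
      intro f
      conv_rhs => rw [← sum_linear_coord hn]
      simp [map_sum]
    funext k
    refine Fin.cases ?_ (fun k => Fin.cases ?_ (fun k => ?_) k) k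
    · simpa [hM, frameMatrix] using sum_linear_coord_eq_zero σ n
    · simpa [hM, frameMatrix, hν] using hf ν
    · have h2 : (k.succ.succ : Fin (m + 2)) ≠ 1 := by
        simp [Fin.ext_iff]
      simpa [hM, frameMatrix, hL, h2] using hf (L k)
  rw [hcol, Matrix.det_succ_column _ i, Finset.sum_eq_single 1] at h1
  · simp only [Matrix.updateCol_self, Pi.single_eq_same, mul_one, smul_eq_mul] at h1
    have h3 : (M.updateCol i (Pi.single 1 1)).submatrix (Fin.succAbove 1) i.succAbove =
        frameMatrix L (facet σ i).points := by
      ext a b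
      simp only [Matrix.submatrix_apply, Matrix.updateCol_ne (Fin.succAbove_ne i b)]
      refine Fin.cases ?_ (fun a => ?_) a
      · simp [hM, frameMatrix]
      · have : (Fin.succAbove 1 a.succ : Fin (m + 2)) = a.succ.succ := by
          simp [Fin.succAbove, Fin.lt_def]
        simp [hM, frameMatrix, this, facet_points]
    rw [h3] at h1
    rw [frameDet, frameDet, ← hM, ← h1]
    push_cast
    simp [pow_add]
    ring
  · intro k _ hk
    simp [Pi.single_eq_of_ne hk]
  · simp

theorem sign_smul_facet {L : Fin m → X →ₗ[ℝ] ℝ} {ν : X →ₗ[ℝ] ℝ} {n : X}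
    {σ : Affine.Simplex ℝ X (m + 1)} (hn : n ∈ (plane σ).direction) (hν : ν n = 1)
    (hL : ∀ l, L l n = 0) (i : Fin (m + 2)) (g : G) :
    ((SignType.sign (frameDet L (facet σ i).points) : SignType) : ℤ) • ((-1 : ℤ) ^ (i : ℕ) • g) =
      -(((SignType.sign ((coord σ i).linear n) : SignType) : ℤ) •
        ((SignType.sign (frameDet (Fin.cons ν L : Fin (m + 1) → X →ₗ[ℝ] ℝ) σ.points) :
          SignType) : ℤ) • g) := by
  have h := congrArg SignType.sign (frameDet_facet hn hν hL i)
  rw [Left.sign_neg, sign_mul, sign_mul] at h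
  rw [smul_smul, smul_smul, ← neg_smul]
  congr 1
  have h' := congrArg (fun s : SignType => (s : ℤ)) h
  simp only [SignType.coe_mul, SignType.coe_neg] at h'
  rw [← h']
  congr 1
  rcases neg_one_pow_eq_or ℤ (i : ℕ) with h | h <;> rw [h] <;> simp

theorem density_formalBoundary_single (L : Fin m → X →ₗ[ℝ] ℝ) (x : X)
    (σ : Affine.Simplex ℝ X (m + 1)) (g : G) :
    density L x (formalBoundary (Finsupp.single σ g)) =
      ∑ i : Fin (m + 2), density L x (Finsupp.single (facet σ i) ((-1 : ℤ) ^ (i : ℕ) • g)) := by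
  rw [formalBoundary_single, map_sum]

open Classical in
/-- The jump of the density in the direction `n` is the density of the boundary. -/
theorem eventually_density_sub_density {L : Fin m → X →ₗ[ℝ] ℝ} {ν : X →ₗ[ℝ] ℝ} {n x : X}
    {σ : Affine.Simplex ℝ X (m + 1)} (hn : n ∈ (plane σ).direction) (hν : ν n = 1)
    (hL : ∀ l, L l n = 0) (hx : x ∈ plane σ)
    (hx' : ∀ i j, i ≠ j → coord σ i x = 0 → coord σ j x ≠ 0) (g : G) :
    ∀ᶠ ε : ℝ in 𝓝[>] 0,
      density (Fin.cons ν L : Fin (m + 1) → X →ₗ[ℝ] ℝ) (ε • n + x) (Finsupp.single σ g) -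
        density (Fin.cons ν L : Fin (m + 1) → X →ₗ[ℝ] ℝ) ((-ε) • n + x) (Finsupp.single σ g) =
      -density L x (formalBoundary (Finsupp.single σ g)) := by
  have hmem : ∀ ε : ℝ, ε • n + x ∈ plane σ := fun ε =>
    AffineSubspace.vadd_mem_of_mem_direction (Submodule.smul_mem _ ε hn) hx
  have hco : ∀ i (ε : ℝ), coord σ i (ε • n + x) = ε * (coord σ i).linear n + coord σ i x := by
    intro i ε
    have := AffineMap.map_vadd (coord σ i) x (ε • n)
    rw [vadd_eq_add, vadd_eq_add, map_smul, smul_eq_mul] at this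
    exact this
  have hpos : ∀ i, 0 < coord σ i x → ∀ᶠ ε : ℝ in 𝓝[>] 0,
      0 < coord σ i (ε • n + x) ∧ 0 < coord σ i ((-ε) • n + x) := by
    intro i hi
    simp_rw [hco]
    have hc1 : ContinuousAt (fun ε : ℝ => ε * (coord σ i).linear n + coord σ i x) 0 := by fun_prop
    have hc2 : ContinuousAt (fun ε : ℝ => -ε * (coord σ i).linear n + coord σ i x) 0 := by fun_prop
    refine Eventually.filter_mono nhdsWithin_le_nhds ?_
    exact (hc1.eventually (lt_mem_nhds (by simpa using hi))).and
      (hc2.eventually (lt_mem_nhds (by simpa using hi)))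
  have hneg : ∀ i, coord σ i x < 0 → ∀ᶠ ε : ℝ in 𝓝[>] 0,
      coord σ i (ε • n + x) < 0 ∧ coord σ i ((-ε) • n + x) < 0 := by
    intro i hi
    simp_rw [hco]
    have hc1 : ContinuousAt (fun ε : ℝ => ε * (coord σ i).linear n + coord σ i x) 0 := by fun_prop
    have hc2 : ContinuousAt (fun ε : ℝ => -ε * (coord σ i).linear n + coord σ i x) 0 := by fun_prop
    refine Eventually.filter_mono nhdsWithin_le_nhds ?_
    exact (hc1.eventually (gt_mem_nhds (by simpa using hi))).and
      (hc2.eventually (gt_mem_nhds (by simpa using hi)))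
  rw [density_formalBoundary_single]
  by_cases hA : ∃ i, coord σ i x < 0
  · obtain ⟨i, hi⟩ := hA
    filter_upwards [hneg i hi] with ε hε
    rw [density_single_of_notMem fun h => absurd ((mem_relInterior_iff.1 h).2 i) (not_lt.2 hε.1.le),
      density_single_of_notMem fun h => absurd ((mem_relInterior_iff.1 h).2 i) (not_lt.2 hε.2.le),
      sub_zero, eq_comm, neg_eq_zero]
    refine Finset.sum_eq_zero fun k _ => density_single_of_notMem (fun h => ?_) _
    obtain ⟨_, h0, h1⟩ := mem_relInterior_facet_iff.1 h
    by_cases hik : i = k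
    · subst hik; linarith
    · linarith [h1 i hik]
  · push Not at hA
    by_cases hB : ∀ i, 0 < coord σ i x
    · filter_upwards [Filter.eventually_all.2 fun i => hpos i (hB i)] with ε hε
      rw [density_single_of_mem (mem_relInterior_iff.2 ⟨hmem ε, fun i => (hε i).1⟩),
        density_single_of_mem (mem_relInterior_iff.2 ⟨hmem (-ε), fun i => (hε i).2⟩), sub_self,
        eq_comm, neg_eq_zero]
      refine Finset.sum_eq_zero fun k _ => density_single_of_notMem (fun h => ?_) _
      exact absurd (mem_relInterior_facet_iff.1 h).2.1 (hB k).ne'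
    · push Not at hB
      -- Here `x` lies in the relative interior of the facet `i` only. For small `ε`, the point `x +
      -- ε n` is inside `σ` exactly when coordinate `i` increases along `n`, and `x - ε n` exactly
      -- when it decreases.
      obtain ⟨i, hi⟩ := hB
      have hi0 : coord σ i x = 0 := le_antisymm hi (hA i)
      have hj : ∀ j, j ≠ i → 0 < coord σ j x := fun j hj =>
        lt_of_le_of_ne (hA j) (hx' i j hj.symm hi0).symm
      have hev : ∀ᶠ ε : ℝ in 𝓝[>] 0, ∀ j, j ≠ i →
          0 < coord σ j (ε • n + x) ∧ 0 < coord σ j ((-ε) • n + x) :=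
        Filter.eventually_all.2 fun j => by
          by_cases hji : j = i
          · simp [hji]
          · filter_upwards [hpos j (hj j hji)] with ε hε _ using hε
      rw [Finset.sum_eq_single i, density_single_of_mem
        (mem_relInterior_facet_iff.2 ⟨hx, hi0, hj⟩), sign_smul_facet hn hν hL, neg_neg]
      · filter_upwards [hev, self_mem_nhdsWithin] with ε hε hε0
        have hε0 : 0 < ε := hε0
        have e1 : ε • n + x ∈ relInterior σ ↔ 0 < (coord σ i).linear n := by
          rw [mem_relInterior_iff]
          constructor
          · intro h
            have := h.2 i
            rw [hco, hi0, add_zero] at this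
            exact pos_of_mul_pos_right this hε0.le
          · refine fun h => ⟨hmem ε, fun j => ?_⟩
            by_cases hji : j = i
            · subst hji
              rw [hco, hi0, add_zero]; positivity
            · exact (hε j hji).1
        have e2 : (-ε) • n + x ∈ relInterior σ ↔ (coord σ i).linear n < 0 := by
          rw [mem_relInterior_iff]
          constructor
          · intro h
            have := h.2 i
            rw [hco, hi0, add_zero, neg_mul, neg_pos] at this
            exact neg_of_mul_neg_right this hε0.le
          · refine fun h => ⟨hmem (-ε), fun j => ?_⟩
            by_cases hji : j = i
            · subst hji
              rw [hco, hi0, add_zero, neg_mul, neg_pos]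
              exact mul_neg_of_pos_of_neg hε0 h
            · exact (hε j hji).2
        rw [density_single, density_single, if_congr e1 rfl rfl, if_congr e2 rfl rfl]
        rcases lt_trichotomy ((coord σ i).linear n) 0 with h | h | h
        · rw [if_neg h.le.not_gt, if_pos h, sign_neg h]; simp
        · simp [h]
        · rw [if_pos h, if_neg h.le.not_gt, sign_pos h]; simp
      · intro k _ hk
        refine density_single_of_notMem (fun h => ?_) _
        exact absurd (mem_relInterior_facet_iff.1 h).2.1 (hj k hk).ne'
      · simp

end Boundary

/-! ### The boundary respects the relations -/

section BoundaryRelations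

variable {X : Type*} [NormedAddCommGroup X] [NormedSpace ℝ X] [FiniteDimensional ℝ X]
  {G : Type*} [AddCommGroup G] {m : ℕ}

/-- All simplexes lie in one plane of dimension `m + 1`, so some direction `n` of it is killed by
the `m` forms of `L`. At a generic point of a facet on which `L` is nondegenerate, the density of
the boundary is minus the jump of the density of `c` along `n`, and both sides of the jump vanish.
-/
theorem nullChain_formalBoundary_of_plane {c : FormalChain X G (m + 1)} {V : AffineSubspace ℝ X}
    (hV : ∀ σ ∈ c.support, plane σ = V) (hc : NullChain c) : NullChain (formalBoundary c) := by
  classical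
  obtain ⟨N, ⟨𝒜, h𝒜, hN𝒜⟩, hN⟩ := hc
  -- `N₁` contains the points where two coordinates of a simplex vanish; `N₂` contains the points
  -- where a facet plane meets a subspace of `𝒜` that does not contain it.
  let N₁ : Set X := ⋃ σ ∈ c.support, ⋃ i, ⋃ j, {x | i ≠ j ∧ x ∈ plane (facet σ i) ∧ coord σ j x = 0}
  let N₂ : Set X := ⋃ σ ∈ c.support, ⋃ i, ⋃ A ∈ 𝒜.filter fun A => ¬ plane (facet σ i) ≤ A,
    ((plane (facet σ i) : Set X) ∩ A)
  have hsum : ∀ (L : Fin m → X →ₗ[ℝ] ℝ) x, density L x (formalBoundary c) =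
      ∑ σ ∈ c.support, density L x (formalBoundary (Finsupp.single σ (c σ))) := by
    intro L x
    conv_lhs => rw [← Finsupp.sum_single c, Finsupp.sum, formalBoundary_sum, map_sum]
  refine ⟨N₁ ∪ N₂, ?_, fun L x hx => ?_⟩
  · refine Small.union ?_ ?_
    · refine Small.biUnion _ _ fun σ _ => Small.iUnion _ fun i => Small.iUnion _ fun j => ?_
      by_cases hij : i = j
      · exact (small_empty m).mono fun x hx => absurd hij hx.1
      · obtain ⟨k, hk⟩ := Fin.exists_succAbove_eq (Ne.symm hij)
        refine (small_plane_zero (facet σ i) (coord σ j) (i := k) ?_).mono fun x hx => hx.2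
        rw [facet_points, hk, coord_points, if_pos rfl]
        exact one_ne_zero
    · refine Small.biUnion _ _ fun σ _ => Small.iUnion _ fun i => Small.biUnion _ _ fun A hA => ?_
      exact small_plane_inter _ (Finset.mem_filter.1 hA).2
  · by_cases hxV : x ∈ V
    swap
    · rw [hsum]
      refine Finset.sum_eq_zero fun σ hσ => ?_
      rw [density_formalBoundary_single]
      refine Finset.sum_eq_zero fun i _ => density_single_of_notMem (fun h => hxV ?_) _
      rw [← hV σ hσ]
      exact (mem_relInterior_facet_iff.1 h).1
    by_cases hreg : ∀ σ ∈ c.support, ∀ i, x ∈ relInterior (facet σ i) →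
        frameDet L (facet σ i).points = 0
    · rw [hsum]
      refine Finset.sum_eq_zero fun σ hσ => ?_
      rw [density_formalBoundary_single]
      refine Finset.sum_eq_zero fun i _ => ?_
      rw [density_single]
      split_ifs with h
      · simp [hreg σ hσ i h]
      · rfl
    push Not at hreg
    obtain ⟨σ₀, hσ₀, i₀, hx₀, hD₀⟩ := hreg
    -- a direction of `V` in the kernel of `L`
    obtain ⟨n, hnV, hn0, hLn⟩ : ∃ n ∈ V.direction, n ≠ 0 ∧ ∀ l, L l n = 0 := by
      have hfr : Module.finrank ℝ V.direction = m + 1 := by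
        rw [← hV σ₀ hσ₀]; exact finrank_direction_plane σ₀
      have hk := (LinearMap.pi L ∘ₗ V.direction.subtype).ker_ne_bot_of_finrank_lt
        (by rw [hfr]; simp)
      obtain ⟨⟨n, hn⟩, hker, hne⟩ := Submodule.exists_mem_ne_zero_of_ne_bot hk
      refine ⟨n, hn, fun h => hne (Subtype.ext h), fun l => ?_⟩
      exact congrFun (LinearMap.mem_ker.1 hker) l
    obtain ⟨ν, hν⟩ : ∃ ν : X →ₗ[ℝ] ℝ, ν n = 1 := by
      obtain ⟨j, hj⟩ : ∃ j, (Module.finBasis ℝ X).coord j n ≠ 0 := by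
        by_contra hcon
        push Not at hcon
        exact hn0 ((Module.finBasis ℝ X).forall_coord_eq_zero_iff.1 hcon)
      refine ⟨((Module.finBasis ℝ X).coord j n)⁻¹ • (Module.finBasis ℝ X).coord j, ?_⟩
      simp only [LinearMap.smul_apply, smul_eq_mul]
      exact inv_mul_cancel₀ hj
    -- `L` is injective on the directions of this facet, while it kills `n`.
    have hnW : n ∉ (plane (facet σ₀ i₀)).direction := by
      intro h
      refine hn0 ?_
      have hz := Matrix.eq_zero_of_mulVec_eq_zero hD₀
        (v := fun j => (coord (facet σ₀ i₀) j).linear n) (by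
          have hf : ∀ f : X →ₗ[ℝ] ℝ, ∑ j, f ((facet σ₀ i₀).points j) *
              (coord (facet σ₀ i₀) j).linear n = f n := by
            intro f
            conv_rhs => rw [← sum_linear_coord h]
            simp [map_sum, mul_comm]
          funext k
          refine Fin.cases ?_ (fun k => ?_) k
          · simpa [Matrix.mulVec, dotProduct, frameMatrix] using
              sum_linear_coord_eq_zero (facet σ₀ i₀) n
          · simpa [Matrix.mulVec, dotProduct, frameMatrix, hLn] using hf (L k))
      rw [← sum_linear_coord h]
      exact Finset.sum_eq_zero fun j _ => by
        rw [show (coord (facet σ₀ i₀) j).linear n = 0 from congrFun hz j, zero_smul]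
    have hline : ∀ s : ℝ, s ≠ 0 → ∀ᶠ ε : ℝ in 𝓝[>] 0, (s * ε) • n + x ∉ N := by
      intro s hs
      have hA : ∀ A ∈ 𝒜, ∀ᶠ ε : ℝ in 𝓝[>] 0, (s * ε) • n + x ∉ (A : Set X) := by
        intro A hA
        by_cases hxA : x ∈ A
        -- A subspace of `𝒜` through `x` contains the facet plane since `x ∉ N₂`, and equals it by
        -- dimension. As `n` is transverse to that plane, the line leaves it at once.
        · have hle : plane (facet σ₀ i₀) ≤ A := by
            by_contra hle
            refine hx (Or.inr (Set.mem_biUnion hσ₀ (Set.mem_iUnion.2 ⟨i₀,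
              Set.mem_biUnion (Finset.mem_coe.2 (Finset.mem_filter.2 ⟨hA, hle⟩))
                ⟨(mem_relInterior_iff.1 hx₀).1, hxA⟩⟩)))
          have heq := plane_eq_of_le hle (Nat.lt_succ_iff.1 (h𝒜 A hA))
          filter_upwards [self_mem_nhdsWithin] with ε hε hmem
          have hε : 0 < ε := hε
          have h1 : (s * ε) • n ∈ A.direction := by
            have := AffineSubspace.vsub_mem_direction hmem hxA
            rwa [vsub_eq_sub, add_sub_cancel_right] at this
          rw [← heq] at h1
          exact hnW ((Submodule.smul_mem_iff _ (mul_ne_zero hs hε.ne')).1 h1)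
        · have hcl : IsClosed (A : Set X) := A.closed_of_finiteDimensional
          have hc : Continuous fun ε : ℝ => (s * ε) • n + x := by fun_prop
          refine Eventually.filter_mono nhdsWithin_le_nhds ?_
          exact (hc.continuousAt (x := 0)).eventually (hcl.isOpen_compl.mem_nhds (by simpa using hxA))
      filter_upwards [(Finset.eventually_all 𝒜).2 hA] with ε hε hmem
      obtain ⟨A, hA, hmem⟩ := Set.mem_iUnion₂.1 (hN𝒜 hmem)
      exact hε A hA hmem
    have hjump : ∀ᶠ ε : ℝ in 𝓝[>] 0, ∀ σ ∈ c.support,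
        density (Fin.cons ν L : Fin (m + 1) → X →ₗ[ℝ] ℝ) (ε • n + x) (Finsupp.single σ (c σ)) -
          density (Fin.cons ν L : Fin (m + 1) → X →ₗ[ℝ] ℝ) ((-ε) • n + x)
            (Finsupp.single σ (c σ)) =
        -density L x (formalBoundary (Finsupp.single σ (c σ))) := by
      refine (Finset.eventually_all c.support).2 fun σ hσ => ?_
      have hxσ : x ∈ plane σ := by rw [hV σ hσ]; exact hxV
      refine eventually_density_sub_density (by rw [hV σ hσ]; exact hnV) hν hLn hxσ
        (fun i j hij hi hj => ?_) _
      exact hx (Or.inl (Set.mem_biUnion hσ (Set.mem_iUnion.2 ⟨i, Set.mem_iUnion.2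
        ⟨j, hij, mem_plane_facet_iff.2 ⟨hxσ, hi⟩, hj⟩⟩)))
    obtain ⟨ε, h1, h2, h3⟩ := ((hline 1 one_ne_zero).and
      ((hline (-1) (by norm_num)).and hjump)).exists
    rw [one_mul] at h1
    rw [neg_one_mul] at h2
    have h4 := Finset.sum_congr rfl h3
    rw [Finset.sum_sub_distrib, ← density_eq_sum, ← density_eq_sum, hN _ _ h1, hN _ _ h2,
      Finset.sum_neg_distrib, ← hsum, sub_zero] at h4
    exact neg_eq_zero.1 h4.symm

/-- Each generating relation involves simplexes of a single plane, so the jump argument applies to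
it. -/
theorem formalBoundary_mem_relations {c : FormalChain X G (m + 1)}
    (hc : c ∈ relations X G (m + 1)) : formalBoundary c ∈ relations X G m := by
  classical
  induction hc using AddSubgroup.closure_induction with
  | mem c hc =>
    rcases hc with ⟨σ, e, g, rfl⟩ | ⟨σ, κ, τ, g, h, rfl⟩
    · refine mem_relations_of_nullChain (nullChain_formalBoundary_of_plane (V := plane σ)
        (fun ρ hρ => ?_) (nullChain_reindex σ e g))
      rcases Finset.mem_union.1 (Finsupp.support_sub hρ) with h | h
      · rw [Finset.mem_singleton.1 (Finsupp.support_single_subset h), plane_reindex]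
      · rw [Finset.mem_singleton.1 (Finsupp.support_single_subset h)]
    · refine mem_relations_of_nullChain (nullChain_formalBoundary_of_plane (V := plane σ)
        (fun ρ hρ => ?_) (nullChain_partition h g))
      rcases Finset.mem_union.1 (Finsupp.support_sub hρ) with h' | h'
      · rw [Finset.mem_singleton.1 (Finsupp.support_single_subset h')]
      · obtain ⟨k, _, hk⟩ := Finset.mem_biUnion.1 (Finsupp.support_finsetSum h')
        rw [Finset.mem_singleton.1 (Finsupp.support_single_subset hk)]
        refine plane_eq_of_body_subset ?_
        rw [← h.iUnion_eq]
        exact Set.subset_iUnion (fun k => body (τ k)) k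
  | zero => rw [← boundaryHom_apply, map_zero]; exact AddSubgroup.zero_mem _
  | add _ _ _ _ h h' => rw [formalBoundary_add]; exact AddSubgroup.add_mem _ h h'
  | neg _ _ h => rw [formalBoundary_neg]; exact AddSubgroup.neg_mem _ h

end BoundaryRelations

/-! ### Hausdorff measure of simplexes and of their slices -/

section HausdorffMeasure

open scoped NNReal

/-- The normalising constant of the Hausdorff measure. -/
def hausdorffConst (m : ℕ) : ℝ≥0∞ :=
  volume (Metric.closedBall (0 : EuclideanSpace ℝ (Fin m)) 1) / 2 ^ m

theorem hausdorffConst_ne_zero (m : ℕ) : hausdorffConst m ≠ 0 := by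
  refine (ENNReal.div_pos (Metric.measure_closedBall_pos _ _ one_pos).ne' ?_).ne'
  exact ENNReal.pow_ne_top (by simp)

theorem hausdorffConst_ne_top (m : ℕ) : hausdorffConst m ≠ ∞ :=
  ENNReal.div_ne_top (isCompact_closedBall _ _).measure_lt_top.ne (by positivity)

/-- The normalised Hausdorff measure as a Borel measure. -/
def normalizedHausdorff (X : Type*) [EMetricSpace X] [MeasurableSpace X] [BorelSpace X] (m : ℕ) :
    Measure X :=
  hausdorffConst m • Measure.hausdorffMeasure (m : ℝ)

theorem hausdorff_eq {X : Type*} [EMetricSpace X] [mX : MeasurableSpace X] [hX : BorelSpace X]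
    (m : ℕ) (A : Set X) : hausdorff m A = normalizedHausdorff X m A := by
  have h := hX.measurable_eq
  subst h
  rfl

theorem hausdorff_image_le {E F : Type*} [NormedAddCommGroup E] [NormedSpace ℝ E]
    [FiniteDimensional ℝ E] [NormedAddCommGroup F] [NormedSpace ℝ F] (e : E →ₗ[ℝ] F) (m : ℕ) :
    ∃ C : ℝ≥0∞, C ≠ 0 ∧ C ≠ ∞ ∧ ∀ A : Set E, hausdorff m (e '' A) ≤ C * hausdorff m A := by
  borelize E
  borelize F
  have hl := (LinearMap.toContinuousLinearMap e).lipschitz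
  -- The added `1` keeps the constant nonzero when the norm is zero.
  refine ⟨(‖LinearMap.toContinuousLinearMap e‖₊ : ℝ≥0∞) ^ (m : ℝ) + 1, by positivity, ?_,
    fun A => ?_⟩
  · finiteness
  · have h := hl.hausdorffMeasure_image_le (d := m) (by positivity) A
    rw [hausdorff_eq, hausdorff_eq, normalizedHausdorff, normalizedHausdorff, Measure.smul_apply,
      Measure.smul_apply, smul_eq_mul, smul_eq_mul, mul_left_comm]
    refine mul_le_mul_right (h.trans (mul_le_mul_left ?_ _)) _
    exact le_self_add

section

variable {X : Type*} [AddCommGroup X] [Module ℝ X] {m : ℕ}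

/-- The parametrisation of the plane of a simplex by the edge coordinates. -/
def edgeMap (σ : Affine.Simplex ℝ X m) : (Fin m → ℝ) →ₗ[ℝ] X :=
  Fintype.linearCombination ℝ fun j : Fin m => σ.points j.succ - σ.points 0

theorem edgeMap_add (σ : Affine.Simplex ℝ X m) (y : Fin m → ℝ) :
    edgeMap σ y + σ.points 0 =
      ∑ i, (Fin.cons (1 - ∑ j, y j) y : Fin (m + 1) → ℝ) i • σ.points i := by
  rw [edgeMap, Fintype.linearCombination_apply, Fin.sum_univ_succ]
  simp only [Fin.cons_zero, Fin.cons_succ, smul_sub, Finset.sum_sub_distrib, sub_smul, one_smul,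
    Finset.sum_smul]
  abel

end

section

variable {X : Type*} [NormedAddCommGroup X] [NormedSpace ℝ X] [MeasurableSpace X] [BorelSpace X]
  {m : ℕ}

/-- A simplex is contained in a Lipschitz image of the unit cube of `Fin m → ℝ`, where Hausdorff
measure is Lebesgue measure. -/
theorem hausdorff_body_ne_top (σ : Affine.Simplex ℝ X m) : hausdorff m (body σ) ≠ ∞ := by
  have hK : LipschitzWith ‖LinearMap.toContinuousLinearMap (edgeMap σ)‖₊
      fun y => edgeMap σ y + σ.points 0 := by
    intro x y
    rw [edist_add_right]
    exact (LinearMap.toContinuousLinearMap (edgeMap σ)).lipschitz x y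
  let s : Set (Fin m → ℝ) := Set.univ.pi fun _ => Set.Icc 0 1
  have h1 : body σ ⊆ (fun y => edgeMap σ y + σ.points 0) '' s := by
    intro x hx
    obtain ⟨w, h0, h1, rfl⟩ := mem_body_iff_exists.1 hx
    have hw : w = Fin.cons (1 - ∑ j : Fin m, w j.succ) fun j : Fin m => w j.succ := by
      funext k
      refine Fin.cases ?_ (fun k => ?_) k
      · rw [Fin.cons_zero, ← h1, Fin.sum_univ_succ]; ring
      · simp
    refine ⟨fun j => w j.succ, fun j _ => ⟨h0 _, ?_⟩, ?_⟩
    · rw [← h1]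
      exact Finset.single_le_sum (fun i _ => h0 i) (Finset.mem_univ _)
    · dsimp only
      rw [edgeMap_add, ← hw]
  have h2 := hK.hausdorffMeasure_image_le (d := m) (by positivity) s
  have h3 : Measure.hausdorffMeasure (m : ℝ) s ≠ ∞ := by
    have h4 := hausdorffMeasure_pi_real (ι := Fin m)
    rw [Fintype.card_fin] at h4
    rw [h4, volume_pi_pi]
    exact ENNReal.prod_ne_top fun i _ => by simp
  rw [hausdorff_eq, normalizedHausdorff, Measure.smul_apply, smul_eq_mul]
  refine ENNReal.mul_ne_top (hausdorffConst_ne_top m) (ne_top_of_le_ne_top ?_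
    ((measure_mono h1).trans h2))
  exact ENNReal.mul_ne_top (by finiteness) h3

theorem hausdorff_smul_add_image (a : X) {r : ℝ} (hr : 0 < r) (A : Set X) :
    hausdorff m ((fun x => r • x + a) '' A) = ENNReal.ofReal r ^ m * hausdorff m A := by
  have h1 : (fun x => r • x + a) '' A = IsometryEquiv.addRight a '' ((fun x => r • x) '' A) := by
    rw [Set.image_image]
    rfl
  have h2 := Measure.hausdorffMeasure_smul₀ (d := (m : ℝ)) (by positivity) hr.ne' A
  rw [hausdorff_eq, hausdorff_eq, normalizedHausdorff, Measure.smul_apply, smul_eq_mul,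
    Measure.smul_apply, smul_eq_mul, h1, IsometryEquiv.hausdorffMeasure_image, Set.image_smul, h2,
    mul_left_comm]
  congr 1
  rw [ENNReal.smul_def, smul_eq_mul, NNReal.rpow_natCast, ENNReal.coe_pow]
  congr 2
  rw [ENNReal.ofReal, Real.toNNReal_of_nonneg hr.le]
  congr 1
  ext
  simp [abs_of_pos hr]

end

/-! ### Eilenberg's inequality -/

/-- Take nearly optimal covers of `A` by sets `E` of diameter at most `1 / (n + 1)`. The slice at
level `s` needs only the sets with `s ∈ f(E)`, and `f(E)` has length at most `K diam E`; integrating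
`∑ (diam E)ᵐ` over the levels thus costs at most `K ∑ (diam E)ᵐ⁺¹`. Fatou's lemma passes to the
limit. The majorant `g` makes measurability of the slice measure itself unnecessary. -/
theorem exists_measurable_bound_slices {X : Type*} [EMetricSpace X] [MeasurableSpace X]
    [BorelSpace X] {m : ℕ} {f : X → ℝ} {K : ℝ≥0} (hf : LipschitzWith K f) (hm : 1 ≤ m)
    {A : Set X} (hA : Measure.hausdorffMeasure ((m + 1 : ℕ) : ℝ) A ≠ ∞) :
    ∃ g : ℝ → ℝ≥0∞, Measurable g ∧
      (∀ t, Measure.hausdorffMeasure (m : ℝ) (A ∩ f ⁻¹' {t}) ≤ g t) ∧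
      ∫⁻ t, g t ≤ K * Measure.hausdorffMeasure ((m + 1 : ℕ) : ℝ) A := by
  set μA := Measure.hausdorffMeasure ((m + 1 : ℕ) : ℝ) A with hμA
  have hcov : ∀ n : ℕ, ∃ t : ℕ → Set X, A ⊆ ⋃ i, t i ∧
      (∀ i, Metric.ediam (t i) ≤ ((n : ℝ≥0∞) + 1)⁻¹) ∧
      ∑' i, ⨆ _ : (t i).Nonempty, Metric.ediam (t i) ^ ((m + 1 : ℕ) : ℝ) ≤
        μA + ((n : ℝ≥0∞) + 1)⁻¹ := by
    intro n
    have hpos : (0 : ℝ≥0∞) < ((n : ℝ≥0∞) + 1)⁻¹ := ENNReal.inv_pos.2 (by finiteness)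
    have hlt : μA < μA + ((n : ℝ≥0∞) + 1)⁻¹ := ENNReal.lt_add_right hA hpos.ne'
    have hle := (le_iSup₂ (f := fun (r : ℝ≥0∞) (_ : 0 < r) =>
        ⨅ (t : ℕ → Set X) (_ : A ⊆ ⋃ n, t n) (_ : ∀ n, Metric.ediam (t n) ≤ r),
          ∑' n, ⨆ _ : (t n).Nonempty, Metric.ediam (t n) ^ ((m + 1 : ℕ) : ℝ)) _ hpos).trans
        (Measure.hausdorffMeasure_apply ((m + 1 : ℕ) : ℝ) A).ge
    have := hle.trans_lt hlt
    simp only [iInf_lt_iff] at this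
    obtain ⟨t, h1, h2, h3⟩ := this
    exact ⟨t, h1, h2, h3.le⟩
  choose t ht1 ht2 ht3 using hcov
  have hm0 : (0 : ℝ) < m := by exact_mod_cast hm
  let G : ℕ → ℝ → ℝ≥0∞ := fun n s =>
    ∑' i, (closure (f '' t n i)).indicator (fun _ => Metric.ediam (t n i) ^ (m : ℝ)) s
  have hG : ∀ n, Measurable (G n) := fun n => Measurable.tsum fun i =>
    measurable_const.indicator isClosed_closure.measurableSet
  have hGint : ∀ n, ∫⁻ s, G n s ≤ K * (μA + ((n : ℝ≥0∞) + 1)⁻¹) := by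
    intro n
    rw [lintegral_tsum fun i =>
      (measurable_const.indicator isClosed_closure.measurableSet).aemeasurable]
    refine le_trans ?_ (mul_le_mul_right (ht3 n) _)
    rw [← ENNReal.tsum_mul_left]
    refine ENNReal.tsum_le_tsum fun i => ?_
    rw [lintegral_indicator_const isClosed_closure.measurableSet]
    rcases Set.eq_empty_or_nonempty (t n i) with h0 | h0
    · simp [h0]
    · have h1 : volume (closure (f '' t n i)) ≤ K * Metric.ediam (t n i) :=
        (Real.volume_le_diam _).trans (by
          rw [Metric.ediam_closure]; exact hf.ediam_image_le _)
      rw [iSup_pos h0]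
      calc Metric.ediam (t n i) ^ (m : ℝ) * volume (closure (f '' t n i))
          ≤ Metric.ediam (t n i) ^ (m : ℝ) * (K * Metric.ediam (t n i)) :=
            mul_le_mul_right h1 _
        _ = K * Metric.ediam (t n i) ^ ((m + 1 : ℕ) : ℝ) := by
            rw [ENNReal.rpow_natCast, ENNReal.rpow_natCast, pow_succ]; ring
  have hr : Tendsto (fun n : ℕ => ((n : ℝ≥0∞) + 1)⁻¹) atTop (𝓝 0) := by
    have := (tendsto_add_atTop_iff_nat 1).2 ENNReal.tendsto_inv_nat_nhds_zero
    simpa using this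
  refine ⟨fun s => liminf (fun n => G n s) atTop, Measurable.liminf hG, fun s => ?_, ?_⟩
  · refine (Measure.hausdorffMeasure_le_liminf_tsum (m : ℝ) (A ∩ f ⁻¹' {s}) _ hr
      (fun n i => t n i ∩ f ⁻¹' {s}) (Eventually.of_forall fun n i =>
        (Metric.ediam_mono Set.inter_subset_left).trans (ht2 n i))
      (Eventually.of_forall fun n => ?_)).trans ?_
    · rw [← Set.iUnion_inter]
      exact Set.inter_subset_inter_left _ (ht1 n)
    · refine liminf_le_liminf (Eventually.of_forall fun n => ENNReal.tsum_le_tsum fun i => ?_)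
      rcases Set.eq_empty_or_nonempty (t n i ∩ f ⁻¹' {s}) with h0 | ⟨x, hx, hxs⟩
      -- Positivity of `m` is what makes an empty slice contribute zero.
      · rw [h0, Metric.ediam_empty, ENNReal.zero_rpow_of_pos hm0]
        exact bot_le
      · rw [Set.indicator_of_mem (subset_closure (show s ∈ f '' t n i from ⟨x, hx, hxs⟩))]
        exact ENNReal.rpow_le_rpow (Metric.ediam_mono Set.inter_subset_left) hm0.le
  · refine (lintegral_liminf_le hG).trans ?_
    have h1 : Tendsto (fun n : ℕ => (K : ℝ≥0∞) * (μA + ((n : ℝ≥0∞) + 1)⁻¹)) atTop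
        (𝓝 (K * (μA + 0))) :=
      ENNReal.Tendsto.const_mul (tendsto_const_nhds.add hr) (Or.inr ENNReal.coe_ne_top)
    rw [add_zero] at h1
    exact (liminf_le_liminf (Eventually.of_forall hGint)).trans h1.liminf_eq.le

section

variable {X : Type*} [NormedAddCommGroup X] [NormedSpace ℝ X] [FiniteDimensional ℝ X]
  [MeasurableSpace X] [BorelSpace X] {m : ℕ}

theorem Small.measure_zero {N : Set X} (h : Small m N) : normalizedHausdorff X m N = 0 := by
  rcases h.eq_empty_or_dimH_lt with h | h
  · rw [h, measure_empty]
  · have : Measure.hausdorffMeasure (((m : ℝ≥0) : ℝ)) N = 0 := hausdorffMeasure_of_dimH_lt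
      (by exact_mod_cast h)
    rw [normalizedHausdorff, Measure.smul_apply]
    rw [NNReal.coe_natCast] at this
    rw [this, smul_zero]

theorem measurableSet_relInterior (σ : Affine.Simplex ℝ X m) : MeasurableSet (relInterior σ) := by
  have : relInterior σ = (plane σ : Set X) ∩ ⋂ i, {x | 0 < coord σ i x} := by
    ext x
    simp [mem_relInterior_iff]
  rw [this]
  refine (plane σ).closed_of_finiteDimensional.measurableSet.inter (MeasurableSet.iInter fun i => ?_)
  exact (isOpen_lt continuous_const (AffineMap.continuous_of_finiteDimensional _)).measurableSet

theorem measure_relInterior (σ : Affine.Simplex ℝ X m) :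
    normalizedHausdorff X m (relInterior σ) = normalizedHausdorff X m (body σ) := by
  refine le_antisymm (measure_mono (relInterior_subset_body σ)) ?_
  calc normalizedHausdorff X m (body σ)
      ≤ normalizedHausdorff X m (relInterior σ ∪ (body σ \ relInterior σ)) :=
        measure_mono (by rw [Set.union_sdiff_self]; exact Set.subset_union_right)
    _ ≤ normalizedHausdorff X m (relInterior σ) + normalizedHausdorff X m (body σ \ relInterior σ) :=
        measure_union_le _ _
    _ = _ := by rw [(small_body_diff_relInterior σ).measure_zero, add_zero]

theorem exists_measurable_bound_hausdorff_slices (f : X →ᵃ[ℝ] ℝ) (hm : 1 ≤ m) :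
    ∃ C : ℝ≥0∞, C ≠ ∞ ∧ ∀ σ : Affine.Simplex ℝ X (m + 1), ∃ g : ℝ → ℝ≥0∞, Measurable g ∧
      (∀ t, hausdorff m (body σ ∩ f ⁻¹' {t}) ≤ g t) ∧
      ∫⁻ t, g t ≤ C * hausdorff (m + 1) (body σ) := by
  have hl : LipschitzWith ‖LinearMap.toContinuousLinearMap f.linear‖₊ f := by
    intro x y
    have h1 := (LinearMap.toContinuousLinearMap f.linear).lipschitz x y
    have h2 : ∀ x, f x = LinearMap.toContinuousLinearMap f.linear x + f 0 :=
      fun x => congrFun f.decomp x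
    rw [h2 x, h2 y, edist_add_right]
    exact h1
  refine ⟨hausdorffConst m * (‖LinearMap.toContinuousLinearMap f.linear‖₊ /
    hausdorffConst (m + 1)), ?_, fun σ => ?_⟩
  · exact ENNReal.mul_ne_top (hausdorffConst_ne_top m)
      (ENNReal.div_ne_top ENNReal.coe_ne_top (hausdorffConst_ne_zero _))
  · have hfin := hausdorff_body_ne_top σ
    rw [hausdorff_eq, normalizedHausdorff, Measure.smul_apply, smul_eq_mul] at hfin
    have hfin' : Measure.hausdorffMeasure ((m + 1 : ℕ) : ℝ) (body σ) ≠ ∞ := fun h => hfin (by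
      rw [h, ENNReal.mul_top (hausdorffConst_ne_zero _)])
    obtain ⟨g, hg, h1, h2⟩ := exists_measurable_bound_slices hl hm hfin'
    refine ⟨fun t => hausdorffConst m * g t, hg.const_mul _, fun t => ?_, ?_⟩
    · rw [hausdorff_eq, normalizedHausdorff, Measure.smul_apply, smul_eq_mul]
      exact mul_le_mul_right (h1 t) _
    · rw [lintegral_const_mul _ hg, mul_assoc]
      refine mul_le_mul_right (h2.trans_eq ?_) _
      rw [hausdorff_eq, normalizedHausdorff, Measure.smul_apply, smul_eq_mul, ← mul_assoc,
        ENNReal.div_mul_cancel (hausdorffConst_ne_zero _) (hausdorffConst_ne_top _)]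

end

end HausdorffMeasure

/-! ### Mass through densities -/

section Mass

/-- The mass of a formal sum without any cancellation. -/
def formalMass {X : Type*} [AddCommGroup X] [Module ℝ X] {G : Type*} [NormedAddCommGroup G] {m : ℕ}
    (h : Set X → ℝ≥0∞) (c : FormalChain X G m) : ℝ≥0∞ :=
  c.sum fun σ g => ‖g‖ₑ * h (body σ)

section

variable {X : Type*} [AddCommGroup X] [Module ℝ X] {G : Type*} [NormedAddCommGroup G] {m : ℕ}
  {h : Set X → ℝ≥0∞}

theorem formalMass_single (σ : Affine.Simplex ℝ X m) (g : G) :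
    formalMass h (Finsupp.single σ g) = ‖g‖ₑ * h (body σ) :=
  Finsupp.sum_single_index (by simp)

theorem formalMass_zero : formalMass h (0 : FormalChain X G m) = 0 := Finsupp.sum_zero_index

theorem formalMass_add_le (c c' : FormalChain X G m) :
    formalMass h (c + c') ≤ formalMass h c + formalMass h c' := by
  classical
  have key : ∀ d : FormalChain X G m, d.support ⊆ c.support ∪ c'.support →
      formalMass h d = ∑ σ ∈ c.support ∪ c'.support, ‖d σ‖ₑ * h (body σ) := fun d hd =>
    Finsupp.sum_of_support_subset _ hd _ (by simp)
  rw [key _ Finsupp.support_add, key c Finset.subset_union_left, key c' Finset.subset_union_right,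
    ← Finset.sum_add_distrib]
  refine Finset.sum_le_sum fun σ _ => ?_
  rw [← add_mul, Finsupp.add_apply]
  exact mul_le_mul_left (enorm_add_le _ _) _

theorem formalMass_neg (c : FormalChain X G m) : formalMass h (-c) = formalMass h c := by
  simp [formalMass, Finsupp.sum, Finsupp.support_neg]

theorem formalMass_sum_le {ι : Type*} (s : Finset ι) (c : ι → FormalChain X G m) :
    formalMass h (∑ i ∈ s, c i) ≤ ∑ i ∈ s, formalMass h (c i) := by
  classical
  induction s using Finset.induction_on with
  | empty => simp [formalMass_zero]
  | insert a s ha ih =>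
    rw [Finset.sum_insert ha, Finset.sum_insert ha]
    exact (formalMass_add_le _ _).trans (add_le_add_right ih _)

theorem formalMass_le_mul {h' : Set X → ℝ≥0∞} {C : ℝ≥0∞} (hC : ∀ A, h A ≤ C * h' A)
    (c : FormalChain X G m) : formalMass h c ≤ C * formalMass h' c := by
  rw [formalMass, formalMass, Finsupp.sum, Finsupp.sum, Finset.mul_sum]
  refine Finset.sum_le_sum fun σ _ => ?_
  rw [mul_left_comm]
  exact mul_le_mul_right (hC _) _

theorem mass_le_formalMass_of_nonOverlapping {c : FormalChain X G m} (hc : NonOverlapping h c) :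
    mass h (toChain c) ≤ formalMass h c :=
  iInf_le_of_le c (iInf_le_of_le rfl (iInf_le_of_le hc le_rfl))

theorem mass_le_mul {h' : Set X → ℝ≥0∞} {C : ℝ≥0∞} (hC : ∀ A, h A ≤ C * h' A)
    (P : PolyhedralChain X G m) (hC0 : C ≠ 0) (hCt : C ≠ ∞) : mass h P ≤ C * mass h' P := by
  have hCi : C⁻¹ ≠ 0 := ENNReal.inv_ne_zero.2 hCt
  rw [← ENNReal.inv_mul_le_iff hC0 hCt]
  refine le_iInf fun c => le_iInf fun hcP => le_iInf fun hc => ?_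
  rw [ENNReal.inv_mul_le_iff hC0 hCt]
  subst hcP
  refine (mass_le_formalMass_of_nonOverlapping fun σ hσ τ hτ hne => ?_).trans
    (formalMass_le_mul hC c)
  have := hC (body σ ∩ body τ)
  rw [hc σ hσ τ hτ hne, mul_zero] at this
  exact le_antisymm this bot_le

theorem exists_formalMass_lt {P : PolyhedralChain X G m} {a : ℝ≥0∞} (ha : mass h P < a) :
    ∃ c : FormalChain X G m, toChain c = P ∧ formalMass h c < a := by
  simp only [mass, iInf_lt_iff] at ha
  obtain ⟨c, hc, _, h⟩ := ha
  exact ⟨c, hc, h⟩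

theorem enorm_density_le (L : Fin m → X →ₗ[ℝ] ℝ) (x : X) (c : FormalChain X G m) :
    ‖density L x c‖ₑ ≤ ∑ σ ∈ c.support, (relInterior σ).indicator (fun _ => ‖c σ‖ₑ) x := by
  classical
  rw [density_eq_sum]
  refine (enorm_sum_le _ _).trans (Finset.sum_le_sum fun σ _ => ?_)
  rw [density_single, Set.indicator_apply]
  split_ifs
  · rcases SignType.sign (frameDet L σ.points) with _ | _ | _ <;> simp
  · simp

theorem toChain_eq_iff {c c' : FormalChain X G m} :
    toChain c = toChain c' ↔ c - c' ∈ relations X G m :=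
  QuotientAddGroup.eq_iff_sub_mem

end

theorem formalMass_ne_top {X : Type*} [NormedAddCommGroup X] [NormedSpace ℝ X]
    {G : Type*} [NormedAddCommGroup G] {m : ℕ} (c : FormalChain X G m) : formalMass (hausdorff m) c ≠ ∞ := by
  borelize X
  exact ENNReal.sum_ne_top.2 fun σ _ => ENNReal.mul_ne_top enorm_ne_top (hausdorff_body_ne_top σ)

variable {X : Type*} [NormedAddCommGroup X] [NormedSpace ℝ X] [FiniteDimensional ℝ X]
  {G : Type*} [NormedAddCommGroup G] {m : ℕ}

theorem StronglyDisjoint.nonOverlapping {c : FormalChain X G m} (hc : StronglyDisjoint c) :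
    NonOverlapping (hausdorff m) c := by
  borelize X
  intro σ hσ τ hτ hne
  rw [hausdorff_eq]
  refine ((small_body_diff_relInterior σ).mono ?_).measure_zero
  exact fun x hx => ⟨hx.1, fun hx' => Set.disjoint_left.1 (hc σ hσ τ hτ hne) hx' hx.2⟩

/-- On a representative without overlaps, the coefficient of a simplex equals the density almost
everywhere on it; the relative interiors are disjoint, so the integrals add up. -/
theorem hausdorffMass_le_lintegral [MeasurableSpace X] [BorelSpace X] {c : FormalChain X G m}
    {F : X → ℝ≥0∞} {N : Set X} (hN : Small m N)
    (hF : ∀ L, ∀ x ∉ N, ‖density L x c‖ₑ ≤ F x) :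
    hausdorffMass (toChain c) ≤ ∫⁻ x, F x ∂normalizedHausdorff X m := by
  classical
  obtain ⟨c', hd, hr⟩ := exists_stronglyDisjoint c
  obtain ⟨N', hN', hnull⟩ := nullChain_of_mem_relations hr
  rw [toChain_eq_iff.2 hr]
  refine (mass_le_formalMass_of_nonOverlapping hd.nonOverlapping).trans ?_
  have hle : ∀ τ ∈ c'.support, ‖c' τ‖ₑ * hausdorff m (body τ) ≤
      ∫⁻ x in relInterior τ, F x ∂normalizedHausdorff X m := by
    intro τ hτ
    rw [hausdorff_eq, ← measure_relInterior, ← setLIntegral_const]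
    refine setLIntegral_mono_ae' (measurableSet_relInterior τ) ?_
    have h0 : ∀ᵐ x ∂normalizedHausdorff X m, x ∉ N ∪ N' :=
      measure_eq_zero_iff_ae_notMem.1 (hN.union hN').measure_zero
    filter_upwards [h0] with x hx hxτ
    obtain ⟨L, hL⟩ := exists_frameDet_eq_one τ
    have h1 := hd.density_eq hτ hxτ L
    rw [hL, sign_one, SignType.coe_one, one_smul] at h1
    have h2 := hnull L x fun h => hx (Or.inr h)
    rw [map_sub, sub_eq_zero, h1] at h2
    rw [← h2]
    exact hF L x fun h => hx (Or.inl h)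
  refine (Finset.sum_le_sum hle).trans ?_
  rw [← lintegral_biUnion_finset (fun τ hτ τ' hτ' hne => ?_)
    fun τ _ => measurableSet_relInterior τ]
  · exact setLIntegral_le_lintegral _ _
  · exact (hd τ hτ τ' hτ' hne).mono_right (relInterior_subset_body τ')

theorem lintegral_sum_indicator [MeasurableSpace X] [BorelSpace X] (c : FormalChain X G m) :
    ∫⁻ x, ∑ σ ∈ c.support, (relInterior σ).indicator (fun _ => ‖c σ‖ₑ) x
      ∂normalizedHausdorff X m = formalMass (hausdorff m) c := by
  rw [lintegral_finsetSum _ fun σ _ => measurable_const.indicator (measurableSet_relInterior σ)]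
  refine Finset.sum_congr rfl fun σ _ => ?_
  rw [lintegral_indicator_const (measurableSet_relInterior σ), measure_relInterior, ← hausdorff_eq]

/-- Overlaps can only produce cancellation: the norm of the density is at most the sum of the norms
of the coefficients present at the point. -/
theorem hausdorffMass_le_formalMass (c : FormalChain X G m) :
    hausdorffMass (toChain c) ≤ formalMass (hausdorff m) c := by
  borelize X
  exact (hausdorffMass_le_lintegral (small_empty m) fun L x _ => enorm_density_le L x c).trans_eq
    (lintegral_sum_indicator c)

theorem enorm_mul_le_formalMass {c : FormalChain X G m} {σ : Affine.Simplex ℝ X m} {g : G}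
    (h : toChain c = toChain (Finsupp.single σ g)) :
    ‖g‖ₑ * hausdorff m (body σ) ≤ formalMass (hausdorff m) c := by
  borelize X
  obtain ⟨N, hN, hnull⟩ := nullChain_of_mem_relations (toChain_eq_iff.1 h)
  obtain ⟨L, hL⟩ := exists_frameDet_eq_one σ
  calc ‖g‖ₑ * hausdorff m (body σ)
      = ∫⁻ x in relInterior σ, ‖g‖ₑ ∂normalizedHausdorff X m := by
        rw [setLIntegral_const, measure_relInterior, hausdorff_eq]
    _ ≤ ∫⁻ x in relInterior σ, ∑ τ ∈ c.support, (relInterior τ).indicator (fun _ => ‖c τ‖ₑ) x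
          ∂normalizedHausdorff X m := by
        refine setLIntegral_mono_ae' (measurableSet_relInterior σ) ?_
        filter_upwards [measure_eq_zero_iff_ae_notMem.1 hN.measure_zero] with x hx hxσ
        have h2 := hnull L x hx
        rw [map_sub, sub_eq_zero, density_single_of_mem hxσ, hL, sign_one, SignType.coe_one,
          one_smul] at h2
        rw [← h2]
        exact enorm_density_le L x c
    _ ≤ ∫⁻ x, ∑ τ ∈ c.support, (relInterior τ).indicator (fun _ => ‖c τ‖ₑ) x
          ∂normalizedHausdorff X m := setLIntegral_le_lintegral _ _
    _ = formalMass (hausdorff m) c := lintegral_sum_indicator c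

theorem hausdorffMass_single (σ : Affine.Simplex ℝ X m) (g : G) :
    hausdorffMass (toChain (Finsupp.single σ g)) = ‖g‖ₑ * hausdorff m (body σ) := by
  refine le_antisymm ?_ ?_
  · rw [← formalMass_single (h := hausdorff m)]
    exact hausdorffMass_le_formalMass _
  · exact le_iInf fun c => le_iInf fun hc => le_iInf fun _ => enorm_mul_le_formalMass hc

/-- The identity is bounded in both directions between the two norms of `X`; the two normed
structures are passed explicitly. -/
theorem exists_euclideanHausdorff_comparison {X : Type*} [nX : NormedAddCommGroup X]
    [sX : NormedSpace ℝ X] [fX : FiniteDimensional ℝ X] (ip : InnerProductSpace.Core ℝ X) (m : ℕ) :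
    ∃ C : ℝ≥0∞, C ≠ 0 ∧ C ≠ ∞ ∧ (∀ A : Set X, euclideanHausdorff ip m A ≤ C * hausdorff m A) ∧
      ∀ A : Set X, hausdorff m A ≤ C * euclideanHausdorff ip m A := by
  let n₁ : NormedAddCommGroup X := ip.toNormedAddCommGroup
  let s₁ : @NormedSpace ℝ X _ n₁.toSeminormedAddCommGroup :=
    @InnerProductSpace.Core.toNormedSpace ℝ X _ nX.toAddCommGroup sX.toModule
      (@InnerProductSpace.Core.toCore ℝ X _ nX.toAddCommGroup sX.toModule ip)
  have f₁ : @FiniteDimensional ℝ X _ n₁.toAddCommGroup s₁.toModule := fX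
  obtain ⟨C₁, h₁, h₁', H₁⟩ := @hausdorff_image_le X X nX sX fX n₁ s₁
    (@LinearMap.id ℝ X _ nX.toAddCommGroup.toAddCommMonoid sX.toModule) m
  obtain ⟨C₂, h₂, h₂', H₂⟩ := @hausdorff_image_le X X n₁ s₁ f₁ nX sX
    (@LinearMap.id ℝ X _ nX.toAddCommGroup.toAddCommMonoid sX.toModule) m
  refine ⟨C₁ + C₂, by simp [h₁], ENNReal.add_ne_top.2 ⟨h₁', h₂'⟩, fun A => ?_, fun A => ?_⟩
  · have := H₁ A
    rw [LinearMap.id_coe, Set.image_id] at this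
    exact this.trans (mul_le_mul_left le_self_add _)
  · have := H₂ A
    rw [LinearMap.id_coe, Set.image_id] at this
    exact this.trans (mul_le_mul_left le_add_self _)

end Mass

/-! ### Restriction of chains to polyhedra -/

section Restriction

variable {X : Type*} [NormedAddCommGroup X] [NormedSpace ℝ X] {m : ℕ}

/-- The formal sum `c'` represents the restriction to `U` of the chain represented by `c`. -/
def IsRestriction {G : Type*} [AddCommGroup G] (U : Set X) (c c' : FormalChain X G m) : Prop :=
  ∃ N : Set X, Small m N ∧ ∀ (L : Fin m → X →ₗ[ℝ] ℝ), ∀ x ∉ N,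
    density L x c' = U.indicator (fun x => density L x c) x

section

variable {G : Type*} [AddCommGroup G] {U U' : Set X} {c c' d d' : FormalChain X G m}

theorem IsRestriction.add (h : IsRestriction U c c') (h' : IsRestriction U d d') :
    IsRestriction U (c + d) (c' + d') := by
  obtain ⟨N, hN, h⟩ := h
  obtain ⟨N', hN', h'⟩ := h'
  refine ⟨N ∪ N', hN.union hN', fun L x hx => ?_⟩
  rw [map_add, h L x fun hx' => hx (Or.inl hx'), h' L x fun hx' => hx (Or.inr hx')]
  by_cases hU : x ∈ U <;> simp [hU]

theorem IsRestriction.sum {ι : Type*} (s : Finset ι) {c c' : ι → FormalChain X G m}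
    (h : ∀ i ∈ s, IsRestriction U (c i) (c' i)) :
    IsRestriction U (∑ i ∈ s, c i) (∑ i ∈ s, c' i) := by
  classical
  induction s using Finset.induction_on with
  | empty => exact ⟨∅, small_empty m, fun L x _ => by simp⟩
  | insert a s ha ih =>
    rw [Finset.sum_insert ha, Finset.sum_insert ha]
    exact (h a (Finset.mem_insert_self a s)).add
      (ih fun i hi => h i (Finset.mem_insert_of_mem hi))

theorem IsRestriction.trans (h : IsRestriction U c c') (h' : IsRestriction U' c' d) :
    IsRestriction (U ∩ U') c d := by
  obtain ⟨N, hN, h⟩ := h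
  obtain ⟨N', hN', h'⟩ := h'
  refine ⟨N ∪ N', hN.union hN', fun L x hx => ?_⟩
  rw [h' L x fun hx' => hx (Or.inr hx')]
  by_cases hU' : x ∈ U'
  · rw [Set.indicator_of_mem hU', h L x fun hx' => hx (Or.inl hx')]
    by_cases hU : x ∈ U <;> simp [hU, hU']
  · simp [hU']

theorem IsRestriction.nullChain_sub (h : IsRestriction U c c') (h' : IsRestriction U c d) :
    NullChain (c' - d) := by
  obtain ⟨N, hN, h⟩ := h
  obtain ⟨N', hN', h'⟩ := h'
  refine ⟨N ∪ N', hN.union hN', fun L x hx => ?_⟩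
  rw [map_sub, h L x fun hx' => hx (Or.inl hx'), h' L x fun hx' => hx (Or.inr hx'), sub_self]

theorem isRestriction_univ_of_nullChain (h : NullChain (c - c')) : IsRestriction Set.univ c c' := by
  obtain ⟨N, hN, h⟩ := h
  refine ⟨N, hN, fun L x hx => ?_⟩
  have := h L x hx
  rw [map_sub, sub_eq_zero] at this
  simp [this]

end

theorem formalMass_inter_le {G : Type*} [NormedAddCommGroup G] (U : Set X)
    (c : FormalChain X G m) :
    formalMass (fun A => hausdorff m (A ∩ U)) c ≤ formalMass (hausdorff m) c := by
  borelize X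
  refine Finset.sum_le_sum fun σ _ => mul_le_mul_right ?_ _
  dsimp only
  rw [hausdorff_eq, hausdorff_eq]
  exact measure_mono Set.inter_subset_left

variable [FiniteDimensional ℝ X] {G : Type*} [NormedAddCommGroup G]

/-- The open polyhedron where finitely many affine functions are positive. -/
def posSet (𝓕 : Finset (X →ᵃ[ℝ] ℝ)) : Set X := {x | ∀ f ∈ 𝓕, 0 < f x}

/-- Once no `f ∈ 𝓕` changes sign on the pieces of `σ`, the restriction consists of the pieces where
every `f` is nonnegative and not identically zero. -/
theorem exists_isRestriction_single (𝓕 : Finset (X →ᵃ[ℝ] ℝ)) (σ : Affine.Simplex ℝ X m) (g : G) :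
    ∃ c : FormalChain X G m, IsRestriction (posSet 𝓕) (Finsupp.single σ g) c ∧
      formalMass (hausdorff m) c ≤ ‖g‖ₑ * hausdorff m (body σ ∩ posSet 𝓕) := by
  classical
  borelize X
  obtain ⟨𝒯, h𝒯, hu⟩ := exists_subdivides_forall_uncut 𝓕 σ
  let q : Affine.Simplex ℝ X m → Prop := fun τ =>
    ∀ f ∈ 𝓕, (∀ i, 0 ≤ f (τ.points i)) ∧ ∃ i, f (τ.points i) ≠ 0
  have hq : ∀ τ, q τ → relInterior τ ⊆ posSet 𝓕 := by
    intro τ hτ x hx f hf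
    obtain ⟨h0, i, hi⟩ := hτ f hf
    exact pos_of_mem_relInterior h0 hi hx
  have hq' : ∀ τ ∈ 𝒯, ¬ q τ → ∀ x ∈ posSet 𝓕, x ∉ relInterior τ := by
    intro τ hτ hnq x hxU hx
    simp only [q, not_forall] at hnq
    obtain ⟨f, hf, hnq⟩ := hnq
    have hx0 := hxU f hf
    rcases hu τ hτ f hf with h | h
    · refine hnq ⟨h, ?_⟩
      by_contra hcon
      push Not at hcon
      exact hx0.ne' (eq_zero_of_mem_plane hcon (mem_relInterior_iff.1 hx).1)
    · exact absurd hx0 (not_lt.2 (nonpos_of_mem_body h (relInterior_subset_body τ hx)))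
  refine ⟨∑ τ ∈ 𝒯.filter q, Finsupp.single τ g, ?_, ?_⟩
  · obtain ⟨N, hN, hnull⟩ := nullChain_of_mem_relations (h𝒯.sub_mem_relations g)
    refine ⟨N, hN, fun L x hx => ?_⟩
    have h1 := hnull L x hx
    rw [map_sub, map_sum, sub_eq_zero] at h1
    rw [map_sum]
    by_cases hxU : x ∈ posSet 𝓕
    · rw [Set.indicator_of_mem hxU, h1, Finset.sum_filter_of_ne]
      intro τ hτ hne
      by_contra hnq
      exact hne (density_single_of_notMem (hq' τ hτ hnq x hxU) g)
    · rw [Set.indicator_of_notMem hxU]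
      refine Finset.sum_eq_zero fun τ hτ => density_single_of_notMem (fun hx' => hxU ?_) g
      exact hq τ (Finset.mem_filter.1 hτ).2 hx'
  · refine (formalMass_sum_le _ _).trans ?_
    simp_rw [formalMass_single]
    rw [← Finset.mul_sum]
    refine mul_le_mul_right ?_ _
    simp_rw [hausdorff_eq, ← measure_relInterior]
    rw [← measure_biUnion_finset (fun τ hτ τ' hτ' hne => h𝒯.disjoint τ (Finset.mem_filter.1 hτ).1 τ'
      (Finset.mem_filter.1 hτ').1 hne) fun τ _ => measurableSet_relInterior τ]
    refine measure_mono (Set.iUnion₂_subset fun τ hτ => Set.subset_inter ?_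
      (hq τ (Finset.mem_filter.1 hτ).2))
    exact (relInterior_subset_body τ).trans (h𝒯.body_subset (Finset.mem_filter.1 hτ).1)

theorem exists_isRestriction (𝓕 : Finset (X →ᵃ[ℝ] ℝ)) (c : FormalChain X G m) :
    ∃ c' : FormalChain X G m, IsRestriction (posSet 𝓕) c c' ∧
      formalMass (hausdorff m) c' ≤ formalMass (fun A => hausdorff m (A ∩ posSet 𝓕)) c := by
  choose d hd1 hd2 using fun σ : Affine.Simplex ℝ X m =>
    fun g : G => exists_isRestriction_single 𝓕 σ g
  refine ⟨∑ σ ∈ c.support, d σ (c σ), ?_, ?_⟩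
  · have := IsRestriction.sum c.support fun σ _ => hd1 σ (c σ)
    have e : ∑ σ ∈ c.support, Finsupp.single σ (c σ) = c := Finsupp.sum_single c
    rwa [e] at this
  · exact (formalMass_sum_le _ _).trans (Finset.sum_le_sum fun σ _ => hd2 σ (c σ))

/-! ### Slices by hyperplanes -/

/-- Let `r` be the part of the simplex where `f ≥ 0`. Its boundary is the part of the old boundary
in `f > 0` plus facets inside `f = 0`, which `s` removes. There are at most `2 ^ (m + 2)` pieces
with `m + 2` facets each. -/
theorem exists_slice_single (f : X →ᵃ[ℝ] ℝ) (σ : Affine.Simplex ℝ X (m + 1)) (g : G) :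
    ∃ (r : FormalChain X G (m + 1)) (s : FormalChain X G m),
      IsRestriction {x | 0 < f x} (formalBoundary (Finsupp.single σ g)) (formalBoundary r + s) ∧
      formalMass (hausdorff (m + 1)) r ≤ ‖g‖ₑ * hausdorff (m + 1) (body σ) ∧
      formalMass (hausdorff m) s ≤
        (2 ^ (m + 2) * (m + 2) : ℕ) * (‖g‖ₑ * hausdorff m (body σ ∩ f ⁻¹' {0})) := by
  classical
  borelize X
  obtain ⟨𝒯, h𝒯, hu, hcard⟩ := exists_subdivides_uncut f σ
  let q : Affine.Simplex ℝ X (m + 1) → Prop := fun τ => ∀ i, 0 ≤ f (τ.points i)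
  let z : Affine.Simplex ℝ X (m + 1) → Fin (m + 2) → Prop := fun τ i =>
    ∀ j, f ((facet τ i).points j) = 0
  let F : Affine.Simplex ℝ X (m + 1) → Fin (m + 2) → FormalChain X G m := fun τ i =>
    Finsupp.single (facet τ i) ((-1 : ℤ) ^ (i : ℕ) • g)
  have hen : ∀ i : Fin (m + 2), ‖(-1 : ℤ) ^ (i : ℕ) • g‖ₑ = ‖g‖ₑ := by
    intro i
    rcases neg_one_pow_eq_or ℤ (i : ℕ) with h | h <;> simp [h]
  refine ⟨∑ τ ∈ 𝒯.filter q, Finsupp.single τ g,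
    -∑ τ ∈ 𝒯.filter q, ∑ i ∈ Finset.univ.filter (z τ), F τ i, ?_, ?_, ?_⟩
  · obtain ⟨N, hN, hnull⟩ := nullChain_of_mem_relations
      (formalBoundary_mem_relations (h𝒯.sub_mem_relations g))
    refine ⟨N, hN, fun L x hx => ?_⟩
    have h1 := hnull L x hx
    rw [formalBoundary_sub, map_sub, sub_eq_zero, formalBoundary_sum, map_sum] at h1
    rw [map_add, map_neg, formalBoundary_sum, map_sum, map_sum]
    have hτ : ∀ τ, density L x (formalBoundary (Finsupp.single τ g)) = ∑ i, density L x (F τ i) :=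
      fun τ => density_formalBoundary_single L x τ g
    by_cases hxU : 0 < f x
    · rw [Set.indicator_of_mem (show x ∈ {x | 0 < f x} from hxU), h1, Finset.sum_filter_of_ne]
      · rw [add_eq_left, neg_eq_zero]
        refine Finset.sum_eq_zero fun τ _ => ?_
        rw [map_sum]
        refine Finset.sum_eq_zero fun i hi => density_single_of_notMem (fun hx' => ?_) _
        exact hxU.ne' (eq_zero_of_mem_plane (Finset.mem_filter.1 hi).2
          (mem_relInterior_iff.1 hx').1)
      · intro τ hτ' hne
        rcases hu τ hτ' with h | h
        · exact h
        · refine absurd ?_ hne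
          rw [hτ]
          refine Finset.sum_eq_zero fun i _ => density_single_of_notMem (fun hx' => ?_) _
          exact absurd hxU (not_lt.2 (nonpos_of_mem_body h
            (body_facet_subset τ i (relInterior_subset_body _ hx'))))
    · rw [Set.indicator_of_notMem (show x ∉ {x | 0 < f x} from hxU), ← sub_eq_add_neg, ← Finset.sum_sub_distrib]
      refine Finset.sum_eq_zero fun τ hτ' => ?_
      rw [hτ, map_sum, ← Finset.sum_filter_add_sum_filter_not Finset.univ (z τ), add_sub_cancel_left]
      refine Finset.sum_eq_zero fun i hi => density_single_of_notMem (fun hx' => hxU ?_) _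
      have hz := (Finset.mem_filter.1 hi).2
      simp only [z, not_forall] at hz
      obtain ⟨j, hj⟩ := hz
      exact pos_of_mem_relInterior (σ := facet τ i) (fun k => (Finset.mem_filter.1 hτ').2 _) hj hx'
  · refine (formalMass_sum_le _ _).trans ?_
    simp_rw [formalMass_single]
    rw [← Finset.mul_sum]
    refine mul_le_mul_right ?_ _
    simp_rw [hausdorff_eq, ← measure_relInterior (X := X) (m := m + 1)]
    rw [← measure_biUnion_finset (fun τ hτ τ' hτ' hne => h𝒯.disjoint τ (Finset.mem_filter.1 hτ).1 τ'
      (Finset.mem_filter.1 hτ').1 hne) fun τ _ => measurableSet_relInterior τ]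
    exact measure_mono (Set.iUnion₂_subset fun τ hτ =>
      relInterior_subset_of_body_subset (h𝒯.body_subset (Finset.mem_filter.1 hτ).1))
  · rw [formalMass_neg]
    set B := ‖g‖ₑ * hausdorff m (body σ ∩ f ⁻¹' {0}) with hB
    have hF : ∀ τ ∈ 𝒯, ∀ i ∈ Finset.univ.filter (z τ), formalMass (hausdorff m) (F τ i) ≤ B := by
      intro τ hτ i hi
      rw [formalMass_single, hen, hB, hausdorff_eq, hausdorff_eq]
      refine mul_le_mul_right (measure_mono (Set.subset_inter
        ((body_facet_subset τ i).trans (h𝒯.body_subset hτ)) fun x hx => ?_)) _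
      exact eq_zero_of_mem_plane (Finset.mem_filter.1 hi).2 (body_subset_plane _ hx)
    calc formalMass (hausdorff m) (∑ τ ∈ 𝒯.filter q, ∑ i ∈ Finset.univ.filter (z τ), F τ i)
        ≤ ∑ τ ∈ 𝒯.filter q, ∑ i ∈ Finset.univ.filter (z τ), formalMass (hausdorff m) (F τ i) :=
          (formalMass_sum_le _ _).trans (Finset.sum_le_sum fun τ _ => formalMass_sum_le _ _)
      _ ≤ ∑ _τ ∈ 𝒯.filter q, (m + 2 : ℕ) • B := by
          refine Finset.sum_le_sum fun τ hτ => ?_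
          refine (Finset.sum_le_card_nsmul _ _ B (hF τ (Finset.mem_filter.1 hτ).1)).trans ?_
          exact nsmul_le_nsmul_left zero_le ((Finset.card_filter_le _ _).trans (by simp))
      _ ≤ (2 ^ (m + 2)) • ((m + 2 : ℕ) • B) := by
          rw [Finset.sum_const]
          exact nsmul_le_nsmul_left zero_le ((Finset.card_filter_le _ _).trans hcard)
      _ = _ := by
          rw [smul_smul, nsmul_eq_mul]

theorem exists_slice (f : X →ᵃ[ℝ] ℝ) (c : FormalChain X G (m + 1)) (t : ℝ) :
    ∃ (r : FormalChain X G (m + 1)) (s : FormalChain X G m),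
      IsRestriction {x | t < f x} (formalBoundary c) (formalBoundary r + s) ∧
      formalMass (hausdorff (m + 1)) r ≤ formalMass (hausdorff (m + 1)) c ∧
      formalMass (hausdorff m) s ≤ (2 ^ (m + 2) * (m + 2) : ℕ) *
        ∑ σ ∈ c.support, ‖c σ‖ₑ * hausdorff m (body σ ∩ f ⁻¹' {t}) := by
  choose r s h1 h2 h3 using fun (σ : Affine.Simplex ℝ X (m + 1)) (g : G) =>
    exists_slice_single (f - AffineMap.const ℝ X t) σ g
  have e1 : {x | 0 < (f - AffineMap.const ℝ X t) x} = {x | t < f x} := by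
    ext x; simp
  have e2 : (f - AffineMap.const ℝ X t) ⁻¹' {0} = f ⁻¹' {t} := by
    ext x; simp [sub_eq_zero]
  rw [e1] at h1
  simp_rw [e2] at h3
  refine ⟨∑ σ ∈ c.support, r σ (c σ), ∑ σ ∈ c.support, s σ (c σ), ?_, ?_, ?_⟩
  · have := IsRestriction.sum c.support fun σ _ => h1 σ (c σ)
    rw [← formalBoundary_sum, Finset.sum_add_distrib, ← formalBoundary_sum] at this
    have e : ∑ σ ∈ c.support, Finsupp.single σ (c σ) = c := Finsupp.sum_single c
    rwa [e] at this
  · exact (formalMass_sum_le _ _).trans (Finset.sum_le_sum fun σ _ => h2 σ (c σ))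
  · refine (formalMass_sum_le _ _).trans ?_
    rw [Finset.mul_sum]
    exact Finset.sum_le_sum fun σ _ => h3 σ (c σ)

/-- Some level does no worse than the average of the slice bound over `(a, b)`. The constant depends
on `f` and `b - a` but not on the chain. -/
theorem exists_good_slice (f : X →ᵃ[ℝ] ℝ) (hm : 1 ≤ m) {a b : ℝ} (hab : a < b) :
    ∃ C : ℝ≥0∞, C ≠ ∞ ∧ ∀ c : FormalChain X G (m + 1), ∃ t ∈ Set.Ioo a b,
      ∃ (r : FormalChain X G (m + 1)) (s : FormalChain X G m),
      IsRestriction {x | t < f x} (formalBoundary c) (formalBoundary r + s) ∧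
      formalMass (hausdorff (m + 1)) r ≤ formalMass (hausdorff (m + 1)) c ∧
      formalMass (hausdorff m) s ≤ C * formalMass (hausdorff (m + 1)) c := by
  borelize X
  obtain ⟨C, hC, hσ⟩ := exists_measurable_bound_hausdorff_slices f hm
  choose γ hγm hγ1 hγ2 using hσ
  have hv : volume (Set.Ioo a b) = ENNReal.ofReal (b - a) := Real.volume_Ioo
  have hv0 : ENNReal.ofReal (b - a) ≠ 0 := (ENNReal.ofReal_pos.2 (sub_pos.2 hab)).ne'
  refine ⟨(2 ^ (m + 2) * (m + 2) : ℕ) * (C / ENNReal.ofReal (b - a)),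
    ENNReal.mul_ne_top (ENNReal.natCast_ne_top _) (ENNReal.div_ne_top hC hv0), fun c => ?_⟩
  let H : ℝ → ℝ≥0∞ := fun t => ∑ σ ∈ c.support, ‖c σ‖ₑ * γ σ t
  have hH : ∫⁻ t, H t ≤ C * formalMass (hausdorff (m + 1)) c := by
    rw [lintegral_finsetSum _ fun σ _ => (hγm σ).const_mul _, formalMass, Finsupp.sum,
      Finset.mul_sum]
    refine Finset.sum_le_sum fun σ _ => ?_
    rw [lintegral_const_mul _ (hγm σ), mul_left_comm]
    exact mul_le_mul_right (hγ2 σ) _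
  obtain ⟨t, ht, hle⟩ := exists_le_setLAverage (μ := volume) (s := Set.Ioo a b) (f := H)
    (by rw [hv]; exact hv0) (by rw [hv]; exact ENNReal.ofReal_ne_top)
    (Finset.measurable_fun_sum _ fun σ _ => (hγm σ).const_mul _).aemeasurable
  obtain ⟨r, s, h1, h2, h3⟩ := exists_slice f c t
  refine ⟨t, ht, r, s, h1, h2, h3.trans ?_⟩
  rw [mul_assoc]
  refine mul_le_mul_right ?_ _
  calc ∑ σ ∈ c.support, ‖c σ‖ₑ * hausdorff m (body σ ∩ f ⁻¹' {t}) ≤ H t :=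
        Finset.sum_le_sum fun σ _ => mul_le_mul_right (hγ1 σ t) _
    _ ≤ (∫⁻ t in Set.Ioo a b, H t) / ENNReal.ofReal (b - a) := by
        rw [← hv]; rwa [setLAverage_eq] at hle
    _ ≤ (C * formalMass (hausdorff (m + 1)) c) / ENNReal.ofReal (b - a) :=
        ENNReal.div_le_div_right ((setLIntegral_le_lintegral _ _).trans hH) _
    _ = C / ENNReal.ofReal (b - a) * formalMass (hausdorff (m + 1)) c := by
        rw [ENNReal.div_eq_inv_mul, ENNReal.div_eq_inv_mul, mul_assoc]

/-- Restriction of an identity `z = Q + ∂R` to a polyhedron whose faces are at well chosen levels. -/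
theorem exists_restriction_to_polyhedron {ι : Type*} (f : ι → X →ᵃ[ℝ] ℝ) (hm : 1 ≤ m)
    {a b : ι → ℝ} (hab : ∀ i, a i < b i) (J : Finset ι) :
    ∃ C : ℝ≥0∞, C ≠ ∞ ∧ ∀ (z Q : FormalChain X G m) (R : FormalChain X G (m + 1)),
      NullChain (z - (Q + formalBoundary R)) →
      ∃ t : ι → ℝ, (∀ i, t i ∈ Set.Ioo (a i) (b i)) ∧
      ∃ (Q' : FormalChain X G m) (R' : FormalChain X G (m + 1)),
        IsRestriction {x | ∀ i ∈ J, t i < f i x} z (Q' + formalBoundary R') ∧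
        formalMass (hausdorff m) Q' ≤
          formalMass (hausdorff m) Q + C * formalMass (hausdorff (m + 1)) R ∧
        formalMass (hausdorff (m + 1)) R' ≤ formalMass (hausdorff (m + 1)) R := by
  classical
  induction J using Finset.induction_on with
  | empty =>
    refine ⟨0, by simp, fun z Q R h => ⟨fun i => (a i + b i) / 2, fun i => ?_, Q, R, ?_, ?_, le_rfl⟩⟩
    · constructor <;> linarith [hab i]
    · simpa using isRestriction_univ_of_nullChain h
    · simp
  | insert j J hj ih =>
    obtain ⟨C, hC, ih⟩ := ih
    obtain ⟨C', hC', hslice⟩ := exists_good_slice (G := G) (f j) hm (hab j)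
    refine ⟨C + C', ENNReal.add_ne_top.2 ⟨hC, hC'⟩, fun z Q R h => ?_⟩
    obtain ⟨t, ht, Q', R', h1, h2, h3⟩ := ih z Q R h
    -- Restricting `∂R'` to the half space creates the slice `s`, which is absorbed into the `Q`
    -- part.
    obtain ⟨u, hu, r, s, h4, h5, h6⟩ := hslice R'
    obtain ⟨Q'', h7, h8⟩ := exists_isRestriction {f j - AffineMap.const ℝ X u} Q'
    have e : posSet {f j - AffineMap.const ℝ X u} = {x | u < f j x} := by
      ext x; simp [posSet]
    rw [e] at h7
    refine ⟨Function.update t j u, fun i => ?_, Q'' + s, r, ?_, ?_, h5.trans h3⟩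
    · by_cases hij : i = j
      · subst hij; simpa using hu
      · simpa [hij] using ht i
    · have h9 := h1.trans (h7.add h4)
      have e1 : Q'' + (formalBoundary r + s) = Q'' + s + formalBoundary r := by abel
      rw [e1] at h9
      convert h9 using 1
      ext x
      simp only [Finset.forall_mem_insert, Set.mem_ofPred_eq, Function.update_self, Set.mem_inter_iff]
      rw [and_comm]
      refine and_congr_left fun _ => forall₂_congr fun i hi => ?_
      rw [Function.update_of_ne (show i ≠ j from fun h => hj (h ▸ hi))]
    · calc formalMass (hausdorff m) (Q'' + s)
          ≤ formalMass (hausdorff m) Q' + C' * formalMass (hausdorff (m + 1)) R' :=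
            (formalMass_add_le _ _).trans (add_le_add (h8.trans (formalMass_inter_le _ _)) h6)
        _ ≤ (formalMass (hausdorff m) Q + C * formalMass (hausdorff (m + 1)) R) +
              C' * formalMass (hausdorff (m + 1)) R :=
            add_le_add h2 (mul_le_mul_right h3 _)
        _ = _ := by rw [add_mul, add_assoc]

end Restriction

/-! ### Dilations -/

section Dilation

variable {X : Type*} [AddCommGroup X] [Module ℝ X] {m : ℕ}

/-- The dilation `x ↦ r x + a`. -/
def dilation (r : ℝ) (a : X) : X →ᵃ[ℝ] X :=
  r • AffineMap.id ℝ X + AffineMap.const ℝ X a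

theorem dilation_apply (r : ℝ) (a x : X) : dilation r a x = r • x + a := rfl

theorem dilation_injective {r : ℝ} (hr : 0 < r) (a : X) : Function.Injective (dilation r a) := by
  intro x y h
  simp only [dilation_apply] at h
  exact smul_right_injective X hr.ne' (add_right_cancel h)

/-- The image of a simplex by the dilation `x ↦ r x + a`. -/
def dilate {r : ℝ} (hr : 0 < r) (a : X) (σ : Affine.Simplex ℝ X m) : Affine.Simplex ℝ X m :=
  σ.map (dilation r a) (dilation_injective hr a)

variable {r : ℝ} (hr : 0 < r) (a : X) (σ : Affine.Simplex ℝ X m)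

theorem dilate_points (i : Fin (m + 1)) : (dilate hr a σ).points i = r • σ.points i + a := rfl

theorem body_dilate : body (dilate hr a σ) = dilation r a '' body σ := body_map σ _ _

theorem relInterior_dilate : relInterior (dilate hr a σ) = dilation r a '' relInterior σ :=
  relInterior_map σ _ _

theorem frameDet_dilate (L : Fin m → X →ₗ[ℝ] ℝ) :
    frameDet L (dilate hr a σ).points = frameDet L σ.points * r ^ m := by
  rw [frameDet_eq_mul_of_edges L (p := σ.points) (r • (1 : Matrix (Fin m) (Fin m) ℝ)) fun j => ?_]
  · rw [Matrix.det_smul, Matrix.det_one, Fintype.card_fin, mul_one]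
  · simp [dilate_points, Matrix.one_apply, smul_sub, ite_smul]

theorem sign_frameDet_dilate (L : Fin m → X →ₗ[ℝ] ℝ) :
    SignType.sign (frameDet L (dilate hr a σ).points) = SignType.sign (frameDet L σ.points) := by
  rw [frameDet_dilate, sign_mul, sign_pos (pow_pos hr m), mul_one]

/-- The points of the plane of `σ` whose `i`-th barycentric coordinate is larger than `t i` are
the relative interior of a simplex obtained by a dilation of `σ`. -/
theorem mem_relInterior_dilate_iff {t : Fin (m + 1) → ℝ} (ht : 0 < 1 - ∑ i, t i) {x : X} :
    x ∈ relInterior (dilate ht (∑ i, t i • σ.points i) σ) ↔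
      x ∈ plane σ ∧ ∀ i, t i < coord σ i x := by
  rw [relInterior_dilate]
  constructor
  · rintro ⟨y, hy, rfl⟩
    obtain ⟨w, hw, hw1, rfl⟩ := hy
    have e : dilation (1 - ∑ i, t i) (∑ i, t i • σ.points i) (∑ i, w i • σ.points i) =
        ∑ i, ((1 - ∑ i, t i) * w i + t i) • σ.points i := by
      simp_rw [dilation_apply, Finset.smul_sum, add_smul, Finset.sum_add_distrib, mul_smul]
    have h1 : ∑ i, ((1 - ∑ i, t i) * w i + t i) = 1 := by
      rw [Finset.sum_add_distrib, ← Finset.mul_sum, hw1]; ring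
    rw [e]
    refine ⟨sum_mem_plane σ _ h1, fun i => ?_⟩
    rw [coord_sum σ _ h1]
    have := mul_pos ht (hw i)
    linarith
  · rintro ⟨hx, hc⟩
    refine ⟨∑ i, ((1 - ∑ i, t i)⁻¹ * (coord σ i x - t i)) • σ.points i,
      ⟨_, fun i => ?_, ?_, rfl⟩, ?_⟩
    · exact mul_pos (inv_pos.2 ht) (sub_pos.2 (hc i))
    · rw [← Finset.mul_sum, Finset.sum_sub_distrib, sum_coord, inv_mul_cancel₀ ht.ne']
    · rw [dilation_apply, Finset.smul_sum, ← Finset.sum_add_distrib]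
      conv_rhs => rw [eq_sum_coord hx]
      refine Finset.sum_congr rfl fun i _ => ?_
      rw [smul_smul, mul_inv_cancel_left₀ ht.ne', ← add_smul, sub_add_cancel]

end Dilation

/-! ### Lower semicontinuity from the triangle inequality -/

section

variable {X : Type*} [NormedAddCommGroup X] [NormedSpace ℝ X] {m : ℕ}

theorem hausdorff_body_dilate {r : ℝ} (hr : 0 < r) (a : X) (σ : Affine.Simplex ℝ X m) :
    hausdorff m (body (dilate hr a σ)) = ENNReal.ofReal r ^ m * hausdorff m (body σ) := by
  borelize X
  rw [body_dilate]
  exact hausdorff_smul_add_image a hr _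

/-- Only the `σ` part of `p` is seen in `U`, and there `U` cuts out of `σ` a smaller homothetic
simplex. -/
theorem isRestriction_single_dilate {G : Type*} [AddCommGroup G]
    {p : FormalChain X G m} {σ : Affine.Simplex ℝ X m}
    {U : Set X} {t : Fin (m + 1) → ℝ} (ht0 : ∀ i, 0 ≤ t i) (ht : 0 < 1 - ∑ i, t i)
    (hU : ∀ x ∈ plane σ, x ∈ U ↔ ∀ i, t i < coord σ i x)
    (hd : ∀ τ ∈ p.support, σ ≠ τ → Disjoint U (body τ)) :
    IsRestriction U p (Finsupp.single (dilate ht (∑ i, t i • σ.points i) σ) (p σ)) := by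
  classical
  refine ⟨∅, small_empty m, fun L x _ => ?_⟩
  by_cases hx : x ∈ U
  · have h1 : density L x p = density L x (Finsupp.single σ (p σ)) := by
      rw [density_eq_sum]
      refine Finset.sum_eq_single σ (fun τ hτ hne => ?_) fun hσ => ?_
      · exact density_single_of_notMem (fun hx' => Set.disjoint_left.1 (hd τ hτ hne.symm) hx
          (relInterior_subset_body τ hx')) _
      · rw [Finsupp.notMem_support_iff.1 hσ, Finsupp.single_zero, map_zero]
    have h2 : x ∈ relInterior (dilate ht (∑ i, t i • σ.points i) σ) ↔ x ∈ relInterior σ := by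
      rw [mem_relInterior_dilate_iff, mem_relInterior_iff]
      exact and_congr_right fun hxp =>
        ⟨fun h i => (ht0 i).trans_lt (h i), fun _ => (hU x hxp).1 hx⟩
    rw [Set.indicator_of_mem hx, h1, density_single, density_single, sign_frameDet_dilate]
    simp only [h2]
  · rw [Set.indicator_of_notMem hx]
    refine density_single_of_notMem (fun hx' => hx ?_) _
    obtain ⟨hxp, hc⟩ := (mem_relInterior_dilate_iff σ ht).1 hx'
    exact (hU x hxp).2 hc

variable [FiniteDimensional ℝ X]

/-- `g ⟦σ⟧ - c` is a cycle, being a boundary up to relations. -/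
theorem TriangleInequalityForCycles.enorm_mul_le {G : Type*} [NormedAddCommGroup G]
    (h : TriangleInequalityForCycles X G m) (hm : 1 ≤ m) {σ : Affine.Simplex ℝ X m} {g : G}
    {c : FormalChain X G m} {R : FormalChain X G (m + 1)}
    (hn : NullChain (Finsupp.single σ g - (c + formalBoundary R))) :
    ‖g‖ₑ * hausdorff m (body σ) ≤ formalMass (hausdorff m) c := by
  classical
  obtain ⟨k, rfl⟩ : ∃ k, m = k + 1 := ⟨m - 1, by omega⟩
  let e := c.support.equivFin.symm
  have hsum (F : Affine.Simplex ℝ X (k + 1) → ℝ≥0∞) :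
      ∑ i, F (e i).1 = ∑ τ ∈ c.support, F τ := by
    rw [e.sum_comp fun τ => F τ.1, Finset.sum_coe_sort c.support F]
  have hsum' (F : Affine.Simplex ℝ X (k + 1) → FormalChain X G (k + 1)) :
      ∑ i, F (e i).1 = ∑ τ ∈ c.support, F τ := by
    rw [e.sum_comp fun τ => F τ.1, Finset.sum_coe_sort c.support F]
  have hc := h c.support.card (Fin.cons σ fun i => (e i).1) (Fin.cons g fun i => -c (e i).1) ?_
  · simp only [Fin.cons_zero, Fin.cons_succ, hausdorffMass_single, enorm_neg] at hc
    rwa [hsum fun τ => ‖c τ‖ₑ * hausdorff (k + 1) (body τ)] at hc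
  · have e1 : ∑ i : Fin (c.support.card + 1),
        Finsupp.single ((Fin.cons σ fun i => (e i).1 : Fin _ → Affine.Simplex ℝ X (k + 1)) i)
          ((Fin.cons g fun i => -c (e i).1 : Fin _ → G) i) = Finsupp.single σ g - c := by
      rw [Fin.sum_univ_succ]
      simp only [Fin.cons_zero, Fin.cons_succ]
      rw [hsum' fun τ => Finsupp.single τ (-c τ), sub_eq_add_neg]
      congr 1
      simp_rw [Finsupp.single_neg, Finset.sum_neg_distrib]
      congr 1
      exact Finsupp.sum_single c
    rw [e1]
    have h1 := formalBoundary_mem_relations (mem_relations_of_nullChain hn)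
    rw [← sub_sub, formalBoundary_sub, formalBoundary_formalBoundary, sub_zero] at h1
    exact (QuotientAddGroup.eq_zero_iff _).2 h1

/-- A neighbourhood of the part of the relative interior of `σ` where the barycentric coordinates
are larger than `s`. -/
def tube (σ : Affine.Simplex ℝ X m) (s u : ℝ) : Set X :=
  {x | (∀ i, s < coord σ i x) ∧ ∀ j, |normalCoord σ j x| < u}

theorem measurableSet_tube [MeasurableSpace X] [BorelSpace X] (σ : Affine.Simplex ℝ X m) (s u : ℝ) :
    MeasurableSet (tube σ s u) := by
  have e : tube σ s u = (⋂ i, {x | s < coord σ i x}) ∩ ⋂ j, {x | |normalCoord σ j x| < u} := by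
    ext x; simp [tube]
  rw [e]
  refine (MeasurableSet.iInter fun i => ?_).inter (MeasurableSet.iInter fun j => ?_)
  · exact (isOpen_lt continuous_const (AffineMap.continuous_of_finiteDimensional _)).measurableSet
  · exact (isOpen_lt (AffineMap.continuous_of_finiteDimensional _).abs
      continuous_const).measurableSet

/-- The core of `σ`, where the coordinates are at least `s`, is compact and misses the closed set
`body τ`, so the two have disjoint thickenings. Projecting to the plane moves a point of a tube by
at most `u * B`, so thin tubes lie in these thickenings. -/
theorem eventually_disjoint_tube {σ τ : Affine.Simplex ℝ X m} {s : ℝ} (hs : 0 < s)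
    (hd : Disjoint (relInterior σ) (body τ)) :
    ∀ᶠ u in 𝓝[>] (0 : ℝ), Disjoint (tube σ s u) (body τ) ∧ Disjoint (tube σ s u) (tube τ s u) := by
  have hcont : ∀ (σ : Affine.Simplex ℝ X m) i, Continuous (coord σ i) := fun σ i =>
    AffineMap.continuous_of_finiteDimensional _
  let K : Set X := body σ ∩ ⋂ i, {x | s ≤ coord σ i x}
  have hK : IsCompact K := (isCompact_body σ).inter_right
    (isClosed_iInter fun i => isClosed_le continuous_const (hcont σ i))
  have hKσ : K ⊆ relInterior σ := fun x hx => mem_relInterior_iff.2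
    ⟨body_subset_plane σ hx.1, fun i => hs.trans_le (Set.mem_iInter.1 hx.2 i)⟩
  obtain ⟨δ, hδ, hdis⟩ := (hd.mono_left hKσ).exists_thickenings hK (isClosed_body τ)
  let B := ∑ j, ‖Module.finBasis ℝ X j‖
  have hB : 0 ≤ B := Finset.sum_nonneg fun j _ => norm_nonneg _
  have hproj : ∀ (ρ : Affine.Simplex ℝ X m) (u : ℝ), 0 < u → u * B < δ → ∀ x ∈ tube ρ s u,
      planeProj ρ x ∈ body ρ ∩ (⋂ i, {x | s ≤ coord ρ i x}) ∧ dist x (planeProj ρ x) < δ := by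
    intro ρ u hu huB x hx
    refine ⟨⟨mem_body_iff_exists.2 ⟨fun i => coord ρ i x, fun i => (hs.trans (hx.1 i)).le,
      sum_coord ρ x, rfl⟩, Set.mem_iInter.2 fun i => ?_⟩, ?_⟩
    · have : coord ρ i (planeProj ρ x) = coord ρ i x := coord_sum ρ _ (sum_coord ρ x) i
      exact (hx.1 i).le.trans this.ge
    · rw [dist_eq_norm, ← (Module.finBasis ℝ X).sum_repr (x - planeProj ρ x)]
      refine (norm_sum_le _ _).trans_lt (lt_of_le_of_lt ?_ huB)
      rw [Finset.mul_sum]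
      refine Finset.sum_le_sum fun j _ => ?_
      rw [norm_smul]
      refine mul_le_mul_of_nonneg_right ?_ (norm_nonneg _)
      have := (hx.2 j).le
      rw [normalCoord_apply] at this
      exact this
  have ht : Tendsto (fun u : ℝ => u * B) (𝓝[>] 0) (𝓝 0) := by
    have : Tendsto (fun u : ℝ => u * B) (𝓝 0) (𝓝 (0 * B)) := tendsto_id.mul_const B
    rw [zero_mul] at this
    exact this.mono_left nhdsWithin_le_nhds
  filter_upwards [ht.eventually (gt_mem_nhds hδ), self_mem_nhdsWithin] with u hu hu0
  have h1 : tube σ s u ⊆ Metric.thickening δ K := fun x hx =>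
    Metric.mem_thickening_iff.2 ⟨_, (hproj σ u hu0 hu x hx).1, (hproj σ u hu0 hu x hx).2⟩
  have h2 : tube τ s u ⊆ Metric.thickening δ (body τ) := fun x hx =>
    Metric.mem_thickening_iff.2 ⟨_, (hproj τ u hu0 hu x hx).1.1, (hproj τ u hu0 hu x hx).2⟩
  exact ⟨hdis.mono h1 (Metric.self_subset_thickening hδ _), hdis.mono h1 h2⟩

variable {G : Type*} [NormedAddCommGroup G]

theorem StronglyDisjoint.exists_tubes {p : FormalChain X G m} (hp : StronglyDisjoint p) {s : ℝ}
    (hs : 0 < s) : ∃ u > 0, ∀ σ ∈ p.support, ∀ τ ∈ p.support, σ ≠ τ →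
      Disjoint (tube σ s u) (body τ) ∧ Disjoint (tube σ s u) (tube τ s u) := by
  have h : ∀ᶠ u in 𝓝[>] (0 : ℝ), ∀ σ ∈ p.support, ∀ τ ∈ p.support, σ ≠ τ →
      Disjoint (tube σ s u) (body τ) ∧ Disjoint (tube σ s u) (tube τ s u) := by
    rw [Finset.eventually_all]
    intro σ hσ
    rw [Finset.eventually_all]
    intro τ hτ
    rw [eventually_imp_distrib_left]
    exact fun hne => eventually_disjoint_tube hs (hp σ hσ τ hτ hne)
  obtain ⟨u, hu, hu0⟩ := (h.and self_mem_nhdsWithin).exists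
  exact ⟨u, hu0, hu⟩

/-- The affine functions that describe the tubes around `σ`. -/
def tubeFun (σ : Affine.Simplex ℝ X m) :
    Fin (m + 1) ⊕ (Fin (Module.finrank ℝ X) ⊕ Fin (Module.finrank ℝ X)) → X →ᵃ[ℝ] ℝ :=
  Sum.elim (coord σ) (Sum.elim (normalCoord σ) fun j => -normalCoord σ j)

/-- The decomposition of `p - T` is restricted to a polyhedron inside the tube. There `p` becomes a
copy of `σ` of ratio at least `1 - (m + 1) * (2 * s)`, to which the triangle inequality applies. -/
theorem TriangleInequalityForCycles.exists_local_bound (h : TriangleInequalityForCycles X G m)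
    (hm : 1 ≤ m) {p : FormalChain X G m} {σ : Affine.Simplex ℝ X m} {s u : ℝ} (hs : 0 < s)
    (hs' : (m + 1) * (2 * s) < 1) (hu : 0 < u)
    (hd : ∀ τ ∈ p.support, σ ≠ τ → Disjoint (tube σ s u) (body τ)) :
    ∃ C : ℝ≥0∞, C ≠ ∞ ∧ ∀ (T Q : FormalChain X G m) (R : FormalChain X G (m + 1)),
      NullChain (p - T - (Q + formalBoundary R)) →
      ENNReal.ofReal (1 - (m + 1) * (2 * s)) ^ m * (‖p σ‖ₑ * hausdorff m (body σ)) ≤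
        formalMass (fun A => hausdorff m (A ∩ tube σ s u)) T + (formalMass (hausdorff m) Q +
          C * formalMass (hausdorff (m + 1)) R) := by
  classical
  borelize X
  obtain ⟨C, hC, key⟩ := exists_restriction_to_polyhedron (G := G) (tubeFun σ) hm
    -- Levels in `(s, 2s)` shrink `σ` only slightly. Levels in `(-u, -u / 2)` for both signs of the
    -- normal coordinates keep the polyhedron in the tube; being negative, they are exceeded on the
    -- plane of `σ`, where these coordinates vanish.
    (a := Sum.elim (fun _ => s) fun _ => -u) (b := Sum.elim (fun _ => 2 * s) fun _ => -u / 2)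
    (by rintro (i | i) <;> simp only [Sum.elim_inl, Sum.elim_inr] <;> linarith) Finset.univ
  refine ⟨C, hC, fun T Q R hn => ?_⟩
  obtain ⟨t, ht, Q', R', h1, h2, -⟩ := key _ Q R hn
  obtain ⟨T', h3, h4⟩ := exists_isRestriction
    (Finset.univ.image fun i => tubeFun σ i - AffineMap.const ℝ X (t i)) T
  set U := {x | ∀ i ∈ Finset.univ, t i < tubeFun σ i x} with hUdef
  have e : posSet (Finset.univ.image fun i => tubeFun σ i - AffineMap.const ℝ X (t i)) = U := by
    ext x
    simp only [posSet, Finset.forall_mem_image, hUdef, Set.mem_ofPred_eq, AffineMap.coe_sub,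
      Pi.sub_apply, AffineMap.const_apply, sub_pos]
  rw [e] at h3 h4
  have htl : ∀ i, s < t (Sum.inl i) ∧ t (Sum.inl i) < 2 * s := fun i => ht (Sum.inl i)
  have htr : ∀ i, -u < t (Sum.inr i) ∧ t (Sum.inr i) < -u / 2 := fun i => ht (Sum.inr i)
  have hUtube : U ⊆ tube σ s u := by
    intro x hx
    refine ⟨fun i => (htl i).1.trans (hx _ (Finset.mem_univ (Sum.inl i))), fun j => ?_⟩
    have h5 : t (Sum.inr (Sum.inl j)) < normalCoord σ j x := hx _ (Finset.mem_univ _)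
    have h6 : t (Sum.inr (Sum.inr j)) < -normalCoord σ j x := hx _ (Finset.mem_univ _)
    rw [abs_lt]
    constructor <;> linarith [(htr (Sum.inl j)).1, (htr (Sum.inr j)).1]
  have hUplane : ∀ x ∈ plane σ, x ∈ U ↔ ∀ i, t (Sum.inl i) < coord σ i x := by
    intro x hx
    refine ⟨fun h i => h _ (Finset.mem_univ (Sum.inl i)), fun h i _ => ?_⟩
    have h0 := mem_plane_iff_normalCoord.1 hx
    rcases i with i | j | j
    · exact h i
    · have : tubeFun σ (Sum.inr (Sum.inl j)) x = 0 := h0 j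
      linarith [(htr (Sum.inl j)).2]
    · have : tubeFun σ (Sum.inr (Sum.inr j)) x = 0 := by
        change -normalCoord σ j x = 0
        rw [h0 j, neg_zero]
      linarith [(htr (Sum.inr j)).2]
  have hsum : ∑ i, t (Sum.inl i) ≤ (m + 1) * (2 * s) := by
    refine (Finset.sum_le_card_nsmul _ _ (2 * s) fun i _ => (htl i).2.le).trans_eq ?_
    simp
  have hpos : 0 < 1 - ∑ i, t (Sum.inl i) := by linarith
  have h5 := isRestriction_single_dilate (fun i => (hs.trans (htl i).1).le) hpos hUplane
    fun τ hτ hne => (hd τ hτ hne).mono_left hUtube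
  -- Adding the restrictions of `p - T` and of `T` recovers that of `p`.
  have h6 := h1.add h3
  rw [sub_add_cancel] at h6
  have h7 := h5.nullChain_sub h6
  rw [show Q' + formalBoundary R' + T' = T' + Q' + formalBoundary R' by abel] at h7
  have h8 := h.enorm_mul_le hm h7
  rw [hausdorff_body_dilate] at h8
  calc ENNReal.ofReal (1 - (m + 1) * (2 * s)) ^ m * (‖p σ‖ₑ * hausdorff m (body σ))
      ≤ ENNReal.ofReal (1 - ∑ i, t (Sum.inl i)) ^ m * (‖p σ‖ₑ * hausdorff m (body σ)) := by
        gcongr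
    _ ≤ formalMass (hausdorff m) (T' + Q') := by rwa [mul_left_comm]
    _ ≤ _ := (formalMass_add_le _ _).trans (add_le_add (h4.trans ?_) h2)
  refine Finset.sum_le_sum fun τ _ => mul_le_mul_right ?_ _
  dsimp only
  rw [hausdorff_eq, hausdorff_eq]
  exact measure_mono (Set.inter_subset_inter_right _ hUtube)

/-- Sum the local bounds: the tubes are disjoint, so the parts of `T` in them have total mass at
most that of `T`. -/
theorem TriangleInequalityForCycles.exists_global_bound (h : TriangleInequalityForCycles X G m)
    (hm : 1 ≤ m) {p : FormalChain X G m} (hp : StronglyDisjoint p) {s : ℝ} (hs : 0 < s)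
    (hs' : (m + 1) * (2 * s) < 1) :
    ∃ C : ℝ≥0∞, C ≠ ∞ ∧ ∀ (T Q : FormalChain X G m) (R : FormalChain X G (m + 1)),
      NullChain (p - T - (Q + formalBoundary R)) →
      ENNReal.ofReal (1 - (m + 1) * (2 * s)) ^ m * formalMass (hausdorff m) p ≤
        formalMass (hausdorff m) T +
          C * (formalMass (hausdorff m) Q + formalMass (hausdorff (m + 1)) R) := by
  classical
  borelize X
  obtain ⟨u, hu, hd⟩ := hp.exists_tubes hs
  choose! C hC key using fun σ (hσ : σ ∈ p.support) => h.exists_local_bound hm (σ := σ) hs hs' hu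
    fun τ hτ hne => (hd σ hσ τ hτ hne).1
  refine ⟨∑ σ ∈ p.support, (1 + C σ), ENNReal.sum_ne_top.2 fun σ hσ =>
    ENNReal.add_ne_top.2 ⟨ENNReal.one_ne_top, hC σ hσ⟩, fun T Q R hn => ?_⟩
  calc ENNReal.ofReal (1 - (m + 1) * (2 * s)) ^ m * formalMass (hausdorff m) p
      = ∑ σ ∈ p.support, ENNReal.ofReal (1 - (m + 1) * (2 * s)) ^ m *
          (‖p σ‖ₑ * hausdorff m (body σ)) := by rw [formalMass, Finsupp.sum, Finset.mul_sum]
    _ ≤ ∑ σ ∈ p.support, (formalMass (fun A => hausdorff m (A ∩ tube σ s u)) T +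
          (formalMass (hausdorff m) Q + C σ * formalMass (hausdorff (m + 1)) R)) :=
        Finset.sum_le_sum fun σ hσ => key σ hσ T Q R hn
    _ ≤ _ := by
        rw [Finset.sum_add_distrib, Finset.sum_mul]
        refine add_le_add ?_ (Finset.sum_le_sum fun σ _ => ?_)
        · simp_rw [formalMass, Finsupp.sum]
          rw [Finset.sum_comm]
          refine Finset.sum_le_sum fun τ _ => ?_
          rw [← Finset.mul_sum]
          refine mul_le_mul_right ?_ _
          simp_rw [hausdorff_eq]
          rw [← measure_biUnion_finset]
          · exact measure_mono (Set.iUnion₂_subset fun σ _ => Set.inter_subset_left)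
          · exact fun σ hσ σ' hσ' hne => (hd σ hσ σ' hσ' hne).2.mono Set.inter_subset_right
              Set.inter_subset_right
          · exact fun σ _ => (isClosed_body τ).measurableSet.inter (measurableSet_tube σ s u)
        · rw [add_mul, one_mul, mul_add]
          exact add_le_add le_self_add le_add_self

/-- The representative `r` need not be the one of nearly least mass; it may be replaced by a cheaper
one because boundaries respect relations. -/
theorem exists_formal_of_flatNorm_lt (ip : InnerProductSpace.Core ℝ X)
    {P : PolyhedralChain X G m} {η : ℝ≥0∞} (h : flatNorm ip P < η) :
    ∃ (Q : FormalChain X G m) (R : FormalChain X G (m + 1)), toChain (Q + formalBoundary R) = P ∧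
      formalMass (euclideanHausdorff ip m) Q + formalMass (euclideanHausdorff ip (m + 1)) R < η := by
  simp only [flatNorm, iInf_lt_iff] at h
  obtain ⟨Q, r, rfl, h⟩ := h
  obtain ⟨ε, hε, hlt⟩ := ENNReal.lt_iff_exists_add_pos_lt.1 h
  have hfin := ENNReal.add_ne_top.1 h.ne_top
  have hε2 : (ε / 2 : ℝ≥0∞) ≠ 0 := by simp [hε.ne']
  obtain ⟨c, rfl, hc⟩ := exists_formalMass_lt (ENNReal.lt_add_right hfin.1 hε2)
  obtain ⟨d, hd, hd'⟩ := exists_formalMass_lt (ENNReal.lt_add_right hfin.2 hε2)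
  refine ⟨c, d, ?_, (ENNReal.add_lt_add hc hd').trans_le (le_of_eq_of_le ?_ hlt.le)⟩
  · have := formalBoundary_mem_relations (toChain_eq_iff.1 hd)
    rw [formalBoundary_sub, ← toChain_eq_iff] at this
    rw [← this]
    rfl
  · rw [add_add_add_comm, ENNReal.add_halves]
    rfl

theorem TriangleInequalityForCycles.exists_bound_flatNorm (h : TriangleInequalityForCycles X G m)
    (ip : InnerProductSpace.Core ℝ X) (hm : 1 ≤ m) {p : FormalChain X G m}
    (hp : StronglyDisjoint p) {s : ℝ} (hs : 0 < s) (hs' : (m + 1) * (2 * s) < 1) :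
    ∃ C : ℝ≥0∞, C ≠ ∞ ∧ ∀ P' : PolyhedralChain X G m,
      ENNReal.ofReal (1 - (m + 1) * (2 * s)) ^ m * formalMass (hausdorff m) p ≤
        hausdorffMass P' + C * flatNorm ip (toChain p - P') := by
  obtain ⟨C, hC, key⟩ := h.exists_global_bound hm hp hs hs'
  obtain ⟨C₁, -, h₁, -, H₁⟩ := exists_euclideanHausdorff_comparison ip m
  obtain ⟨C₂, -, h₂, -, H₂⟩ := exists_euclideanHausdorff_comparison ip (m + 1)
  have hK : C * (C₁ + C₂) ≠ ∞ := ENNReal.mul_ne_top hC (ENNReal.add_ne_top.2 ⟨h₁, h₂⟩)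
  -- The added `1` allows the error `ε / 2` to be divided by the constant.
  refine ⟨C * (C₁ + C₂) + 1, ENNReal.add_ne_top.2 ⟨hK, ENNReal.one_ne_top⟩, fun P' => ?_⟩
  refine le_of_forall_gt fun a ha => ?_
  have hfin := ENNReal.add_ne_top.1 ha.ne_top
  have hfl : flatNorm ip (toChain p - P') ≠ ∞ := fun htop => hfin.2 (by
    rw [htop]; exact ENNReal.mul_top (by simp))
  obtain ⟨ε, hε, hlt⟩ := ENNReal.lt_iff_exists_add_pos_lt.1 ha
  have hK0 : C * (C₁ + C₂) + 1 ≠ 0 := by simp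
  have hK1 : C * (C₁ + C₂) + 1 ≠ ∞ := ENNReal.add_ne_top.2 ⟨hK, ENNReal.one_ne_top⟩
  have hε2 : (ε / 2 : ℝ≥0∞) ≠ 0 := by simp [hε.ne']
  obtain ⟨T, rfl, hT⟩ := exists_formalMass_lt (ENNReal.lt_add_right hfin.1 hε2)
  obtain ⟨Q, R, hQR, hlt'⟩ := exists_formal_of_flatNorm_lt ip (ENNReal.lt_add_right hfl
    (ENNReal.div_ne_zero.2 ⟨hε2, hK1⟩))
  have hn : NullChain (p - T - (Q + formalBoundary R)) :=
    nullChain_of_mem_relations (toChain_eq_iff.1 hQR.symm)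
  refine ((key T Q R hn).trans (add_le_add hT.le ?_)).trans_lt (lt_of_le_of_lt (b :=
    hausdorffMass (toChain T) + ε / 2 +
      (C * (C₁ + C₂) + 1) * (flatNorm ip (toChain p - toChain T) +
        ε / 2 / (C * (C₁ + C₂) + 1))) le_rfl ?_)
  · calc C * (formalMass (hausdorff m) Q + formalMass (hausdorff (m + 1)) R)
        ≤ C * (C₁ * formalMass (euclideanHausdorff ip m) Q +
            C₂ * formalMass (euclideanHausdorff ip (m + 1)) R) :=
          mul_le_mul_right (add_le_add (formalMass_le_mul H₁ _) (formalMass_le_mul H₂ _)) _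
      _ ≤ C * ((C₁ + C₂) * (formalMass (euclideanHausdorff ip m) Q +
            formalMass (euclideanHausdorff ip (m + 1)) R)) := by
          refine mul_le_mul_right ?_ _
          rw [mul_add]
          exact add_le_add (mul_le_mul_left le_self_add _) (mul_le_mul_left le_add_self _)
      _ ≤ _ := by
          rw [← mul_assoc]
          exact mul_le_mul' le_self_add hlt'.le
  · rw [mul_add, ENNReal.mul_div_cancel hK0 hK1, add_add_add_comm, ENNReal.add_halves]
    exact hlt

/-- For fixed `s` the flat term disappears as `j → ∞`, whatever the size of `C`; only then does `s`
tend to zero. -/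
theorem TriangleInequalityForCycles.lowerSemicontinuous (h : TriangleInequalityForCycles X G m)
    (ip : InnerProductSpace.Core ℝ X) (hm : 1 ≤ m) :
    HausdorffMassLowerSemicontinuous X G ip m := by
  intro P Pseq hlim
  obtain ⟨c, rfl⟩ := QuotientAddGroup.mk_surjective P
  obtain ⟨p, hp, hcp⟩ := exists_stronglyDisjoint c
  have hcp' : toChain c = toChain p := toChain_eq_iff.2 hcp
  change Tendsto (fun j => flatNorm ip (toChain c - Pseq j)) atTop (𝓝 0) at hlim
  change hausdorffMass (toChain c) ≤ _
  rw [hcp'] at hlim ⊢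
  refine (hausdorffMass_le_formalMass p).trans ?_
  have hcont : Tendsto (fun s : ℝ => ENNReal.ofReal (1 - (m + 1) * (2 * s)) ^ m *
      formalMass (hausdorff m) p) (𝓝[>] 0) (𝓝 (formalMass (hausdorff m) p)) := by
    have h1 : Continuous fun s : ℝ => 1 - ((m : ℝ) + 1) * (2 * s) := by fun_prop
    have h2 : Tendsto (fun s : ℝ => ENNReal.ofReal (1 - (m + 1) * (2 * s)) ^ m) (𝓝[>] 0)
        (𝓝 1) := by
      have := ((ENNReal.continuous_pow m).comp (ENNReal.continuous_ofReal.comp h1)).tendsto 0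
      simp only [Function.comp_def, mul_zero, sub_zero, ENNReal.ofReal_one, one_pow] at this
      exact this.mono_left nhdsWithin_le_nhds
    have := ENNReal.Tendsto.mul_const h2 (b := formalMass (hausdorff m) p) (Or.inl one_ne_zero)
    rwa [one_mul] at this
  refine le_of_tendsto hcont ?_
  have hsmall : ∀ᶠ s : ℝ in 𝓝[>] 0, ((m : ℝ) + 1) * (2 * s) < 1 := by
    have h1 : Continuous fun s : ℝ => ((m : ℝ) + 1) * (2 * s) := by fun_prop
    have := h1.tendsto 0
    simp only [mul_zero] at this
    exact (this.mono_left nhdsWithin_le_nhds).eventually (gt_mem_nhds one_pos)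
  filter_upwards [hsmall, self_mem_nhdsWithin] with s hs' hs
  obtain ⟨C, hC, key⟩ := h.exists_bound_flatNorm ip hm hp hs hs'
  have hC0 : Tendsto (fun j => C * flatNorm ip (toChain p - Pseq j)) atTop (𝓝 0) := by
    have := ENNReal.Tendsto.const_mul hlim (a := C) (Or.inr hC)
    rwa [mul_zero] at this
  refine ENNReal.le_of_forall_pos_le_add fun ε hε _ => ?_
  rw [← tsub_le_iff_right]
  refine le_liminf_of_le (by isBoundedDefault) ?_
  filter_upwards [hC0.eventually (gt_mem_nhds (ENNReal.coe_pos.2 hε))] with j hj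
  rw [tsub_le_iff_right]
  exact (key (Pseq j)).trans (add_le_add_right hj.le _)

end

/-! ### Cones -/

section Cone

variable {X : Type*} [AddCommGroup X] [Module ℝ X] {m : ℕ}

theorem affineIndependent_cons {σ : Affine.Simplex ℝ X m} {b : X} (hb : b ∉ plane σ) :
    AffineIndependent ℝ (Fin.cons b σ.points : Fin (m + 2) → X) := by
  rw [affineIndependent_iff_of_fintype]
  intro w hw hs
  rw [Finset.weightedVSub_eq_linear_combination _ hw, Fin.sum_univ_succ] at hs
  simp only [Fin.cons_zero, Fin.cons_succ] at hs
  rw [Fin.sum_univ_succ] at hw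
  have h0 : w 0 = 0 := by
    by_contra h0
    refine hb ?_
    have h1 : b = ∑ j : Fin (m + 1), (-(w 0)⁻¹ * w j.succ) • σ.points j := by
      simp_rw [mul_smul]
      rw [← Finset.smul_sum, ← neg_eq_of_add_eq_zero_right hs, smul_neg, neg_smul, neg_neg,
        inv_smul_smul₀ h0]
    rw [h1]
    refine sum_mem_plane σ _ ?_
    rw [← Finset.mul_sum, ← neg_eq_of_add_eq_zero_right hw]
    field_simp
  rw [h0, zero_smul, zero_add] at hs
  rw [h0, zero_add] at hw
  have h2 := σ.independent.eq_zero_of_sum_eq_zero hw hs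
  exact Fin.cases h0 fun j => h2 j (Finset.mem_univ j)

/-- The cone over `σ` with apex `b`. -/
def coneSimplex (b : X) (σ : Affine.Simplex ℝ X m) (hb : b ∉ plane σ) :
    Affine.Simplex ℝ X (m + 1) where
  points := Fin.cons b σ.points
  independent := affineIndependent_cons hb

open Classical in
/-- The cone with apex `b` over a formal sum (degenerate cones are omitted). -/
def cone (G : Type*) [AddCommGroup G] (b : X) : FormalChain X G m →+ FormalChain X G (m + 1) :=
  Finsupp.liftAddHom fun σ =>
    if hb : b ∉ plane σ then Finsupp.singleAddHom (coneSimplex b σ hb) else 0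

section

variable {G : Type*} [AddCommGroup G]

theorem cone_single {b : X} {σ : Affine.Simplex ℝ X m} (hb : b ∉ plane σ) (g : G) :
    cone G b (Finsupp.single σ g) = Finsupp.single (coneSimplex b σ hb) g := by
  simp [cone, hb]

theorem formalBoundary_cone_single {b : X} {σ : Affine.Simplex ℝ X (m + 1)} (hb : b ∉ plane σ)
    (g : G) : formalBoundary (cone G b (Finsupp.single σ g)) =
      Finsupp.single σ g - cone G b (formalBoundary (Finsupp.single σ g)) := by
  have hb' : ∀ i, b ∉ plane (facet σ i) := fun i h => hb (plane_facet_le σ i h)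
  have h0 : facet (coneSimplex b σ hb) 0 = σ := by
    ext j
    simp [facet_points, coneSimplex]
  have h1 : ∀ i : Fin (m + 2), facet (coneSimplex b σ hb) i.succ =
      coneSimplex b (facet σ i) (hb' i) := fun i => by
    ext j
    refine Fin.cases ?_ (fun j => ?_) j <;> simp [facet_points, coneSimplex]
  rw [cone_single hb, formalBoundary_single, formalBoundary_single, Fin.sum_univ_succ, h0, map_sum,
    sub_eq_add_neg, ← Finset.sum_neg_distrib]
  congr 1
  · simp
  · refine Finset.sum_congr rfl fun i _ => ?_
    rw [h1, cone_single (hb' i), ← Finsupp.single_neg]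
    congr 1
    simp [pow_succ]

theorem cone_reindex_sub_mem_relations {b : X} {σ : Affine.Simplex ℝ X m} (hb : b ∉ plane σ)
    (e : Equiv.Perm (Fin (m + 1))) (g : G) : cone G b (Finsupp.single (σ.reindex e) g -
      Finsupp.single σ (((Equiv.Perm.sign e : ℤˣ) : ℤ) • g)) ∈ relations X G (m + 1) := by
  have hb' : b ∉ plane (σ.reindex e) := by rwa [plane_reindex]
  -- Fixes the apex, permutes the other vertices by `e`, and has the same sign.
  let e' := Equiv.Perm.decomposeFin.symm (0, e)
  have h1 : coneSimplex b (σ.reindex e) hb' = (coneSimplex b σ hb).reindex e' := by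
    ext k
    obtain ⟨k, rfl⟩ := e'.surjective k
    change (Fin.cons b (σ.points ∘ e.symm) : Fin (m + 2) → X) (e' k) =
      (Fin.cons b σ.points : Fin (m + 2) → X) (e'.symm (e' k))
    rw [Equiv.symm_apply_apply]
    refine Fin.cases ?_ (fun k => ?_) k <;> simp [e']
  have h2 : Equiv.Perm.sign e' = Equiv.Perm.sign e := by
    rw [Equiv.Perm.decomposeFin.symm_sign, if_pos rfl, one_mul]
  refine AddSubgroup.subset_closure (Or.inl ⟨coneSimplex b σ hb, e', g, ?_⟩)
  rw [map_sub, cone_single hb, cone_single hb', h1, h2]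

end

theorem body_coneSimplex {b : X} {σ : Affine.Simplex ℝ X m} (hb : b ∉ plane σ) :
    body (coneSimplex b σ hb) = convexJoin ℝ {b} (body σ) := by
  rw [body, body, ← convexHull_insert (Set.range_nonempty _)]
  congr 1
  exact Fin.range_cons b σ.points

theorem exists_of_mem_relInterior_coneSimplex {b : X} {σ : Affine.Simplex ℝ X m} (hb : b ∉ plane σ)
    {x : X} (hx : x ∈ relInterior (coneSimplex b σ hb)) :
    ∃ s : ℝ, s < 1 ∧ ∃ y ∈ relInterior σ, x = s • b + (1 - s) • y := by
  obtain ⟨w, h0, h1, rfl⟩ := hx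
  rw [Fin.sum_univ_succ] at h1
  have hpos : 0 < ∑ j : Fin (m + 1), w j.succ :=
    Finset.sum_pos (fun j _ => h0 _) Finset.univ_nonempty
  have e : ∑ j : Fin (m + 1), w j.succ = 1 - w 0 := by linarith
  refine ⟨w 0, by linarith, ∑ j : Fin (m + 1), ((1 - w 0)⁻¹ * w j.succ) • σ.points j,
    ⟨_, fun j => mul_pos (inv_pos.2 (e ▸ hpos)) (h0 _), ?_, rfl⟩, ?_⟩
  · rw [← Finset.mul_sum, e, inv_mul_cancel₀ (e ▸ hpos.ne')]
  · rw [Fin.sum_univ_succ, Finset.smul_sum]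
    congr 1
    refine Finset.sum_congr rfl fun j _ => ?_
    rw [smul_smul, mul_inv_cancel_left₀ (e ▸ hpos.ne')]
    rfl

/-- Subtracting `c` times the row of ones from the row of `ν` leaves one entry, that of the apex. -/
theorem frameDet_cons (L : Fin m → X →ₗ[ℝ] ℝ) (ν : X →ₗ[ℝ] ℝ) {p : Fin (m + 1) → X} {c : ℝ}
    (hν : ∀ j, ν (p j) = c) (b : X) :
    frameDet (Fin.cons ν L : Fin (m + 1) → X →ₗ[ℝ] ℝ) (Fin.cons b p : Fin (m + 2) → X) =
      -((ν b - c) * frameDet L p) := by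
  set M := frameMatrix (Fin.cons ν L : Fin (m + 1) → X →ₗ[ℝ] ℝ) (Fin.cons b p : Fin (m + 2) → X)
    with hM
  have h01 : (1 : Fin (m + 2)) ≠ 0 := by simp
  have hrow : M 1 + (-c) • M 0 = Pi.single 0 (ν b - c) := by
    funext j
    have h1 : M 1 j = ν ((Fin.cons b p : Fin (m + 2) → X) j) := rfl
    have h0 : M 0 j = 1 := rfl
    rw [Pi.add_apply, Pi.smul_apply, h1, h0, smul_eq_mul, mul_one, ← sub_eq_add_neg]
    refine Fin.cases ?_ (fun j => ?_) j
    · rw [Fin.cons_zero, Pi.single_eq_same]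
    · rw [Fin.cons_succ, hν, sub_self, Pi.single_eq_of_ne (Fin.succ_ne_zero j)]
  rw [frameDet, ← hM, ← Matrix.det_updateRow_add_smul_self M h01 (-c), hrow,
    Matrix.det_succ_row _ 1, Finset.sum_eq_single 0]
  · have h3 : (M.updateRow 1 (Pi.single 0 (ν b - c))).submatrix (Fin.succAbove 1)
        (Fin.succAbove 0) = frameMatrix L p := by
      ext i j
      simp only [Matrix.submatrix_apply, Matrix.updateRow_ne (Fin.succAbove_ne 1 i)]
      refine Fin.cases ?_ (fun i => ?_) i
      · simp [hM, frameMatrix]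
      · have : (Fin.succAbove 1 i.succ : Fin (m + 2)) = i.succ.succ := by
          simp [Fin.succAbove, Fin.lt_def]
        simp [hM, frameMatrix, this]
    rw [h3, Matrix.updateRow_self, Pi.single_eq_same, frameDet]
    simp
    ring
  · intro j _ hj
    simp [Pi.single_eq_of_ne hj]
  · simp

/-- The coordinate `f` of the apex is `1` at `b` and `0` on the base. It determines the height of a
point in the cone and then its projection to the base, so disjointness and orientation reduce to the
base. -/
theorem isSimplicialPartition_cone [FiniteDimensional ℝ X] {b : X} {σ : Affine.Simplex ℝ X m}
    (hb : b ∉ plane σ) {κ : ℕ} {τ : Fin κ → Affine.Simplex ℝ X m} (h : IsSimplicialPartition σ τ)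
    (hb' : ∀ k, b ∉ plane (τ k)) :
    IsSimplicialPartition (coneSimplex b σ hb) fun k => coneSimplex b (τ k) (hb' k) := by
  have hsub : ∀ k, body (τ k) ⊆ body σ := fun k => h.iUnion_eq ▸ Set.subset_iUnion (body ∘ τ) k
  let f := coord (coneSimplex b σ hb) 0
  have hfb : f b = 1 := by
    have := coord_points (coneSimplex b σ hb) 0 0
    rwa [if_pos rfl] at this
  have hfσ : ∀ x ∈ plane σ, f x = 0 := fun x hx => by
    refine eq_zero_of_mem_plane (fun j => ?_) hx
    have := coord_points (coneSimplex b σ hb) 0 j.succ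
    rwa [if_neg (Fin.succ_ne_zero j).symm] at this
  have hfτ : ∀ k, ∀ x ∈ plane (τ k), f x = 0 := fun k x hx =>
    hfσ x (plane_eq_of_body_subset (hsub k) ▸ hx)
  refine ⟨?_, fun k l hkl => ?_, fun k => ?_⟩
  · simp_rw [body_coneSimplex]
    rw [← convexJoin_iUnion_right, h.iUnion_eq]
  · rw [Set.disjoint_left]
    intro x hxk hxl
    obtain ⟨s, hs, y, hy, hx⟩ := exists_of_mem_relInterior_coneSimplex (hb' k) hxk
    obtain ⟨s', hs', y', hy', hx'⟩ := exists_of_mem_relInterior_coneSimplex (hb' l) hxl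
    have hf : ∀ (s : ℝ) (y : X), f y = 0 → f (s • b + (1 - s) • y) = s := by
      intro s y hy
      have := affineMap_sum_smul_eq f ![s, 1 - s] ![b, y] (by simp)
      simpa [hfb, hy] using this
    have e1 := hf s y (hfτ k y (mem_relInterior_iff.1 hy).1)
    have e2 := hf s' y' (hfτ l y' (mem_relInterior_iff.1 hy').1)
    rw [← hx] at e1
    rw [← hx', e1] at e2
    subst e2
    have hyy : y = y' := smul_right_injective X (sub_pos.2 hs).ne' (add_left_cancel (hx ▸ hx'))
    exact Set.disjoint_left.1 (h.disjoint k l hkl) hy (hyy ▸ hy')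
  · obtain ⟨L, hL⟩ := exists_frameDet_eq_one σ
    have hd : ∀ ρ : Affine.Simplex ℝ X m, (∀ x ∈ plane ρ, f x = 0) →
        frameDet (Fin.cons f.linear L : Fin (m + 1) → X →ₗ[ℝ] ℝ)
          (Fin.cons b ρ.points : Fin (m + 2) → X) = -frameDet L ρ.points := by
      intro ρ hρ
      have e : ∀ x, f x = f.linear x + f 0 := fun x => congrFun f.decomp x
      rw [frameDet_cons L f.linear (c := -f 0) fun j => ?_, sub_neg_eq_add, ← e, hfb, one_mul]
      have := hρ _ (points_mem_plane ρ j)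
      rw [e] at this
      linarith
    have hs := (h.orientation k).sign_eq (L := L)
    rw [hL, sign_one] at hs
    refine sameOrientation_of_frameDet (L := Fin.cons f.linear L) ?_ ?_
    · refine plane_le_of_points fun j => ?_
      refine Fin.cases ?_ (fun j => ?_) j
      · exact points_mem_plane (coneSimplex b σ hb) 0
      · have hle : plane σ ≤ plane (coneSimplex b σ hb) :=
          plane_le_of_points fun i => points_mem_plane (coneSimplex b σ hb) i.succ
        exact hle (plane_eq_of_body_subset (hsub k) ▸ points_mem_plane (τ k) j)
    · change 0 < frameDet _ (Fin.cons b σ.points) * frameDet _ (Fin.cons b (τ k).points)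
      rw [hd σ hfσ, hd (τ k) (hfτ k), neg_mul_neg, hL, one_mul]
      exact sign_eq_one_iff.1 (by rw [← hs])

end Cone

/-! ### Filling cycles by generic cones -/

section

variable {X : Type*} [NormedAddCommGroup X] [NormedSpace ℝ X] [FiniteDimensional ℝ X] {m : ℕ}

theorem ae_notMem_plane [MeasurableSpace X] [BorelSpace X] (μ : Measure X) [μ.IsAddHaarMeasure]
    (hm : m < Module.finrank ℝ X) (σ : Affine.Simplex ℝ X m) : ∀ᵐ b ∂μ, b ∉ plane σ := by
  refine measure_eq_zero_iff_ae_notMem.1 (Measure.addHaar_affineSubspace μ (plane σ) fun h => ?_)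
  have := finrank_direction_plane σ
  rw [h, AffineSubspace.direction_top, finrank_top] at this
  omega

variable {G : Type*} [AddCommGroup G]

/-- The cone over a generating relation is again a relation if the apex avoids finitely many planes,
which are null sets since `m < dim X`. A relation involves finitely many generators, so almost every
apex works. -/
theorem ae_cone_mem_relations [MeasurableSpace X] [BorelSpace X] (μ : Measure X)
    [μ.IsAddHaarMeasure] (hm : m < Module.finrank ℝ X) {c : FormalChain X G m}
    (hc : c ∈ relations X G m) : ∀ᵐ b ∂μ, cone G b c ∈ relations X G (m + 1) := by
  induction hc using AddSubgroup.closure_induction with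
  | mem c hc =>
    rcases hc with ⟨σ, e, g, rfl⟩ | ⟨σ, κ, τ, g, h, rfl⟩
    · filter_upwards [ae_notMem_plane μ hm σ] with b hb
      exact cone_reindex_sub_mem_relations hb e g
    · filter_upwards [ae_notMem_plane μ hm σ, ae_all_iff.2 fun k => ae_notMem_plane μ hm (τ k)]
        with b hb hb'
      refine AddSubgroup.subset_closure (Or.inr ⟨_, κ, _, g, isSimplicialPartition_cone hb h hb', ?_⟩)
      rw [map_sub, map_sum, cone_single hb]
      congr 1
      exact Finset.sum_congr rfl fun k _ => cone_single (hb' k) g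
  | zero => exact Eventually.of_forall fun b => by rw [map_zero]; exact zero_mem _
  | add c c' _ _ h h' =>
    filter_upwards [h, h'] with b h h'
    rw [map_add]
    exact add_mem h h'
  | neg c _ h =>
    filter_upwards [h] with b h
    rw [map_neg]
    exact neg_mem h

/-- A cycle is a boundary. -/
theorem IsCycle.exists_filling (hm : 1 ≤ m) (hm' : m < Module.finrank ℝ X)
    {c : FormalChain X G m} (hc : IsCycle c) :
    ∃ R : FormalChain X G (m + 1), NullChain (c - formalBoundary R) := by
  borelize X
  obtain ⟨k, rfl⟩ : ∃ k, m = k + 1 := ⟨m - 1, by omega⟩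
  have h0 : formalBoundary c ∈ relations X G k := (QuotientAddGroup.eq_zero_iff _).1 hc
  have h1 := ae_cone_mem_relations (Measure.addHaar (G := X)) (by omega) h0
  have h2 : ∀ᵐ b ∂(Measure.addHaar (G := X)), ∀ σ ∈ c.support, b ∉ plane σ :=
    (ae_ball_iff c.support.countable_toSet).2 fun σ _ => ae_notMem_plane _ hm' σ
  obtain ⟨b, hb, hb'⟩ := (h1.and h2).exists
  refine ⟨cone G b c, ?_⟩
  have e : c = ∑ σ ∈ c.support, Finsupp.single σ (c σ) := (Finsupp.sum_single c).symm
  -- The cone over `∂c` is a relation for the chosen apex, so the cone over `c` fills `c`.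
  have h3 : formalBoundary (cone G b c) = c - cone G b (formalBoundary c) := by
    rw [e, map_sum, formalBoundary_sum, formalBoundary_sum, map_sum, ← Finset.sum_sub_distrib]
    exact Finset.sum_congr rfl fun σ hσ => formalBoundary_cone_single (hb' σ hσ) _
  rw [h3, sub_sub_cancel]
  exact nullChain_of_mem_relations hb

end

/-! ### Dilations of chains -/

section

variable {X : Type*} [AddCommGroup X] [Module ℝ X] {G : Type*} [AddCommGroup G] {m : ℕ}
  {r : ℝ} (hr : 0 < r) (a : X)

/-- The image of a formal sum by the dilation `x ↦ r x + a`. -/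
def dilateHom (G : Type*) [AddCommGroup G] : FormalChain X G m →+ FormalChain X G m :=
  Finsupp.mapDomain.addMonoidHom (dilate hr a)

theorem dilateHom_single (σ : Affine.Simplex ℝ X m) (g : G) :
    dilateHom hr a G (Finsupp.single σ g) = Finsupp.single (dilate hr a σ) g :=
  Finsupp.mapDomain_single

theorem dilateHom_eq_sum (c : FormalChain X G m) :
    dilateHom hr a G c = ∑ σ ∈ c.support, Finsupp.single (dilate hr a σ) (c σ) := rfl

theorem density_dilateHom (L : Fin m → X →ₗ[ℝ] ℝ) (x : X) (c : FormalChain X G m) :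
    density L (dilation r a x) (dilateHom hr a G c) = density L x c := by
  classical
  rw [dilateHom_eq_sum, map_sum, density_eq_sum L x c]
  refine Finset.sum_congr rfl fun σ _ => ?_
  rw [density_single, density_single, sign_frameDet_dilate, relInterior_dilate]
  simp only [(dilation_injective hr a).mem_set_image]

theorem Small.image {N : Set X} [FiniteDimensional ℝ X] {k : ℕ} (h : Small k N) (f : X →ᵃ[ℝ] X) :
    Small k (f '' N) := by
  classical
  obtain ⟨𝒜, h1, h2⟩ := h
  refine ⟨𝒜.image fun A => A.map f, ?_, ?_⟩
  · rw [Finset.forall_mem_image]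
    intro A hA
    rw [AffineSubspace.map_direction]
    exact (Submodule.finrank_map_le _ _).trans_lt (h1 A hA)
  · rintro _ ⟨x, hx, rfl⟩
    obtain ⟨A, hA, hxA⟩ := Set.mem_iUnion₂.1 (h2 hx)
    exact Set.mem_iUnion₂.2 ⟨_, Finset.mem_image_of_mem _ hA, x, hxA, rfl⟩

theorem NullChain.dilateHom [FiniteDimensional ℝ X] {c : FormalChain X G m} (hc : NullChain c) :
    NullChain (dilateHom hr a G c) := by
  obtain ⟨N, hN, h⟩ := hc
  refine ⟨dilation r a '' N, hN.image _, fun L x hx => ?_⟩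
  obtain ⟨y, rfl⟩ : ∃ y, dilation r a y = x := ⟨r⁻¹ • (x - a), by
    rw [dilation_apply, smul_inv_smul₀ hr.ne', sub_add_cancel]⟩
  rw [density_dilateHom]
  exact h L y fun hy => hx (Set.mem_image_of_mem _ hy)

theorem formalBoundary_dilateHom (c : FormalChain X G (m + 1)) :
    formalBoundary (dilateHom hr a G c) = dilateHom hr a G (formalBoundary c) := by
  conv_rhs => rw [show c = ∑ σ ∈ c.support, Finsupp.single σ (c σ) from (Finsupp.sum_single c).symm]
  rw [dilateHom_eq_sum, formalBoundary_sum, formalBoundary_sum, map_sum]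
  refine Finset.sum_congr rfl fun σ _ => ?_
  rw [formalBoundary_single, formalBoundary_single, map_sum]
  refine Finset.sum_congr rfl fun i _ => ?_
  rw [dilateHom_single]
  rfl

end

/-! ### The triangle inequality from lower semicontinuity -/

section

variable {X : Type*} [NormedAddCommGroup X] [NormedSpace ℝ X] {G : Type*} [NormedAddCommGroup G]
  {m : ℕ}

theorem formalMass_dilateHom_le {r : ℝ} (hr : 0 < r) (a : X) (c : FormalChain X G m) :
    formalMass (hausdorff m) (dilateHom hr a G c) ≤
      ENNReal.ofReal r ^ m * formalMass (hausdorff m) c := by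
  rw [dilateHom_eq_sum]
  refine (formalMass_sum_le _ _).trans ?_
  rw [formalMass, Finsupp.sum, Finset.mul_sum]
  refine Finset.sum_le_sum fun σ _ => ?_
  rw [formalMass_single, hausdorff_body_dilate, mul_left_comm]

/-- Inside a simplex there are `q ^ m` nonoverlapping dilated copies of ratio `1 / (m q)`. -/
theorem exists_grid (σ : Affine.Simplex ℝ X m) (q : ℕ) {r : ℝ} (hr : 0 < r)
    (hrq : r * (m * q) = 1) : ∃ a : (Fin m → Fin q) → X,
      (∀ n, relInterior (dilate hr (a n) σ) ⊆ relInterior σ) ∧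
      ∀ n n', n ≠ n' → Disjoint (relInterior (dilate hr (a n) σ))
        (relInterior (dilate hr (a n') σ)) := by
  -- Copy `n` is where the coordinates exceed `t n`: multiples of `r` in the last `m` coordinates,
  -- and the first entry makes the sum `1 - r`. That entry is nonnegative because `m (q - 1) r = 1 -
  -- m r ≤ 1 - r`.
  let t : (Fin m → Fin q) → Fin (m + 1) → ℝ := fun n =>
    Fin.cons (1 - r - ∑ j, (n j : ℝ) * r) fun j => n j * r
  have ht1 : ∀ n, r = 1 - ∑ i, t n i := fun n => by
    rw [Fin.sum_univ_succ]
    simp only [t, Fin.cons_zero, Fin.cons_succ]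
    ring
  have ht0 : ∀ n i, 0 ≤ t n i := by
    intro n i
    refine Fin.cases ?_ (fun j => ?_) i
    · have h1 : ∑ j, (n j : ℝ) * r ≤ m * ((q - 1) * r) := by
        refine (Finset.sum_le_card_nsmul _ _ ((q - 1) * r) fun j _ => ?_).trans_eq (by simp)
        have : (n j : ℝ) + 1 ≤ q := by exact_mod_cast (n j).2
        exact mul_le_mul_of_nonneg_right (by linarith) hr.le
      have h2 : (1 : ℝ) ≤ m := by
        rcases Nat.eq_zero_or_pos m with rfl | h
        · simp at hrq
        · exact_mod_cast h
      have h3 := mul_le_mul_of_nonneg_right h2 hr.le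
      simp only [t, Fin.cons_zero]
      nlinarith
    · simp only [t, Fin.cons_succ]
      positivity
  have key : ∀ n x, x ∈ relInterior (dilate hr (∑ i, t n i • σ.points i) σ) ↔
      x ∈ plane σ ∧ ∀ i, t n i < coord σ i x := by
    intro n x
    have hr' : 0 < 1 - ∑ i, t n i := ht1 n ▸ hr
    have e : dilate hr (∑ i, t n i • σ.points i) σ = dilate hr' (∑ i, t n i • σ.points i) σ := by
      congr 1
      exact ht1 n
    rw [e]
    exact mem_relInterior_dilate_iff σ hr'
  have hdisj : ∀ n n' j, (n j : ℕ) < n' j →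
      Disjoint (relInterior (dilate hr (∑ i, t n i • σ.points i) σ))
        (relInterior (dilate hr (∑ i, t n' i • σ.points i) σ)) := by
    intro n n' j hlt
    rw [Set.disjoint_left]
    intro x hx hx'
    have h1 := ((key n x).1 hx).2
    have h2 := ((key n' x).1 hx').2 j.succ
    -- In copy `n` the other coordinates already use up their lower bounds, so coordinate `j` is at
    -- most `(n j + 1) * r`, which is at most `n' j * r`; copy `n'` requires more.
    have h3 : ∑ i ∈ Finset.univ.erase j.succ, t n i ≤
        ∑ i ∈ Finset.univ.erase j.succ, coord σ i x :=
      Finset.sum_le_sum fun i _ => (h1 i).le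
    have h4 := Finset.add_sum_erase Finset.univ (t n) (Finset.mem_univ j.succ)
    have h5 := Finset.add_sum_erase Finset.univ (fun i => coord σ i x) (Finset.mem_univ j.succ)
    rw [sum_coord] at h5
    have h6 := ht1 n
    have h7 : (n j : ℝ) + 1 ≤ n' j := by exact_mod_cast hlt
    have h8 := mul_le_mul_of_nonneg_right h7 hr.le
    have e1 : t n j.succ = n j * r := rfl
    have e2 : t n' j.succ = n' j * r := rfl
    linarith
  refine ⟨fun n => ∑ i, t n i • σ.points i, fun n x hx => ?_, fun n n' hne => ?_⟩
  · rw [key] at hx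
    exact mem_relInterior_iff.2 ⟨hx.1, fun i => (ht0 n i).trans_lt (hx.2 i)⟩
  · obtain ⟨j, hj⟩ := Function.ne_iff.1 hne
    rcases lt_or_gt_of_ne fun h => hj (Fin.ext h) with h | h
    · exact hdisj n n' j h
    · exact (hdisj n' n j h).symm

variable [FiniteDimensional ℝ X]

/-- On the union `U` of the small copies of `σ` the densities of `g ⟦σ⟧` and of its copies cancel;
there remain `σ` outside `U` and the copies of `w`. The additive form avoids truncated subtraction.
-/
theorem hausdorffMass_sub_sum_dilateHom_le {ι : Type*} [Fintype ι] {r : ℝ} (hr : 0 < r) (a : ι → X)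
    {σ : Affine.Simplex ℝ X m} (hsub : ∀ n, relInterior (dilate hr (a n) σ) ⊆ relInterior σ)
    (hdisj : ∀ n n', n ≠ n' → Disjoint (relInterior (dilate hr (a n) σ))
      (relInterior (dilate hr (a n') σ))) (g : G) (w : FormalChain X G m) :
    hausdorffMass (toChain (Finsupp.single σ g -
        ∑ n, dilateHom hr (a n) G (Finsupp.single σ g + w))) +
      Fintype.card ι * ENNReal.ofReal r ^ m * (‖g‖ₑ * hausdorff m (body σ)) ≤
    ‖g‖ₑ * hausdorff m (body σ) +
      Fintype.card ι * ENNReal.ofReal r ^ m * formalMass (hausdorff m) w := by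
  classical
  borelize X
  let μ := normalizedHausdorff X m
  let U : Set X := ⋃ n, relInterior (dilate hr (a n) σ)
  have hU : MeasurableSet U := MeasurableSet.iUnion fun n => measurableSet_relInterior _
  have hUσ : U ⊆ relInterior σ := Set.iUnion_subset hsub
  have hμU : μ U = Fintype.card ι * ENNReal.ofReal r ^ m * hausdorff m (body σ) := by
    rw [measure_iUnion hdisj fun n => measurableSet_relInterior _, tsum_fintype]
    have : ∀ n, μ (relInterior (dilate hr (a n) σ)) =
        ENNReal.ofReal r ^ m * hausdorff m (body σ) := fun n => by
      rw [measure_relInterior, ← hausdorff_eq, hausdorff_body_dilate]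
    simp_rw [this]
    simp [mul_assoc]
  have hdiff : μ (relInterior σ \ U) + μ U = hausdorff m (body σ) := by
    have := measure_sdiff_add_inter (μ := μ) (relInterior σ) hU
    rwa [Set.inter_eq_self_of_subset_right hUσ, measure_relInterior, ← hausdorff_eq] at this
  let F : ι → X → ℝ≥0∞ := fun n x => ∑ τ ∈ (dilateHom hr (a n) G w).support,
    (relInterior τ).indicator (fun _ => ‖dilateHom hr (a n) G w τ‖ₑ) x
  have hF : ∀ n, Measurable (F n) := fun n => Finset.measurable_fun_sum _ fun τ _ =>
    measurable_const.indicator (measurableSet_relInterior τ)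
  have hbound : ∀ L, ∀ x ∉ (∅ : Set X), ‖density L x (Finsupp.single σ g -
      ∑ n, dilateHom hr (a n) G (Finsupp.single σ g + w))‖ₑ ≤
        (relInterior σ \ U).indicator (fun _ => ‖g‖ₑ) x + ∑ n, F n x := by
    intro L x _
    have e : density L x (Finsupp.single σ g -
        ∑ n, dilateHom hr (a n) G (Finsupp.single σ g + w)) =
        (density L x (Finsupp.single σ g) -
          ∑ n, density L x (Finsupp.single (dilate hr (a n) σ) g)) -
        ∑ n, density L x (dilateHom hr (a n) G w) := by
      simp only [map_sub, map_sum, map_add, dilateHom_single, Finset.sum_add_distrib, sub_sub]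
    rw [e]
    refine enorm_sub_le.trans (add_le_add ?_ ((enorm_sum_le _ _).trans
      (Finset.sum_le_sum fun n _ => enorm_density_le L x _)))
    by_cases hxU : x ∈ U
    · obtain ⟨n, hn⟩ := Set.mem_iUnion.1 hxU
      rw [Finset.sum_eq_single n (fun n' _ hne => density_single_of_notMem
          (Set.disjoint_left.1 (hdisj n n' hne.symm) hn) g) (by simp),
        density_single_of_mem hn, density_single_of_mem (hsub n hn), sign_frameDet_dilate, sub_self,
        enorm_zero]
      exact bot_le
    · rw [Finset.sum_eq_zero fun n _ => density_single_of_notMem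
        (fun hx => hxU (Set.mem_iUnion.2 ⟨n, hx⟩)) g, sub_zero]
      by_cases hx : x ∈ relInterior σ
      · rw [Set.indicator_of_mem (Set.mem_sdiff_of_mem hx hxU), density_single_of_mem hx]
        rcases SignType.sign (frameDet L σ.points) with _ | _ | _ <;> simp
      · rw [density_single_of_notMem hx, enorm_zero]
        exact bot_le
  have hmass := hausdorffMass_le_lintegral (small_empty m) hbound
  rw [lintegral_add_right _ (Finset.measurable_fun_sum _ fun n _ => hF n),
    lintegral_indicator_const ((measurableSet_relInterior σ).diff hU),
    lintegral_finsetSum _ fun n _ => hF n] at hmass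
  have hsum : ∑ n, ∫⁻ x, F n x ∂μ ≤
      Fintype.card ι * ENNReal.ofReal r ^ m * formalMass (hausdorff m) w := by
    refine (Finset.sum_le_card_nsmul _ _ (ENNReal.ofReal r ^ m * formalMass (hausdorff m) w)
      fun n _ => ?_).trans_eq (by simp [mul_assoc])
    exact (lintegral_sum_indicator _).le.trans (formalMass_dilateHom_le hr (a n) w)
  calc _ ≤ ‖g‖ₑ * μ (relInterior σ \ U) +
        Fintype.card ι * ENNReal.ofReal r ^ m * formalMass (hausdorff m) w + ‖g‖ₑ * μ U := by
        refine add_le_add (hmass.trans (add_le_add_right hsum _)) (le_of_eq ?_)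
        rw [hμU]
        ring
    _ = _ := by rw [add_right_comm, ← mul_add, hdiff]

/-- Take `Q = 0` in the flat norm. -/
theorem exists_flatNorm_le (ip : InnerProductSpace.Core ℝ X) (m : ℕ) :
    ∃ C : ℝ≥0∞, C ≠ ∞ ∧ ∀ (c : FormalChain X G m) (R : FormalChain X G (m + 1)),
      NullChain (c - formalBoundary R) →
        flatNorm ip (toChain c) ≤ C * formalMass (hausdorff (m + 1)) R := by
  obtain ⟨C, hC0, hC, H, -⟩ := exists_euclideanHausdorff_comparison ip (m + 1)
  refine ⟨C, hC, fun c R h => ?_⟩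
  have h0 : toChain c = 0 + toChain (formalBoundary R) := by
    rw [zero_add]
    exact toChain_eq_iff.2 (mem_relations_of_nullChain h)
  unfold flatNorm
  refine (iInf₂_le_of_le (0 : PolyhedralChain X G m) R (iInf_le_of_le h0 le_rfl)).trans ?_
  have h1 : euclideanMass ip (0 : PolyhedralChain X G m) = 0 :=
    le_antisymm ((mass_le_formalMass_of_nonOverlapping (c := 0) fun σ hσ => by
      simp at hσ).trans_eq formalMass_zero) bot_le
  rw [h1, zero_add]
  exact (mass_le_mul H _ hC0 hC).trans (mul_le_mul_right (hausdorffMass_le_formalMass R) _)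

theorem HausdorffMassLowerSemicontinuous.triangleInequalityForCycles
    {ip : InnerProductSpace.Core ℝ X} (h : HausdorffMassLowerSemicontinuous X G ip m) (hm : 1 ≤ m)
    (hm' : m < Module.finrank ℝ X) : TriangleInequalityForCycles X G m := by
  intro κ σ g hz
  borelize X
  rw [Fin.sum_univ_succ] at hz
  set w : FormalChain X G m := ∑ k : Fin κ, Finsupp.single (σ k.succ) (g k.succ) with hw
  obtain ⟨R, hR⟩ := hz.exists_filling hm hm'
  have hm0 : (0 : ℝ) < m := by exact_mod_cast hm
  let r : ℕ → ℝ := fun q => ((m : ℝ) * (q + 1 : ℕ))⁻¹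
  have hr : ∀ q, 0 < r q := fun q => by positivity
  choose a ha1 ha2 using fun q => exists_grid (σ 0) (q + 1) (hr q)
    (inv_mul_cancel₀ (by positivity))
  let S : ℕ → FormalChain X G m := fun q =>
    ∑ n, dilateHom (hr q) (a q n) G (Finsupp.single (σ 0) (g 0) + w)
  -- The fraction `(q + 1) ^ m * r q ^ m = m⁻ᵐ` of `σ 0` filled by the copies, independent of `q`.
  let ρ : ℝ≥0∞ := ENNReal.ofReal (m : ℝ)⁻¹ ^ m
  have hρ : ∀ q, (Fintype.card (Fin m → Fin (q + 1)) : ℝ≥0∞) * ENNReal.ofReal (r q) ^ m = ρ := by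
    intro q
    have h1 : (Fintype.card (Fin m → Fin (q + 1)) : ℝ≥0∞) = ENNReal.ofReal (q + 1 : ℕ) ^ m := by
      rw [ENNReal.ofReal_natCast]
      simp
    rw [h1, ← mul_pow, ← ENNReal.ofReal_mul (by positivity)]
    congr 2
    simp only [r]
    have : ((q + 1 : ℕ) : ℝ) ≠ 0 := by positivity
    field_simp
  have hρ0 : ρ ≠ 0 := pow_ne_zero _ (ENNReal.ofReal_pos.2 (inv_pos.2 hm0)).ne'
  have hρt : ρ ≠ ∞ := ENNReal.pow_ne_top ENNReal.ofReal_ne_top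
  let A := ‖g 0‖ₑ * hausdorff m (body (σ 0))
  have hA : A ≠ ∞ := ENNReal.mul_ne_top enorm_ne_top (hausdorff_body_ne_top _)
  have hmass : ∀ q, hausdorffMass (toChain (Finsupp.single (σ 0) (g 0) - S q)) + ρ * A ≤
      A + ρ * formalMass (hausdorff m) w := fun q => by
    have := hausdorffMass_sub_sum_dilateHom_le (hr q) (a q) (ha1 q) (ha2 q) (g 0) w
    rwa [hρ q] at this
  obtain ⟨C, hC, hflat⟩ := exists_flatNorm_le (G := G) ip m
  have hlim : Tendsto (fun q => flatNorm ip (toChain (Finsupp.single (σ 0) (g 0)) -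
      toChain (Finsupp.single (σ 0) (g 0) - S q))) atTop (𝓝 0) := by
    -- The copies of `R` scale with exponent `m + 1`, one more than their number compensates, which
    -- leaves the factor `r q → 0`.
    have hle : ∀ q, flatNorm ip (toChain (Finsupp.single (σ 0) (g 0)) -
        toChain (Finsupp.single (σ 0) (g 0) - S q)) ≤
        C * ρ * formalMass (hausdorff (m + 1)) R * ENNReal.ofReal (r q) := by
      intro q
      have e : toChain (Finsupp.single (σ 0) (g 0)) - toChain (Finsupp.single (σ 0) (g 0) - S q) =
          toChain (S q) := by
        change toChain (Finsupp.single (σ 0) (g 0) - (Finsupp.single (σ 0) (g 0) - S q)) = _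
        rw [sub_sub_cancel]
      rw [e]
      have h1 : S q - formalBoundary (∑ n, dilateHom (hr q) (a q n) G R) =
          ∑ n, dilateHom (hr q) (a q n) G
            (Finsupp.single (σ 0) (g 0) + w - formalBoundary R) := by
        simp only [S, formalBoundary_sum, formalBoundary_dilateHom, map_sub, Finset.sum_sub_distrib]
      have h2 : NullChain (S q - formalBoundary (∑ n, dilateHom (hr q) (a q n) G R)) := by
        rw [h1]
        exact Finset.sum_induction _ NullChain (fun _ _ => NullChain.add) nullChain_zero
          fun n _ => hR.dilateHom (hr q) (a q n)
      refine (hflat _ _ h2).trans ?_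
      calc C * formalMass (hausdorff (m + 1)) (∑ n, dilateHom (hr q) (a q n) G R)
          ≤ C * ((Fintype.card (Fin m → Fin (q + 1)) : ℝ≥0∞) * (ENNReal.ofReal (r q) ^ (m + 1) *
              formalMass (hausdorff (m + 1)) R)) := by
            refine mul_le_mul_right ((formalMass_sum_le _ _).trans ?_) _
            refine (Finset.sum_le_card_nsmul _ _ _
              fun n _ => formalMass_dilateHom_le (hr q) (a q n) R).trans_eq ?_
            rw [nsmul_eq_mul]
            rfl
        _ = C * ρ * formalMass (hausdorff (m + 1)) R * ENNReal.ofReal (r q) := by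
            rw [← hρ q, pow_succ]
            ring
    have hK : C * ρ * formalMass (hausdorff (m + 1)) R ≠ ∞ :=
      ENNReal.mul_ne_top (ENNReal.mul_ne_top hC hρt) (formalMass_ne_top R)
    have hr0 : Tendsto r atTop (𝓝 0) := by
      have h1 := tendsto_one_div_add_atTop_nhds_zero_nat (𝕜 := ℝ)
      have h2 := h1.const_mul (m : ℝ)⁻¹
      rw [mul_zero] at h2
      refine h2.congr fun q => ?_
      simp only [r]
      push_cast
      rw [mul_inv, one_div]
    have h3 := ENNReal.Tendsto.const_mul (ENNReal.tendsto_ofReal hr0) (Or.inr hK)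
    rw [ENNReal.ofReal_zero, mul_zero] at h3
    exact tendsto_of_tendsto_of_tendsto_of_le_of_le tendsto_const_nhds h3 (fun _ => bot_le) hle
  have hlsc := h _ _ hlim
  have hle : A ≤ A + ρ * formalMass (hausdorff m) w - ρ * A := by
    rw [hausdorffMass_single] at hlsc
    refine hlsc.trans ?_
    refine (liminf_le_liminf (Eventually.of_forall fun q => ENNReal.le_sub_of_add_le_right
      (ENNReal.mul_ne_top hρt hA) (hmass q))).trans_eq ?_
    exact liminf_const _
  -- All these masses are finite and `ρ` is neither zero nor infinite, so `A` and then `ρ` can be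
  -- cancelled.
  have hle' : A + ρ * A ≤ A + ρ * formalMass (hausdorff m) w := by
    refine (add_le_add_left hle _).trans_eq (tsub_add_cancel_of_le ?_)
    exact le_add_self.trans (hmass 0)
  rw [ENNReal.add_le_add_iff_left hA, ENNReal.mul_le_mul_iff_right hρ0 hρt] at hle'
  simp_rw [hausdorffMass_single]
  refine hle'.trans ((formalMass_sum_le _ _).trans_eq ?_)
  simp_rw [formalMass_single]

end

end PolyhedralGChain

end

theorem mainTheorem4 {X : Type*} [NormedAddCommGroup X] [NormedSpace ℝ X] [FiniteDimensional ℝ X]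
    (ip : InnerProductSpace.Core ℝ X) {G : Type*} [NormedAddCommGroup G] [CompleteSpace G]
    (m : ℕ) (hm : 1 ≤ m) (hm' : m < Module.finrank ℝ X) :
    PolyhedralGChain.TriangleInequalityForCycles X G m ↔
      PolyhedralGChain.HausdorffMassLowerSemicontinuous X G ip m :=
  ⟨fun h => h.lowerSemicontinuous ip hm, fun h => h.triangleInequalityForCycles hm hm'⟩
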